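/- **Setting.** For $\rho>2$ let $$M_\rho=\Bigl\{x\in\mathbb R^3 : \bigl(\sqrt{x_1^2+x_2^2}-\rho\bigr)^2+x_3^2\le 1\Bigr\}.$$ For $n\in\mathbb N$ let $D_n$ be the group of Euclidean isometries generated by the rotation of angle $\pi$ around the $x_1$-axis and the rotation of angle $2\pi/n$ around the $x_3$-axis. For $k\in\{0,\dots,2n-1\}$ let $$\xi_k=\bigl\{\bigl(r\cos\tfrac{\pi k}{n},\,r\sin\tfrac{\pi k}{n},\,0\bigr) : r\in[\rho-1,\rho+1]\bigr\},$$ and let $$M_{1/n}=\bigl\{\bigl((\rho+y_1)\cos\varphi,\,(\rho+y_1)\sin\varphi,\,y_2\bigr) : y_1^2+y_2^2\le1,\ 0\le\varphi\le 2\pi/n\bigr\}$$ be the closed sector of $M_\rho$ of toroidal angle $2\pi/n$. Let $\mathcal H^2$ be the two-dimensional Hausdorff measure, normalised to be area, and $\mathcal H^3$ the Lebesgue measure on $\mathbb R^3$. A *$D_n$-sweepout* of $M_\rho$ is a family $\{\Sigma_t\}_{t\in[0,1]}$ of closed, $D_n$-equivariant (that is, $D_n$-invariant) subsets of $M_\rho$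 such that for every $t\in(0,1)$ the set $\Sigma_t$ is a smooth, properly embedded surface in $M_\rho$ (a smooth embedded surface with $\partial\Sigma_t=\Sigma_t\cap\partial M_\rho$), varying smoothly in $t\in(0,1)$, and such that $\Sigma_t$ varies continuously, in the sense of varifolds, in $t\in[0,1]$: for every continuous function $\phi$ of a point and a plane, $\int_{\Sigma_t}\phi(x,T_x\Sigma_t)\,d\mathcal H^2(x)$ exists and is continuous in $t\in[0,1]$. **Corollary (Sweepout construction).** For every $\rho>2$ and every integer $n\ge 5(\rho+1)/2$ there exists a $D_n$-sweepout $\{\Sigma_t\}_{t\in[0,1]}$ of $M_\rho$ with the following properties. 1. $\mathcal H^2(\Sigma_0)=\mathcal H^2(\Sigma_1)=n\pi$, and $\mathcal H^2(\Sigma_t)<2n\pi$ for every $t\in[0,1]$. 2. For every $t\in(0,1)$ and $k\in\{0,\dots,2n-1\}$ the surface $\Sigma_t$ contains $\xi_k$ if $k$ is even; if $k$ is odd, $\Sigma_t\cap\xi_k$ is nonempty and at each of its points the tangent plane of $\Sigma_t$ is orthogonal to $\xi_k$. 3. For every $t\in(0,1)$ the surface $\Sigma_t$ is, topologically, a compact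 Möbius band if $n$ is odd and a compact annulus if $n$ is even. 4. For every $t\in[0,1]$ there is a set $E_t\subset M_{1/n}$ of finite perimeter such that - for every $0<t<1$ the set $\Sigma_t\cap M_{1/n}$ is the relative perimeter of $E_t$ in $M_{1/n}$, that is, $(\Sigma_t\cap M_{1/n})\setminus\partial M_{1/n}=\partial E_t\setminus\partial M_{1/n}$, and every ball centred at a point of this set meets both $E_t$ and the complement of $E_t$ in positive volume; - $E_0=\emptyset$ and $E_1=M_{1/n}$; - $\displaystyle\lim_{t\to t_0}\mathcal H^3(E_t\,\triangle\,E_{t_0})=0$ for every $t_0\in[0,1]$, where $t\in[0,1]$. -/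

import Mathlib

open Set Filter Topology MeasureTheory
open scoped ContDiff ENNReal

noncomputable section

namespace Toroid

/-- Euclidean three-space; the coordinates `x₁, x₂, x₃` are `x 0, x 1, x 2`. -/
abbrev E3 := EuclideanSpace ℝ (Fin 3)

/-- Area: the two-dimensional Hausdorff measure, normalised so that it agrees with Lebesgue
measure on Euclidean planes. -/
abbrev area : Measure E3 := μHE[2]

/-! ### The ambient manifold, its sectors, segments and symmetries -/

/-- The compact toroid `M_ρ`. -/
def toroid (ρ : ℝ) : Set E3 :=
  {x | (Real.sqrt ((x 0) ^ 2 + (x 1) ^ 2) - ρ) ^ 2 + (x 2) ^ 2 ≤ 1}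

/-- The closed sector `M_α` of `M_ρ` of toroidal angle `2πα`, starting at toroidal angle `0`. -/
def sector (ρ α : ℝ) : Set E3 :=
  {x | ∃ y₁ y₂ φ : ℝ, y₁ ^ 2 + y₂ ^ 2 ≤ 1 ∧ 0 ≤ φ ∧ φ ≤ 2 * Real.pi * α ∧
    x = !₂[(ρ + y₁) * Real.cos φ, (ρ + y₁) * Real.sin φ, y₂]}

/-- The horizontal unit vector at angle `πk/n`. -/
def segmentDir (n k : ℕ) : E3 :=
  !₂[Real.cos (Real.pi * k / n), Real.sin (Real.pi * k / n), 0]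

/-- The horizontal segment `ξ_k`. -/
def segment (ρ : ℝ) (n k : ℕ) : Set E3 :=
  {x | ∃ r ∈ Icc (ρ - 1) (ρ + 1), x = r • segmentDir n k}

/-- The rotation by angle `π` around the `x₁`-axis. -/
def halfTurn : E3 ≃ₗᵢ[ℝ] E3 where
  toFun x := !₂[x 0, -x 1, -x 2]
  invFun x := !₂[x 0, -x 1, -x 2]
  map_add' x y := by
    ext i; fin_cases i <;> simp <;> ring
  map_smul' c x := by
    ext i; fin_cases i <;> simp
  left_inv x := by
    ext i; fin_cases i <;> simp
  right_inv x := by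
    ext i; fin_cases i <;> simp
  norm_map' x := by
    simp [EuclideanSpace.norm_eq, Fin.sum_univ_three]

/-- The rotation by angle `φ` around the `x₃`-axis. -/
def rotation (φ : ℝ) : E3 ≃ₗᵢ[ℝ] E3 where
  toFun x := !₂[Real.cos φ * x 0 - Real.sin φ * x 1, Real.sin φ * x 0 + Real.cos φ * x 1, x 2]
  invFun x := !₂[Real.cos φ * x 0 + Real.sin φ * x 1, -Real.sin φ * x 0 + Real.cos φ * x 1, x 2]
  map_add' x y := by
    ext i; fin_cases i <;> simp <;> ring
  map_smul' c x := by
    ext i; fin_cases i <;> simp <;> ring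
  left_inv x := by
    ext i; fin_cases i <;> simp
    · linear_combination (x 0) * Real.sin_sq_add_cos_sq φ
    · linear_combination (x 1) * Real.sin_sq_add_cos_sq φ
  right_inv x := by
    ext i; fin_cases i <;> simp
    · linear_combination (x 0) * Real.sin_sq_add_cos_sq φ
    · linear_combination (x 1) * Real.sin_sq_add_cos_sq φ
  norm_map' x := by
    simp only [EuclideanSpace.norm_eq, Fin.sum_univ_three, Real.norm_eq_abs, sq_abs]
    congr 1
    simp
    linear_combination ((x 0) ^ 2 + (x 1) ^ 2) * Real.sin_sq_add_cos_sq φ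

/-- The dihedral group `D_n` of order `2n`, as a group of Euclidean isometries. -/
def dihedral (n : ℕ) : Subgroup (E3 ≃ₗᵢ[ℝ] E3) :=
  Subgroup.closure {halfTurn, rotation (2 * Real.pi / n)}

/-- `S` is equivariant with respect to the group `G` of isometries. -/
def IsEquivariant (G : Subgroup (E3 ≃ₗᵢ[ℝ] E3)) (S : Set E3) : Prop :=
  ∀ g ∈ G, g '' S = S

/-! ### Smooth properly embedded surfaces and smooth families of them -/

/-- Near `p`, the set `S` is a smooth surface without boundary: the zero set of a smooth function
with nonvanishing differential at `p`. -/
def IsInteriorPoint (S : Set E3) (p : E3) : Prop :=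
  ∃ (U : Set E3) (f : E3 → ℝ), IsOpen U ∧ p ∈ U ∧ ContDiffOn ℝ ∞ f U ∧
    fderiv ℝ f p ≠ 0 ∧ ∀ x ∈ U, x ∈ S ↔ f x = 0

/-- Near `p`, the set `S` is a smooth surface with boundary, and `p` is a boundary point: `S` is
`{f = 0, g ≥ 0}` with `f(p) = g(p) = 0`, where `f, g` are smooth with linearly independent
differentials at `p`. -/
def IsBoundaryPoint (S : Set E3) (p : E3) : Prop :=
  ∃ (U : Set E3) (f g : E3 → ℝ), IsOpen U ∧ p ∈ U ∧ ContDiffOn ℝ ∞ f U ∧ ContDiffOn ℝ ∞ g U ∧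
    f p = 0 ∧ g p = 0 ∧ LinearIndependent ℝ ![fderiv ℝ f p, fderiv ℝ g p] ∧
    ∀ x ∈ U, x ∈ S ↔ f x = 0 ∧ 0 ≤ g x

/-- `S` is a smooth, properly embedded surface in `M`: a smooth embedded surface with
boundary `∂S = S ∩ ∂M`. -/
def IsProperlyEmbedded (M S : Set E3) : Prop :=
  S ⊆ M ∧ IsClosed S ∧
    (∀ p ∈ S, p ∉ frontier M → IsInteriorPoint S p) ∧
    (∀ p ∈ S, p ∈ frontier M → IsBoundaryPoint S p)

/-- Near `(t₀, p)`, the sets `S t` are given by a function which is smooth jointly in `(t, x)` and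
whose differential in `x` does not vanish. -/
def IsInteriorFamilyPoint (S : ℝ → Set E3) (t₀ : ℝ) (p : E3) : Prop :=
  ∃ (U : Set (ℝ × E3)) (f : ℝ × E3 → ℝ), IsOpen U ∧ (t₀, p) ∈ U ∧ ContDiffOn ℝ ∞ f U ∧
    fderiv ℝ (fun x => f (t₀, x)) p ≠ 0 ∧ ∀ q ∈ U, q.2 ∈ S q.1 ↔ f q = 0

/-- The analogue of `IsInteriorFamilyPoint` at a boundary point. -/
def IsBoundaryFamilyPoint (S : ℝ → Set E3) (t₀ : ℝ) (p : E3) : Prop :=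
  ∃ (U : Set (ℝ × E3)) (f g : ℝ × E3 → ℝ), IsOpen U ∧ (t₀, p) ∈ U ∧
    ContDiffOn ℝ ∞ f U ∧ ContDiffOn ℝ ∞ g U ∧ f (t₀, p) = 0 ∧ g (t₀, p) = 0 ∧
    LinearIndependent ℝ
      ![fderiv ℝ (fun x => f (t₀, x)) p, fderiv ℝ (fun x => g (t₀, x)) p] ∧
    ∀ q ∈ U, q.2 ∈ S q.1 ↔ f q = 0 ∧ 0 ≤ g q

/-- The properly embedded surfaces `S t` in `M` vary smoothly in `t ∈ (0,1)`: the total space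
`{(t, x) | x ∈ S t}` is a smooth hypersurface with boundary in `(0,1) × M`, closed in `(0,1) × M`
and transverse to the time slices. -/
def VariesSmoothly (M : Set E3) (S : ℝ → Set E3) : Prop :=
  ∀ t₀ ∈ Ioo (0 : ℝ) 1,
    (∀ p ∈ S t₀, p ∉ frontier M → IsInteriorFamilyPoint S t₀ p) ∧
    (∀ p ∈ S t₀, p ∈ frontier M → IsBoundaryFamilyPoint S t₀ p) ∧
    (∀ p ∉ S t₀, ∀ᶠ q in 𝓝 (t₀, p), q.2 ∉ S q.1)

/-- The tangent space of `S` at `p`, the linear span of the tangent directions to `S` at `p`; for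
a smooth surface, possibly with boundary, it is the tangent plane. -/
def tangentSpace (S : Set E3) (p : E3) : Submodule ℝ E3 :=
  Submodule.span ℝ (tangentConeAt ℝ S p)

/-! ### Varifolds -/

/-- The test function `φ` evaluated at `p` and at the tangent plane of `S` at `p`. A plane is
represented by the orthogonal projection onto it, which embeds the Grassmannian as a compact set
of endomorphisms. -/
def varifoldIntegrand (S : Set E3) (φ : C(E3 × (E3 →L[ℝ] E3), ℝ)) (p : E3) : ℝ :=
  φ (p, (tangentSpace S p).starProjection)

/-- The varifolds induced by the sets `S t` are well defined and depend continuously (in the weak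
topology) on `t ∈ [0,1]`. -/
def IsVarifoldContinuous (S : ℝ → Set E3) : Prop :=
  ∀ φ : C(E3 × (E3 →L[ℝ] E3), ℝ),
    (∀ t ∈ Icc (0 : ℝ) 1, IntegrableOn (varifoldIntegrand (S t) φ) (S t) area) ∧
    ContinuousOn (fun t => ∫ p in S t, varifoldIntegrand (S t) φ p ∂area) (Icc 0 1)

/-- A one-parameter `G`-sweepout `{S t}`, `t ∈ [0,1]`, of `M`. -/
structure IsSweepout (G : Subgroup (E3 ≃ₗᵢ[ℝ] E3)) (M : Set E3) (S : ℝ → Set E3) : Prop where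
  subset : ∀ t ∈ Icc (0 : ℝ) 1, S t ⊆ M
  isClosed : ∀ t ∈ Icc (0 : ℝ) 1, IsClosed (S t)
  equivariant : ∀ t ∈ Icc (0 : ℝ) 1, IsEquivariant G (S t)
  properlyEmbedded : ∀ t ∈ Ioo (0 : ℝ) 1, IsProperlyEmbedded M (S t)
  smooth : VariesSmoothly M S
  varifoldContinuous : IsVarifoldContinuous S

/-! ### Orthogonal intersection, topological type, sets of finite perimeter -/

/-- The surface `S` meets the segment `ξ_k`, and at every intersection point its tangent plane is
the orthogonal complement of the direction of `ξ_k`. -/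
def MeetsOrthogonally (ρ : ℝ) (n k : ℕ) (S : Set E3) : Prop :=
  (S ∩ segment ρ n k).Nonempty ∧
    ∀ p ∈ S ∩ segment ρ n k, tangentSpace S p = (ℝ ∙ segmentDir n k)ᗮ

/-- The identification of `(0, y)` with `(1, -y)`. -/
def mobiusRel (p q : Icc (0 : ℝ) 1 × Icc (-1 : ℝ) 1) : Prop :=
  (p.1 : ℝ) = 0 ∧ (q.1 : ℝ) = 1 ∧ (q.2 : ℝ) = -(p.2 : ℝ)

/-- The compact Möbius band: the rectangle `[0,1] × [-1,1]` with `(0, y)` glued to `(1, -y)`. -/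
abbrev MobiusBand : Type := Quot mobiusRel

/-- The compact annulus. -/
abbrev Annulus : Type := Circle × Icc (0 : ℝ) 1

/-- The divergence of a vector field. -/
def divergence (X : E3 → E3) (x : E3) : ℝ :=
  ∑ i : Fin 3, fderiv ℝ X x (EuclideanSpace.single i 1) i

/-- Sets of finite perimeter in Euclidean three-space. -/
def HasFinitePerimeter (A : Set E3) : Prop :=
  MeasurableSet A ∧ ∃ C : ℝ, ∀ X : E3 → E3, ContDiff ℝ 1 X → HasCompactSupport X →
    (∀ x, ‖X x‖ ≤ 1) → ∫ x in A, divergence X x ≤ C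

/-- `S ∩ N` is the relative perimeter of `A` in `N`: away from `∂N`, it is the boundary of `A`, and
both `A` and its complement have positive volume near each of its points (so that this boundary is
the support of the perimeter measure of `A`). -/
def IsRelativePerimeter (N A S : Set E3) : Prop :=
  (S ∩ N) \ frontier N = frontier A \ frontier N ∧
    ∀ p ∈ (S ∩ N) \ frontier N, ∀ r > 0,
      0 < volume (A ∩ Metric.ball p r) ∧ 0 < volume (Metric.ball p r \ A)

end Toroid

end

/-! With `u = cos(πt)` and `τ = sin(πt)`, the section of `Σ_t` at toroidal angle `φ` is the chord of
the unit disc through `(-u, 0)` in direction `(τ cos θ, sin θ)`, where `θ = nφ/2`. For `0 < t < 1`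
the chord turns with `φ`; as `τ → 0` the turning concentrates at the angles `2πk/n`, and the limits
at both ends consist of `n` meridian discs and a circle. The surface is the zero set of `profile`.
The rotation by `2π/n` adds `π` to `θ` and only changes the sign of `profile`; so does the half
turn. Hence the surface is equivariant.

The normalisation `u² + τ² = 1` does two things. It makes the zero set transversal to the boundary
of the toroid (`sq_transversality`). It also makes `kleinBoost`, a projective automorphism of the
disc, carry the diameter of direction `(cos θ, sin θ)` to the chord of parameter `θ`. So every `Σ_t`
is a homeomorphic image of the twisted band `(φ, l)`, in which one turn replaces `l` by `(-1)^n l`.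

For area and varifolds, each of the `n` congruent pieces is parametrised by polar coordinates around
`(-u, 0)`: the direction `ψ ∈ (0, π)` of the chord and a coordinate `σ ∈ (-1, 1)` along it. This
domain does not depend on `t`, and the density extends continuously to `t = 0, 1` away from `ψ =
π/2`. With `h` half the chord length, `s` the signed distance from `(-u, 0)` and `R` the distance
from the axis, the density is `√(h²s² + (2R/n)²τ²/h²)`. The hypothesis on `n` gives `2R/n ≤ 4/5`;
then `x ≤ (1 + x²)/2` and integration bound each piece by `π(3/2 - τ²/6 + 16τ/25) < 2π`
(`area_ribbon_lt`). Dominated convergence gives varifold continuity (`isVarifoldContinuous_sweep`).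

The set `E_t` is the part of the sector where `profile < 0`. Its frontier lies in finitely many `C¹`
squares, which bounds its perimeter, and its indicator converges at every point off the null set
`Σ_{t₀}`. -/

noncomputable section

namespace Toroid

/-! ### The area formula for injective immersions -/

section AreaFormula

open scoped NNReal
open Module

/-- The estimate makes `F` factor through `G` by a `K`-Lipschitz map on `G '' s`, even where `G` is
not injective. Applied to a map and its differential in both orders, it compares their image
measures. -/
theorem euclideanHausdorffMeasure_image_le_of_edist_le {α X Y : Type*}
    [MetricSpace X] [MeasurableSpace X] [BorelSpace X]
    [MetricSpace Y] [MeasurableSpace Y] [BorelSpace Y] (d : ℕ) {F : α → Y} {G : α → X}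
    {s : Set α} {K : ℝ≥0}
    (h : ∀ x ∈ s, ∀ y ∈ s, edist (F x) (F y) ≤ K * edist (G x) (G y)) :
    μHE[d] (F '' s) ≤ (K : ℝ≥0∞) ^ d * μHE[d] (G '' s) := by
  rcases s.eq_empty_or_nonempty with rfl | ⟨x₀, hx₀⟩
  · simp
  have : Nonempty α := ⟨x₀⟩
  set φ : X → Y := fun z => F (Function.invFunOn G s z) with hφ
  have hmem : ∀ x ∈ s, Function.invFunOn G s (G x) ∈ s := fun x hx =>
    Function.invFunOn_mem ⟨x, hx, rfl⟩
  have heq : ∀ x ∈ s, G (Function.invFunOn G s (G x)) = G x := fun x hx =>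
    Function.invFunOn_eq ⟨x, hx, rfl⟩
  have hval : ∀ x ∈ s, φ (G x) = F x := by
    intro x hx
    have := h _ (hmem x hx) _ hx
    rw [heq x hx, edist_self, mul_zero] at this
    exact edist_le_zero.1 this
  have hlip : LipschitzOnWith K φ (G '' s) := by
    rintro _ ⟨x, hx, rfl⟩ _ ⟨y, hy, rfl⟩
    rw [hval x hx, hval y hy]
    exact h x hx y hy
  have himg : F '' s = φ '' (G '' s) := by
    rw [image_image]
    exact image_congr fun x hx => (hval x hx).symm
  have key := hlip.hausdorffMeasure_image_le (d := d) (by positivity)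
  rw [himg]
  simp only [Measure.euclideanHausdorffMeasure_def, Measure.smul_apply, ENNReal.smul_def,
    smul_eq_mul]
  rw [mul_left_comm]
  gcongr
  simpa using key

variable {U V : Type*} [NormedAddCommGroup U] [InnerProductSpace ℝ U] [FiniteDimensional ℝ U]
  [NormedAddCommGroup V] [InnerProductSpace ℝ V] [FiniteDimensional ℝ V]

theorem exists_nhds_edist_comparable {f : U → V} {A : U →L[ℝ] V} {x₀ : U}
    (hf : HasStrictFDerivAt f A x₀) (hA : Function.Injective A) {K : ℝ≥0} (hK : 1 < K) :
    ∃ W ∈ 𝓝 x₀, ∀ x ∈ W, ∀ y ∈ W, edist (f x) (f y) ≤ K * edist (A x) (A y) ∧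
      edist (A x) (A y) ≤ K * edist (f x) (f y) := by
  obtain ⟨c, hc, hAc⟩ := (A : U →ₗ[ℝ] V).exists_antilipschitzWith (LinearMap.ker_eq_bot.2 hA)
  have hK0 : (0 : ℝ) < K := by exact_mod_cast zero_lt_one.trans hK
  have hK1 : (1 : ℝ) < K := by exact_mod_cast hK
  have hc' : (0 : ℝ) < c := by exact_mod_cast hc
  -- Injectivity bounds `‖x - y‖` by `c ‖A x - A y‖`, so this constant makes the error at most `(1 -
  -- K⁻¹) ‖A x - A y‖`. Both comparisons then follow, the first from `2 - K⁻¹ ≤ K`.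
  have hδ : 0 < (1 - (K : ℝ)⁻¹) / c := div_pos (sub_pos.2 (inv_lt_one_of_one_lt₀ hK1)) hc'
  obtain ⟨W, hW, hfW⟩ := hf.approximates_deriv_on_nhds (c := ⟨_, hδ.le⟩) (Or.inr hδ)
  refine ⟨W, hW, fun x hx y hy => ?_⟩
  have h1 : ‖f x - f y - (A x - A y)‖ ≤ (1 - (K : ℝ)⁻¹) * ‖A x - A y‖ := by
    have := hfW x hx y hy
    rw [map_sub] at this
    refine this.trans ?_
    have h2 : ‖x - y‖ ≤ c * ‖A x - A y‖ := by
      have := hAc.le_mul_dist x y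
      rwa [dist_eq_norm, dist_eq_norm] at this
    calc (1 - (K : ℝ)⁻¹) / c * ‖x - y‖ ≤ (1 - (K : ℝ)⁻¹) / c * (c * ‖A x - A y‖) := by gcongr
      _ = _ := by field_simp
  have hKi : (K : ℝ)⁻¹ * K = 1 := inv_mul_cancel₀ hK0.ne'
  have hKi0 : 0 < (K : ℝ)⁻¹ := inv_pos.2 hK0
  have h3 : ‖f x - f y‖ ≤ ‖f x - f y - (A x - A y)‖ + ‖A x - A y‖ := by
    simpa using norm_add_le (f x - f y - (A x - A y)) (A x - A y)
  have h4 : ‖A x - A y‖ ≤ ‖f x - f y - (A x - A y)‖ + ‖f x - f y‖ := by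
    rw [norm_sub_rev (f x - f y)]
    simpa using norm_add_le (A x - A y - (f x - f y)) (f x - f y)
  have hn := norm_nonneg (A x - A y)
  constructor
  · rw [edist_nndist, edist_nndist, ← ENNReal.coe_mul, ENNReal.coe_le_coe, ← NNReal.coe_le_coe]
    push_cast
    rw [dist_eq_norm, dist_eq_norm]
    have : 1 + (1 - (K : ℝ)⁻¹) ≤ K := by nlinarith [sq_nonneg ((K : ℝ) - 1)]
    nlinarith
  · rw [edist_nndist, edist_nndist, ← ENNReal.coe_mul, ENNReal.coe_le_coe, ← NNReal.coe_le_coe]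
    push_cast
    rw [dist_eq_norm, dist_eq_norm]
    have : (K : ℝ)⁻¹ * ‖A x - A y‖ ≤ ‖f x - f y‖ := by linarith
    calc ‖A x - A y‖ = K * ((K : ℝ)⁻¹ * ‖A x - A y‖) := by field_simp
      _ ≤ _ := by gcongr

theorem normDet_eq_sqrt_det_gram {ι : Type*} [Fintype ι] [DecidableEq ι] (A : U →ₗ[ℝ] V)
    (b : OrthonormalBasis ι ℝ U) :
    A.normDet = √(Matrix.gram ℝ (fun i => A (b i))).det := by
  rw [← A.normDet_sq_eq_det_gram b]
  simp [Real.sqrt_sq A.normDet_nonneg]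

theorem continuous_normDet : Continuous fun A : U →L[ℝ] V => (A : U →ₗ[ℝ] V).normDet := by
  simp_rw [normDet_eq_sqrt_det_gram _ (stdOrthonormalBasis ℝ U)]
  refine Real.continuous_sqrt.comp (Continuous.matrix_det ?_)
  refine continuous_matrix fun i j => ?_
  simp only [Matrix.gram_apply, ContinuousLinearMap.coe_coe]
  fun_prop

variable [MeasurableSpace U] [BorelSpace U] [MeasurableSpace V] [BorelSpace V]

/-- Near `x₀` the image measure is compared with that of the linear map `A`, which is `J x₀ * volume
s`. The metric comparison costs `K ^ d` and the oscillation of the Jacobian one more factor `K`. -/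
theorem exists_open_area_comparable {f : U → V} {Ω : Set U} (hΩ : IsOpen Ω)
    (hf : ContDiffOn ℝ 1 f Ω) {x₀ : U} (hx₀ : x₀ ∈ Ω)
    (himm : Function.Injective (fderiv ℝ f x₀)) {K : ℝ≥0} (hK : 1 < K) :
    ∃ W : Set U, IsOpen W ∧ x₀ ∈ W ∧ ∀ s ⊆ W, MeasurableSet s →
      μHE[finrank ℝ U] (f '' s) ≤ (K : ℝ≥0∞) ^ (finrank ℝ U + 1) *
        ∫⁻ x in s, ENNReal.ofReal (fderiv ℝ f x : U →ₗ[ℝ] V).normDet ∧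
      ∫⁻ x in s, ENNReal.ofReal (fderiv ℝ f x : U →ₗ[ℝ] V).normDet ≤
        (K : ℝ≥0∞) ^ (finrank ℝ U + 1) * μHE[finrank ℝ U] (f '' s) := by
  have hcd : ContDiffAt ℝ 1 f x₀ := hf.contDiffAt (hΩ.mem_nhds hx₀)
  have hst := hcd.hasStrictFDerivAt (by simp)
  set A := fderiv ℝ f x₀
  set J : U → ℝ := fun x => (fderiv ℝ f x : U →ₗ[ℝ] V).normDet with hJ
  have hA0 : 0 < J x₀ := by
    refine lt_of_le_of_ne (LinearMap.normDet_nonneg _) (Ne.symm ?_)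
    rw [hJ]
    simp only [ne_eq, LinearMap.normDet_eq_zero_iff_ker_ne_bot, not_not]
    exact LinearMap.ker_eq_bot.2 himm
  have hJc : ContinuousAt J x₀ := by
    have h1 : ContinuousAt (fderiv ℝ f) x₀ := (hcd.fderiv_right (m := 0) (by simp)).continuousAt
    exact ContinuousAt.comp (g := fun A : U →L[ℝ] V => (A : U →ₗ[ℝ] V).normDet)
      continuous_normDet.continuousAt h1
  have hK1 : (1 : ℝ) < K := by exact_mod_cast hK
  have hlo : ∀ᶠ x in 𝓝 x₀, J x₀ < K * J x :=
    (hJc.const_mul (K : ℝ)).eventually (lt_mem_nhds (by nlinarith))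
  have hhi : ∀ᶠ x in 𝓝 x₀, J x < K * J x₀ := hJc.eventually (gt_mem_nhds (by nlinarith))
  obtain ⟨W₁, hW₁, hcomp⟩ := exists_nhds_edist_comparable hst himm hK
  obtain ⟨W, hWsub, hWo, hxW⟩ := mem_nhds_iff.1 (inter_mem hW₁ (hlo.and hhi))
  refine ⟨W, hWo, hxW, fun s hs hsm => ?_⟩
  have hAs : μHE[finrank ℝ U] (A '' s) = ENNReal.ofReal (J x₀) * volume s :=
    (A : U →ₗ[ℝ] V).euclideanHausdorffMeasure_image_eq_normDet_mul_volume s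
  have h1 := euclideanHausdorffMeasure_image_le_of_edist_le (finrank ℝ U) (F := f) (G := A) (s := s)
    (K := K) fun x hx y hy => (hcomp x (hWsub (hs hx)).1 y (hWsub (hs hy)).1).1
  have h2 := euclideanHausdorffMeasure_image_le_of_edist_le (finrank ℝ U) (F := A) (G := f) (s := s)
    (K := K) fun x hx y hy => (hcomp x (hWsub (hs hx)).1 y (hWsub (hs hy)).1).2
  have h3 : ENNReal.ofReal (J x₀) * volume s ≤ K * ∫⁻ x in s, ENNReal.ofReal (J x) := by
    rw [← setLIntegral_const, ← lintegral_const_mul' _ _ ENNReal.coe_ne_top]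
    refine setLIntegral_mono' hsm fun x hx => ?_
    rw [← ENNReal.ofReal_coe_nnreal, ← ENNReal.ofReal_mul K.coe_nonneg]
    exact ENNReal.ofReal_le_ofReal (hWsub (hs hx)).2.1.le
  have h4 : ∫⁻ x in s, ENNReal.ofReal (J x) ≤ K * (ENNReal.ofReal (J x₀) * volume s) := by
    rw [← mul_assoc, ← setLIntegral_const]
    refine setLIntegral_mono' hsm fun x hx => ?_
    rw [← ENNReal.ofReal_coe_nnreal, ← ENNReal.ofReal_mul K.coe_nonneg]
    exact ENNReal.ofReal_le_ofReal (hWsub (hs hx)).2.2.le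
  constructor
  · rw [pow_succ, mul_assoc]
    refine h1.trans ?_
    rw [hAs]
    gcongr
  · rw [pow_succ', mul_assoc]
    refine h4.trans ?_
    rw [← hAs]
    gcongr

theorem ENNReal_le_of_forall_one_lt_pow_mul {a b : ℝ≥0∞} (k : ℕ)
    (h : ∀ K : ℝ≥0, 1 < K → a ≤ (K : ℝ≥0∞) ^ k * b) : a ≤ b := by
  have hc : Tendsto (fun K : ℝ≥0 => ((K ^ k : ℝ≥0) : ℝ≥0∞)) (𝓝[>] 1) (𝓝 ((1 ^ k : ℝ≥0) : ℝ≥0∞)) :=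
    ENNReal.tendsto_coe.2 (((continuous_pow k).tendsto 1).mono_left nhdsWithin_le_nhds)
  have h2 := ENNReal.Tendsto.mul_const (b := b) hc (Or.inl (by simp))
  simp only [one_pow, ENNReal.coe_one, one_mul] at h2
  refine ge_of_tendsto h2 ?_
  filter_upwards [self_mem_nhdsWithin] with K hK
  simpa using h K hK

/-- **Area formula** for injective immersions of class `C¹`. -/
theorem euclideanHausdorffMeasure_image_eq_lintegral_normDet {f : U → V} {Ω : Set U}
    (hΩ : IsOpen Ω) (hf : ContDiffOn ℝ 1 f Ω) (hinj : InjOn f Ω)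
    (himm : ∀ x ∈ Ω, Function.Injective (fderiv ℝ f x)) {s : Set U} (hs : s ⊆ Ω)
    (hsm : MeasurableSet s) :
    μHE[finrank ℝ U] (f '' s) = ∫⁻ x in s, ENNReal.ofReal (fderiv ℝ f x : U →ₗ[ℝ] V).normDet := by
  rcases s.eq_empty_or_nonempty with rfl | hne
  · simp
  suffices h : ∀ K : ℝ≥0, 1 < K →
      μHE[finrank ℝ U] (f '' s) ≤ (K : ℝ≥0∞) ^ (finrank ℝ U + 1) *
        ∫⁻ x in s, ENNReal.ofReal (fderiv ℝ f x : U →ₗ[ℝ] V).normDet ∧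
      ∫⁻ x in s, ENNReal.ofReal (fderiv ℝ f x : U →ₗ[ℝ] V).normDet ≤
        (K : ℝ≥0∞) ^ (finrank ℝ U + 1) * μHE[finrank ℝ U] (f '' s) from
    le_antisymm (ENNReal_le_of_forall_one_lt_pow_mul _ fun K hK => (h K hK).1)
      (ENNReal_le_of_forall_one_lt_pow_mul _ fun K hK => (h K hK).2)
  intro K hK
  choose! W hWo hWx hW using fun x (hx : x ∈ Ω) =>
    exists_open_area_comparable hΩ hf hx (himm x hx) hK
  obtain ⟨t, hts, htc, hcov⟩ := TopologicalSpace.countable_cover_nhdsWithin (s := s) (f := W)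
    fun x hx => mem_nhdsWithin_of_mem_nhds ((hWo x (hs hx)).mem_nhds (hWx x (hs hx)))
  have htne : t.Nonempty := by
    obtain ⟨x, hx⟩ := hne
    obtain ⟨y, hy, -⟩ := mem_iUnion₂.1 (hcov hx)
    exact ⟨y, hy⟩
  obtain ⟨e, rfl⟩ := htc.exists_eq_range htne
  have heΩ : ∀ i, e i ∈ Ω := fun i => hs (hts (mem_range_self i))
  -- Disjoint pieces, so that both sides add up over them; on the left this uses the injectivity of
  -- `f`.
  set D : ℕ → Set U := fun i => s ∩ disjointed (fun i => W (e i)) i with hD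
  have hDm : ∀ i, MeasurableSet (D i) := fun i =>
    hsm.inter (MeasurableSet.disjointed (fun j => (hWo _ (heΩ j)).measurableSet) i)
  have hDd : Pairwise (Function.onFun Disjoint D) := fun i j hij =>
    (disjoint_disjointed _ hij).mono inter_subset_right inter_subset_right
  have hDs : ⋃ i, D i = s := by
    rw [hD, ← inter_iUnion, iUnion_disjointed, inter_eq_left]
    refine hcov.trans ?_
    rw [biUnion_range]
  have hDW : ∀ i, D i ⊆ W (e i) := fun i => inter_subset_right.trans (disjointed_subset _ i)
  have hDΩ : ∀ i, D i ⊆ Ω := fun i => inter_subset_left.trans hs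
  have e1 : μHE[finrank ℝ U] (f '' s) = ∑' i, μHE[finrank ℝ U] (f '' D i) := by
    conv_lhs => rw [← hDs, image_iUnion]
    refine measure_iUnion (fun i j hij => ?_) fun i =>
      (hDm i).image_of_continuousOn_injOn (hf.continuousOn.mono (hDΩ i)) (hinj.mono (hDΩ i))
    exact (hDd hij).image hinj (hDΩ i) (hDΩ j)
  have e2 : ∫⁻ x in s, ENNReal.ofReal (fderiv ℝ f x : U →ₗ[ℝ] V).normDet =
      ∑' i, ∫⁻ x in D i, ENNReal.ofReal (fderiv ℝ f x : U →ₗ[ℝ] V).normDet := by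
    conv_lhs => rw [← hDs]
    exact lintegral_iUnion hDm hDd _
  rw [e1, e2, ← ENNReal.tsum_mul_left, ← ENNReal.tsum_mul_left]
  exact ⟨ENNReal.tsum_le_tsum fun i => (hW _ (heΩ i) _ (hDW i) (hDm i)).1,
    ENNReal.tsum_le_tsum fun i => (hW _ (heΩ i) _ (hDW i) (hDm i)).2⟩

theorem continuousOn_normDet_fderiv {f : U → V} {Ω : Set U}
    (hΩ : IsOpen Ω) (hf : ContDiffOn ℝ 1 f Ω) :
    ContinuousOn (fun x => (fderiv ℝ f x : U →ₗ[ℝ] V).normDet) Ω :=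
  continuous_normDet.comp_continuousOn (hf.continuousOn_fderiv_of_isOpen hΩ (by simp))

theorem map_withDensity_normDet {f : U → V} {Ω : Set U}
    (hΩ : IsOpen Ω) (hf : ContDiffOn ℝ 1 f Ω) (hinj : InjOn f Ω)
    (himm : ∀ x ∈ Ω, Function.Injective (fderiv ℝ f x)) :
    Measure.map (Ω.domRestrict f) (Measure.comap (↑) ((volume : Measure U).withDensity
      fun x => ENNReal.ofReal (fderiv ℝ f x : U →ₗ[ℝ] V).normDet)) =
      (μHE[finrank ℝ U]).restrict (f '' Ω) := by
  have hc : Continuous (Ω.domRestrict f) := hf.continuousOn.domRestrict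
  refine Measure.ext fun t ht => ?_
  rw [Measure.map_apply hc.measurable ht, Measure.restrict_apply ht,
    comap_subtype_coe_apply hΩ.measurableSet]
  have h1 : ((↑) '' (Ω.domRestrict f ⁻¹' t) : Set U) = Ω ∩ f ⁻¹' t := by
    ext x; simp [and_comm]
  have h2 : MeasurableSet (Ω ∩ f ⁻¹' t) := by
    rw [← h1]
    exact hΩ.measurableSet.subtype_image (hc.measurable ht)
  rw [h1, withDensity_apply _ h2, ← euclideanHausdorffMeasure_image_eq_lintegral_normDet hΩ hf hinj
    himm inter_subset_left h2, image_inter_preimage, inter_comm]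

/-- No measurability of `g` is assumed: the restriction of `f` is a measurable embedding. This
matters for varifold integrands, which contain a tangent plane defined point by point. -/
theorem integrableOn_image_iff_normDet {f : U → V} {Ω : Set U}
    (hΩ : IsOpen Ω) (hf : ContDiffOn ℝ 1 f Ω) (hinj : InjOn f Ω)
    (himm : ∀ x ∈ Ω, Function.Injective (fderiv ℝ f x)) (g : V → ℝ) :
    IntegrableOn g (f '' Ω) μHE[finrank ℝ U] ↔
      IntegrableOn (fun x => (fderiv ℝ f x : U →ₗ[ℝ] V).normDet * g (f x)) Ω := by
  have hemb : MeasurableEmbedding (Ω.domRestrict f) :=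
    hf.continuousOn.measurableEmbedding hΩ.measurableSet hinj
  rw [IntegrableOn, ← map_withDensity_normDet hΩ hf hinj himm, hemb.integrable_map_iff]
  simp only [Set.domRestrict_eq, ← Function.comp_assoc, ENNReal.ofReal]
  rw [← (MeasurableEmbedding.subtype_coe hΩ.measurableSet).integrable_map_iff,
    map_comap_subtype_coe hΩ.measurableSet, restrict_withDensity hΩ.measurableSet,
    integrable_withDensity_iff_integrable_coe_smul₀]
  · simp_rw [IntegrableOn, Real.coe_toNNReal _ (LinearMap.normDet_nonneg _), Function.comp_apply,
      smul_eq_mul]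
  · exact ((continuousOn_normDet_fderiv hΩ hf).aemeasurable hΩ.measurableSet).real_toNNReal

theorem setIntegral_image_eq_normDet {f : U → V} {Ω : Set U}
    (hΩ : IsOpen Ω) (hf : ContDiffOn ℝ 1 f Ω) (hinj : InjOn f Ω)
    (himm : ∀ x ∈ Ω, Function.Injective (fderiv ℝ f x)) (g : V → ℝ) :
    ∫ y in f '' Ω, g y ∂μHE[finrank ℝ U] =
      ∫ x in Ω, (fderiv ℝ f x : U →ₗ[ℝ] V).normDet * g (f x) := by
  have hemb : MeasurableEmbedding (Ω.domRestrict f) :=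
    hf.continuousOn.measurableEmbedding hΩ.measurableSet hinj
  rw [← map_withDensity_normDet hΩ hf hinj himm, hemb.integral_map]
  simp only [Set.domRestrict_apply, ← Function.comp_apply (f := g), ENNReal.ofReal]
  rw [← (MeasurableEmbedding.subtype_coe hΩ.measurableSet).integral_map,
    map_comap_subtype_coe hΩ.measurableSet,
    setIntegral_withDensity_eq_setIntegral_smul₀
      ((continuousOn_normDet_fderiv hΩ hf).aemeasurable hΩ.measurableSet).real_toNNReal
      _ hΩ.measurableSet]
  congr with x
  rw [NNReal.smul_def, Real.coe_toNNReal _ (LinearMap.normDet_nonneg _), smul_eq_mul]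

end AreaFormula

/-! ### A criterion for finite perimeter -/

section FinitePerimeter

open scoped NNReal

/-- The segment from `x` to `y` is connected; if it missed the frontier, the interiors of `A` and of
its complement would separate it. -/
theorem exists_mem_frontier_dist_le {V : Type*} [NormedAddCommGroup V] [NormedSpace ℝ V]
    {A : Set V} {x y : V} (hx : x ∈ A) (hy : y ∉ A) :
    ∃ z ∈ frontier A, dist x z ≤ dist x y := by
  by_contra! hcon
  have hsub : _root_.segment ℝ x y ⊆ interior A ∪ interior Aᶜ := by
    intro z hz
    have hz' : z ∉ frontier A := fun h => by
      have h1 := hcon z h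
      have h2 := (convex_closedBall x (dist x y)).segment_subset
        (Metric.mem_closedBall_self dist_nonneg) (Metric.mem_closedBall'.2 le_rfl) hz
      exact absurd (Metric.mem_closedBall'.1 h2) (not_le.2 h1)
    have := frontier_eq_closure_inter_closure (s := A)
    by_cases hzA : z ∈ A
    · left
      by_contra h
      exact hz' ⟨subset_closure hzA, h⟩
    · right
      by_contra h
      rw [← frontier_compl] at hz'
      exact hz' ⟨subset_closure hzA, h⟩
  obtain ⟨z, -, hz⟩ := (convex_segment x y).isPreconnected _ _ isOpen_interior isOpen_interior hsub
    ⟨x, left_mem_segment ℝ x y, (hsub (left_mem_segment ℝ x y)).resolve_right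
      fun h => interior_subset h hx⟩
    ⟨y, right_mem_segment ℝ x y, (hsub (right_mem_segment ℝ x y)).resolve_left
      fun h => hy (interior_subset h)⟩
  exact interior_subset hz.2 (interior_subset hz.1)

/-- The integral is the limit of difference quotients. Translating the variable turns each of them
into `1/t` times the difference of the integrals of `g` over `A + t v` and over `A`, which the
symmetric difference bounds because `|g| ≤ 1`. -/
theorem setIntegral_fderiv_apply_le {A : Set E3} (hA : MeasurableSet A) (hfin : volume A ≠ ⊤)
    {C : ℝ} (v : E3)
    (h : ∀ t : ℝ, 0 < t → t ≤ 1 →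
      volume (symmDiff A ((fun x => x - t • v) ⁻¹' A)) ≤ ENNReal.ofReal (C * t))
    {g : E3 → ℝ} (hg : ContDiff ℝ 1 g) (hgc : HasCompactSupport g) (hg1 : ∀ x, |g x| ≤ 1) :
    ∫ x in A, fderiv ℝ g x v ≤ |C| := by
  obtain ⟨K, hK⟩ := ContDiff.lipschitzWith_of_hasCompactSupport hgc hg (by simp)
  have hint : Integrable (A.indicator (1 : E3 → ℝ)) :=
    (integrable_indicator_iff hA).2 (integrableOn_const hfin)
  have hgi : Integrable g := hg.continuous.integrable_of_hasCompactSupport hgc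
  have hlim := hK.integral_inv_smul_sub_mul_tendsto_integral_lineDeriv_mul hint v
  have hA1 : ∀ f : E3 → ℝ, ∫ x, f x * A.indicator (1 : E3 → ℝ) x = ∫ x in A, f x := fun f => by
    rw [← integral_indicator hA]
    refine integral_congr_ae (Eventually.of_forall fun x => ?_)
    by_cases hx : x ∈ A <;> simp [hx]
  rw [hA1] at hlim
  have hfd : ∀ x, lineDeriv ℝ g x v = fderiv ℝ g x v := fun x =>
    ((hg.differentiable (by simp)) x).lineDeriv_eq_fderiv
  simp only [hfd] at hlim
  refine le_of_tendsto hlim ?_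
  filter_upwards [Ioc_mem_nhdsGT (zero_lt_one' ℝ)] with t ht
  rw [hA1]
  set B : Set E3 := (fun x => x - t • v) ⁻¹' A with hB
  have hBm : MeasurableSet B := (measurable_sub_const _) hA
  have e1 : ∫ x in A, g (x + t • v) = ∫ x in B, g x := by
    rw [← integral_indicator hA, ← integral_indicator hBm,
      ← integral_sub_right_eq_self (A.indicator fun x => g (x + t • v)) (t • v)]
    refine integral_congr_ae (Eventually.of_forall fun x => ?_)
    simp only [indicator, hB, mem_preimage, sub_add_cancel]
    rfl
  have hsd : MeasurableSet (symmDiff A B) := hA.symmDiff hBm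
  have hsdf : volume (symmDiff A B) ≠ ⊤ := ne_top_of_le_ne_top ENNReal.ofReal_ne_top (h t ht.1 ht.2)
  have e2 : (∫ x in B, g x) - ∫ x in A, g x ≤ |C| * t := by
    rw [← integral_indicator hA, ← integral_indicator hBm,
      ← integral_sub (hgi.indicator hBm) (hgi.indicator hA)]
    calc ∫ x, (B.indicator g x - A.indicator g x)
        ≤ ∫ x, (symmDiff A B).indicator (1 : E3 → ℝ) x := by
          refine integral_mono ((hgi.indicator hBm).sub (hgi.indicator hA))
            ((integrable_indicator_iff hsd).2 (integrableOn_const hsdf)) fun x => ?_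
          have := abs_le.1 (hg1 x)
          by_cases h1 : x ∈ A <;> by_cases h2 : x ∈ B <;> simp [indicator, mem_symmDiff, h1, h2] <;>
            linarith
      _ = (volume (symmDiff A B)).toReal := by
          rw [integral_indicator hsd]; simp [Measure.real]
      _ ≤ |C| * t := by
          refine ENNReal.toReal_le_of_le_ofReal (by have := ht.1; positivity) ?_
          refine (h t ht.1 ht.2).trans (ENNReal.ofReal_le_ofReal ?_)
          have := ht.1
          gcongr
          exact le_abs_self C
  have hcomp : Integrable fun x => g (x + t • v) := hgi.comp_add_right (t • v)
  simp only [smul_eq_mul]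
  rw [integral_const_mul, integral_sub hcomp.integrableOn hgi.integrableOn, e1,
    inv_mul_le_iff₀ ht.1, mul_comm]
  exact e2

theorem hasFinitePerimeter_of_volume_symmDiff_le {A : Set E3} (hA : MeasurableSet A)
    (hfin : volume A ≠ ⊤) {C : ℝ}
    (h : ∀ v : E3, ‖v‖ ≤ 1 →
      volume (symmDiff A ((fun x => x - v) ⁻¹' A)) ≤ ENNReal.ofReal (C * ‖v‖)) :
    HasFinitePerimeter A := by
  -- Each of the three coordinates of the field contributes at most `|C|`.
  refine ⟨hA, 3 * |C|, fun X hX hXc hX1 => ?_⟩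
  set e : Fin 3 → E3 := fun i => EuclideanSpace.single i 1
  have he : ∀ i, ‖e i‖ = 1 := fun i => by simp [e]
  have hXi : ∀ i, ContDiff ℝ 1 fun x => X x i := fun i =>
    (EuclideanSpace.proj (𝕜 := ℝ) i).contDiff.comp hX
  have hXic : ∀ i, HasCompactSupport fun x => X x i := fun i =>
    hXc.comp_left (g := fun y : E3 => y i) rfl
  have hXi1 : ∀ i x, |X x i| ≤ 1 := fun i x =>
    (PiLp.norm_apply_le (X x) i).trans (hX1 x)
  have hder : ∀ i x, fderiv ℝ X x (e i) i = fderiv ℝ (fun x => X x i) x (e i) := fun i x => by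
    have h1 : HasFDerivAt X (fderiv ℝ X x) x := (hX.differentiable (by simp) x).hasFDerivAt
    have h2 := (EuclideanSpace.proj (𝕜 := ℝ) i).hasFDerivAt.comp x h1
    have h3 : HasFDerivAt (fun x => X x i)
      ((EuclideanSpace.proj (𝕜 := ℝ) i).comp (fderiv ℝ X x)) x := h2
    rw [h3.fderiv]
    rfl
  have hbound : ∀ i, ∫ x in A, fderiv ℝ (fun x => X x i) x (e i) ≤ |C| := fun i => by
    refine setIntegral_fderiv_apply_le hA hfin (e i) (fun t ht ht1 => ?_) (hXi i) (hXic i) (hXi1 i)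
    have hn : ‖t • e i‖ = t := by rw [norm_smul, he, mul_one, Real.norm_of_nonneg ht.le]
    simpa [hn] using h (t • e i) (hn.trans_le ht1)
  have hint : ∀ i, Integrable fun x => fderiv ℝ (fun x => X x i) x (e i) := fun i => by
    refine Continuous.integrable_of_hasCompactSupport ?_ ?_
    · exact ((hXi i).continuous_fderiv (by simp)).clm_apply continuous_const
    · exact (hXic i).fderiv_apply (𝕜 := ℝ) (e i)
  have hdiv : ∀ x, divergence X x = ∑ i, fderiv ℝ (fun x => X x i) x (e i) := fun x =>
    Finset.sum_congr rfl fun i _ => hder i x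
  simp_rw [hdiv]
  rw [integral_finsetSum _ fun i _ => (hint i).integrableOn]
  refine (Finset.sum_le_sum fun i _ => hbound i).trans ?_
  simp

/-- A grid of mesh at most `r` in the square has at most `9 / r²` points. Balls of radius `(K + 1)
r` around their images cover the neighbourhood, and their volumes add up to `O(r)`. -/
theorem exists_volume_neighborhood_le {f : ℝ × ℝ → E3} (hf : ContDiff ℝ 1 f) :
    ∃ C : ℝ, 0 ≤ C ∧ ∀ r : ℝ, 0 < r → r ≤ 1 →
      volume {x | ∃ y ∈ f '' (Icc 0 1 ×ˢ Icc 0 1), dist x y ≤ r} ≤ ENNReal.ofReal (C * r) := by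
  obtain ⟨K, hK⟩ := hf.contDiffOn.exists_lipschitzOnWith (s := Icc (0 : ℝ) 1 ×ˢ Icc (0 : ℝ) 1)
    (by simp) ((convex_Icc 0 1).prod (convex_Icc 0 1)) (isCompact_Icc.prod isCompact_Icc)
  set b : ℝ := (volume (Metric.ball (0 : E3) 1)).toReal
  have hb : volume (Metric.ball (0 : E3) 1) = ENNReal.ofReal b :=
    (ENNReal.ofReal_toReal measure_ball_lt_top.ne).symm
  have hb0 : 0 ≤ b := ENNReal.toReal_nonneg
  refine ⟨9 * (K + 1) ^ 3 * b, by positivity, fun r hr hr1 => ?_⟩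
  set N : ℕ := ⌈r⁻¹⌉₊ with hN
  have hNr : r⁻¹ ≤ N := Nat.le_ceil _
  have hN0 : (0 : ℝ) < N := (inv_pos.2 hr).trans_le hNr
  have hN1 : (N : ℝ) + 1 ≤ 3 / r := by
    have := Nat.ceil_lt_add_one (inv_pos.2 hr).le
    have h1 : 1 ≤ r⁻¹ := (one_le_inv₀ hr).2 hr1
    rw [div_eq_mul_inv]
    linarith
  have hNi : (N : ℝ)⁻¹ ≤ r := by rw [inv_le_comm₀ hN0 hr]; exact hNr
  set g : Fin (N + 1) × Fin (N + 1) → ℝ × ℝ := fun p => ((p.1 : ℕ) / (N : ℝ), (p.2 : ℕ) / (N : ℝ))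
  have hgm : ∀ p, g p ∈ Icc (0 : ℝ) 1 ×ˢ Icc (0 : ℝ) 1 := fun p => by
    have h1 : ((p.1 : ℕ) : ℝ) ≤ N := by exact_mod_cast Nat.lt_succ_iff.1 p.1.2
    have h2 : ((p.2 : ℕ) : ℝ) ≤ N := by exact_mod_cast Nat.lt_succ_iff.1 p.2.2
    exact ⟨⟨by positivity, (div_le_one hN0).2 h1⟩, ⟨by positivity, (div_le_one hN0).2 h2⟩⟩
  have happ : ∀ a ∈ Icc (0 : ℝ) 1, ∃ i : Fin (N + 1), |a - (i : ℕ) / (N : ℝ)| ≤ r := by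
    intro a ha
    have h0 : 0 ≤ a * N := mul_nonneg ha.1 hN0.le
    have h1 : ⌊a * N⌋₊ < N + 1 := by
      rw [Nat.lt_succ_iff]
      refine Nat.floor_le_of_le ?_
      nlinarith [ha.2]
    refine ⟨⟨⌊a * N⌋₊, h1⟩, ?_⟩
    have h2 := Nat.floor_le h0
    have h3 := Nat.lt_floor_add_one (a * N)
    have h4 : a - (⌊a * N⌋₊ : ℝ) / N = (a * N - ⌊a * N⌋₊) * (N : ℝ)⁻¹ := by field_simp
    simp only
    rw [h4, abs_of_nonneg (mul_nonneg (by linarith) (by positivity))]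
    refine le_trans ?_ hNi
    have h5 : (0 : ℝ) < (N : ℝ)⁻¹ := inv_pos.2 hN0
    nlinarith
  have hcov : {x | ∃ y ∈ f '' (Icc 0 1 ×ˢ Icc 0 1), dist x y ≤ r} ⊆
      ⋃ p, Metric.closedBall (f (g p)) ((K + 1) * r) := by
    rintro x ⟨_, ⟨⟨a, c⟩, hac, rfl⟩, hx⟩
    obtain ⟨i, hi⟩ := happ a hac.1
    obtain ⟨j, hj⟩ := happ c hac.2
    refine mem_iUnion.2 ⟨(i, j), Metric.mem_closedBall.2 ?_⟩
    have h1 := hK.dist_le_mul _ hac _ (hgm (i, j))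
    have h2 : dist (a, c) (g (i, j)) ≤ r := max_le hi hj
    calc dist x (f (g (i, j))) ≤ dist x (f (a, c)) + dist (f (a, c)) (f (g (i, j))) :=
          dist_triangle _ _ _
      _ ≤ r + K * r := add_le_add hx (h1.trans (by gcongr))
      _ = _ := by ring
  refine (measure_mono hcov).trans ((measure_iUnion_fintype_le _ _).trans ?_)
  have hball : ∀ p, volume (Metric.closedBall (f (g p)) ((K + 1) * r)) =
      ENNReal.ofReal (((K + 1) * r) ^ 3 * b) := fun p => by
    rw [Measure.addHaar_closedBall _ _ (by positivity), hb, ← ENNReal.ofReal_mul (by positivity)]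
    simp
  simp_rw [hball]
  rw [Finset.sum_const, nsmul_eq_mul, Finset.card_univ, Fintype.card_prod, Fintype.card_fin,
    ← ENNReal.ofReal_natCast, ← ENNReal.ofReal_mul (by positivity)]
  refine ENNReal.ofReal_le_ofReal ?_
  push_cast
  have hsq : ((N : ℝ) + 1) * (N + 1) ≤ 9 / r ^ 2 := by
    calc ((N : ℝ) + 1) * (N + 1) ≤ (3 / r) * (3 / r) := by gcongr
      _ = 9 / r ^ 2 := by field_simp; norm_num
  calc ((N : ℝ) + 1) * (N + 1) * (((K + 1) * r) ^ 3 * b)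
      ≤ 9 / r ^ 2 * (((K + 1) * r) ^ 3 * b) := by gcongr
    _ = _ := by field_simp

/-- A bounded set whose boundary is covered by finitely many squares of class `C¹` has finite
perimeter. -/
theorem hasFinitePerimeter_of_frontier_subset {A : Set E3} (hA : MeasurableSet A)
    (hb : Bornology.IsBounded A) {ι : Type*} [Fintype ι] {f : ι → ℝ × ℝ → E3}
    (hf : ∀ i, ContDiff ℝ 1 (f i))
    (hfr : frontier A ⊆ ⋃ i, f i '' (Icc 0 1 ×ˢ Icc 0 1)) : HasFinitePerimeter A := by
  choose C hC0 hC using fun i => exists_volume_neighborhood_le (hf i)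
  refine hasFinitePerimeter_of_volume_symmDiff_le hA hb.measure_lt_top.ne (C := ∑ i, C i)
    fun v hv => ?_
  rcases eq_or_ne v 0 with rfl | hv0
  · simp
  have hvp : 0 < ‖v‖ := norm_pos_iff.2 hv0
  -- If exactly one of `x` and `x - v` lies in `A`, the frontier passes within `‖v‖` of `x`.
  have hsub : symmDiff A ((fun x => x - v) ⁻¹' A) ⊆
      ⋃ i, {x | ∃ y ∈ f i '' (Icc 0 1 ×ˢ Icc 0 1), dist x y ≤ ‖v‖} := by
    intro x hx
    have hd : dist x (x - v) = ‖v‖ := by simp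
    have hex : ∃ z ∈ frontier A, dist x z ≤ ‖v‖ := by
      rcases hx with ⟨h1, h2⟩ | ⟨h1, h2⟩
      · obtain ⟨z, hz, hzd⟩ := exists_mem_frontier_dist_le h1 h2
        exact ⟨z, hz, hd ▸ hzd⟩
      · obtain ⟨z, hz, hzd⟩ := exists_mem_frontier_dist_le (A := Aᶜ) h2 (not_not.2 h1)
        exact ⟨z, frontier_compl A ▸ hz, hd ▸ hzd⟩
    obtain ⟨z, hz, hzd⟩ := hex
    obtain ⟨i, hi⟩ := mem_iUnion.1 (hfr hz)
    exact mem_iUnion.2 ⟨i, z, hi, hzd⟩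
  calc volume (symmDiff A ((fun x => x - v) ⁻¹' A))
      ≤ ∑ i, volume {x | ∃ y ∈ f i '' (Icc 0 1 ×ˢ Icc 0 1), dist x y ≤ ‖v‖} :=
        (measure_mono hsub).trans (measure_iUnion_fintype_le _ _)
    _ ≤ ∑ i, ENNReal.ofReal (C i * ‖v‖) := Finset.sum_le_sum fun i _ => hC i _ hvp hv
    _ = ENNReal.ofReal ((∑ i, C i) * ‖v‖) := by
        rw [Finset.sum_mul, ENNReal.ofReal_sum_of_nonneg fun i _ => by
          have := hC0 i; positivity]

end FinitePerimeter

/-! ### Cylindrical coordinates -/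

/-- The point with cylindrical coordinates `(r, φ, z)`. -/
def cyl (φ r z : ℝ) : E3 := !₂[r * Real.cos φ, r * Real.sin φ, z]

/-- The distance from the `x₃`-axis. -/
def radius (x : E3) : ℝ := √((x 0) ^ 2 + (x 1) ^ 2)

@[simp] theorem cyl_zero (φ r z : ℝ) : cyl φ r z 0 = r * Real.cos φ := rfl
@[simp] theorem cyl_one (φ r z : ℝ) : cyl φ r z 1 = r * Real.sin φ := rfl
@[simp] theorem cyl_two (φ r z : ℝ) : cyl φ r z 2 = z := rfl

theorem E3_ext {x y : E3} (h0 : x 0 = y 0) (h1 : x 1 = y 1) (h2 : x 2 = y 2) : x = y := by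
  ext i; fin_cases i <;> assumption

theorem radius_cyl {φ r : ℝ} (z : ℝ) (hr : 0 ≤ r) : radius (cyl φ r z) = r := by
  rw [radius, cyl_zero, cyl_one, ← Real.sqrt_sq hr]
  congr 1
  rw [Real.sqrt_sq hr]
  linear_combination r ^ 2 * Real.sin_sq_add_cos_sq φ

theorem exists_eq_cyl (x : E3) : ∃ φ, x = cyl φ (radius x) (x 2) := by
  refine ⟨Complex.arg ⟨x 0, x 1⟩, ?_⟩
  have hn : ‖(⟨x 0, x 1⟩ : ℂ)‖ = radius x := by
    rw [radius, Complex.norm_def, Complex.normSq_mk]; congr 1; ring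
  refine E3_ext ?_ ?_ rfl
  · rw [cyl_zero, ← hn, Complex.norm_mul_cos_arg]
  · rw [cyl_one, ← hn, Complex.norm_mul_sin_arg]

theorem cyl_inj {φ r z φ' r' z' : ℝ} (hr : 0 < r) (hr' : 0 < r')
    (h : cyl φ r z = cyl φ' r' z') : r = r' ∧ z = z' ∧ ∃ k : ℤ, φ' = φ + 2 * Real.pi * k := by
  have hrr : r = r' := by rw [← radius_cyl z hr.le, h, radius_cyl z' hr'.le]
  subst hrr
  have h0 := congrArg (fun x : E3 => x 0) h
  have h1 := congrArg (fun x : E3 => x 1) h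
  have h2 := congrArg (fun x : E3 => x 2) h
  simp only [cyl_zero, cyl_one, cyl_two] at h0 h1 h2
  have hang : (φ : Real.Angle) = φ' :=
    Real.Angle.cos_sin_inj (mul_left_cancel₀ hr.ne' h0) (mul_left_cancel₀ hr.ne' h1)
  obtain ⟨k, hk⟩ := Real.Angle.angle_eq_iff_two_pi_dvd_sub.1 hang
  refine ⟨rfl, h2, -k, ?_⟩
  push_cast
  linarith

theorem cyl_add_two_pi (φ r z : ℝ) (k : ℤ) : cyl (φ + 2 * Real.pi * k) r z = cyl φ r z := by
  have : φ + 2 * Real.pi * k = φ + k * (2 * Real.pi) := by ring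
  rw [this]
  simp [cyl]

theorem cyl_mem_toroid {ρ φ r z : ℝ} (hr : 0 ≤ r) :
    cyl φ r z ∈ toroid ρ ↔ (r - ρ) ^ 2 + z ^ 2 ≤ 1 := by
  have := radius_cyl (φ := φ) z hr
  rw [radius] at this
  rw [toroid, mem_ofPred_eq, this, cyl_two]

theorem mem_toroid {ρ : ℝ} {x : E3} : x ∈ toroid ρ ↔ (radius x - ρ) ^ 2 + (x 2) ^ 2 ≤ 1 := Iff.rfl

theorem abs_radius_sub_le {ρ : ℝ} {x : E3} (hx : x ∈ toroid ρ) : |radius x - ρ| ≤ 1 := by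
  rw [mem_toroid] at hx
  exact abs_le_one_iff_mul_self_le_one.2 (by nlinarith [sq_nonneg (x 2)])

theorem radius_pos {ρ : ℝ} (hρ : 2 < ρ) {x : E3} (hx : x ∈ toroid ρ) : 0 < radius x := by
  have := abs_le.1 (abs_radius_sub_le hx)
  linarith

theorem continuous_radius : Continuous radius := by
  unfold radius; fun_prop

theorem continuous_cyl : Continuous fun q : ℝ × ℝ × ℝ => cyl q.1 q.2.1 q.2.2 := by
  unfold cyl
  refine (PiLp.continuous_toLp 2 _).comp (continuous_pi fun i => ?_)
  fin_cases i <;> simp <;> fun_prop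

theorem contDiff_cyl : ContDiff ℝ ∞ fun q : ℝ × ℝ × ℝ => cyl q.1 q.2.1 q.2.2 := by
  rw [contDiff_piLp]
  intro i
  fin_cases i
  · exact contDiff_snd.fst.mul (Real.contDiff_cos.comp contDiff_fst)
  · exact contDiff_snd.fst.mul (Real.contDiff_sin.comp contDiff_fst)
  · exact contDiff_snd.snd

theorem hasDerivAt_E3 {f : ℝ → E3} {v : E3} {t : ℝ} (h : ∀ i, HasDerivAt (fun s => f s i) (v i) t) :
    HasDerivAt f v t := by
  have := (hasDerivAt_pi (φ := fun s i => f s i) (φ' := fun i => v i)).2 h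
  exact ((PiLp.continuousLinearEquiv 2 ℝ (fun _ : Fin 3 => ℝ)).symm.hasFDerivAt.comp_hasDerivAt
    t this)

/-- Derivative of a curve given in cylindrical coordinates. -/
theorem hasDerivAt_cyl {φ r z : ℝ → ℝ} {φ' r' z' t : ℝ} (hφ : HasDerivAt φ φ' t)
    (hr : HasDerivAt r r' t) (hz : HasDerivAt z z' t) :
    HasDerivAt (fun s => cyl (φ s) (r s) (z s))
      (cyl (φ t) r' z' + cyl (φ t + Real.pi / 2) (r t * φ') 0) t := by
  refine hasDerivAt_E3 fun i => ?_
  fin_cases i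
  · refine (hr.mul hφ.cos).congr_deriv ?_
    simp [Real.cos_add_pi_div_two]; ring
  · refine (hr.mul hφ.sin).congr_deriv ?_
    simp [Real.sin_add_pi_div_two]; ring
  · refine hz.congr_deriv ?_
    simp

/-! ### The ribbons -/

/-- The equation of the line with direction `(τ cos θ, sin θ)` through `(-u, 0)`. -/
def profile (u τ θ y₁ y₂ : ℝ) : ℝ := (y₁ + u) * Real.sin θ - τ * y₂ * Real.cos θ

/-- The ruled surface in the toroid whose section at toroidal angle `φ` is the chord through
`(-u, 0)` with direction `(τ cos (nφ/2), sin (nφ/2))`. -/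
def ribbon (ρ : ℝ) (n : ℕ) (u τ : ℝ) : Set E3 :=
  {x | x ∈ toroid ρ ∧ ∃ φ r : ℝ, 0 < r ∧ x = cyl φ r (x 2) ∧
    profile u τ (n * φ / 2) (r - ρ) (x 2) = 0}

/-- A change of `φ` by `2π` adds `nπ` to `θ = nφ/2`, so the zero set does not depend on the choice
of angle. The rotation by `2π/n` adds `π`, which gives the invariance of the ribbon. -/
theorem profile_add_int_mul_pi (u τ θ y₁ y₂ : ℝ) (k : ℤ) :
    profile u τ (θ + k * Real.pi) y₁ y₂ = (-1) ^ k * profile u τ θ y₁ y₂ := by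
  rw [profile, profile, Real.sin_add_int_mul_pi, Real.cos_add_int_mul_pi]; ring

theorem profile_neg (u τ θ y₁ y₂ : ℝ) :
    profile u τ (-θ) y₁ (-y₂) = -profile u τ θ y₁ y₂ := by
  rw [profile, profile, Real.sin_neg, Real.cos_neg]; ring

theorem cyl_mem_ribbon {ρ : ℝ} {n : ℕ} {u τ φ r z : ℝ} (hr : 0 < r) :
    cyl φ r z ∈ ribbon ρ n u τ ↔
      (r - ρ) ^ 2 + z ^ 2 ≤ 1 ∧ profile u τ (n * φ / 2) (r - ρ) z = 0 := by
  rw [ribbon, mem_ofPred_eq, cyl_mem_toroid hr.le, and_congr_right_iff]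
  intro _
  constructor
  · rintro ⟨φ', r', hr', h, hp⟩
    obtain ⟨rfl, -, k, rfl⟩ := cyl_inj hr hr' h
    rw [cyl_two] at hp
    have h1 : (n : ℝ) * (φ + 2 * Real.pi * k) / 2 = n * φ / 2 + ((n * k : ℤ) : ℝ) * Real.pi := by
      push_cast; ring
    rw [h1, profile_add_int_mul_pi] at hp
    exact (mul_eq_zero.1 hp).resolve_left (zpow_ne_zero _ (by norm_num))
  · exact fun h => ⟨φ, r, hr, rfl, h⟩

theorem ribbon_subset (ρ : ℝ) (n : ℕ) (u τ : ℝ) : ribbon ρ n u τ ⊆ toroid ρ := fun _ hx => hx.1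

/-! ### Symmetry -/

theorem halfTurn_cyl (φ r z : ℝ) : halfTurn (cyl φ r z) = cyl (-φ) r (-z) := by
  refine E3_ext ?_ ?_ ?_
  · change r * Real.cos φ = _; simp
  · change -(r * Real.sin φ) = _; simp
  · rfl

theorem rotation_cyl (a φ r z : ℝ) : rotation a (cyl φ r z) = cyl (φ + a) r z := by
  refine E3_ext ?_ ?_ ?_
  · change Real.cos a * (r * Real.cos φ) - Real.sin a * (r * Real.sin φ) = _
    rw [cyl_zero, Real.cos_add]; ring
  · change Real.sin a * (r * Real.cos φ) + Real.cos a * (r * Real.sin φ) = _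
    rw [cyl_one, Real.sin_add]; ring
  · rfl

theorem isEquivariant_closure {A : Set (E3 ≃ₗᵢ[ℝ] E3)} {S : Set E3} (h : ∀ g ∈ A, g '' S = S) :
    IsEquivariant (Subgroup.closure A) S := by
  intro g hg
  induction hg using Subgroup.closure_induction with
  | mem g hg => exact h g hg
  | one => exact image_id S
  | mul g g' _ _ hg hg' =>
    have : (⇑(g * g') : E3 → E3) = g ∘ g' := rfl
    rw [this, image_comp, hg', hg]
  | inv g _ hg =>
    have : (⇑(g⁻¹) : E3 → E3) ∘ g = id := funext fun x => g.symm_apply_apply x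
    conv_lhs => rw [← hg]
    rw [← image_comp, this, image_id]

theorem isEquivariant_ribbon {ρ : ℝ} (hρ : 2 < ρ) {n : ℕ} (hn : n ≠ 0) (u τ : ℝ) :
    IsEquivariant (dihedral n) (ribbon ρ n u τ) := by
  have hn' : (n : ℝ) ≠ 0 := by exact_mod_cast hn
  refine isEquivariant_closure ?_
  rintro g (rfl | rfl)
  · have hsub : ∀ x ∈ ribbon ρ n u τ, halfTurn x ∈ ribbon ρ n u τ := by
      intro x hx
      obtain ⟨φ, hφ⟩ := exists_eq_cyl x
      have hr := radius_pos hρ hx.1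
      rw [hφ, cyl_mem_ribbon hr] at hx
      rw [hφ, halfTurn_cyl, cyl_mem_ribbon hr]
      refine ⟨by simpa using hx.1, ?_⟩
      have : (n : ℝ) * -φ / 2 = -(n * φ / 2) := by ring
      rw [this, profile_neg, hx.2, neg_zero]
    refine Subset.antisymm (image_subset_iff.2 hsub) fun x hx => ⟨halfTurn x, hsub x hx, ?_⟩
    obtain ⟨φ, hφ⟩ := exists_eq_cyl x
    rw [hφ, halfTurn_cyl, halfTurn_cyl, neg_neg, neg_neg]
  · have hsub : ∀ φ r z : ℝ, 0 < r → ∀ k : ℤ, cyl φ r z ∈ ribbon ρ n u τ →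
        cyl (φ + k * (2 * Real.pi / n)) r z ∈ ribbon ρ n u τ := by
      intro φ r z hr k h
      rw [cyl_mem_ribbon hr] at h ⊢
      refine ⟨h.1, ?_⟩
      have : (n : ℝ) * (φ + k * (2 * Real.pi / n)) / 2 = n * φ / 2 + k * Real.pi := by
        field_simp
      rw [this, profile_add_int_mul_pi, h.2, mul_zero]
    refine Subset.antisymm ?_ ?_
    · rintro _ ⟨x, hx, rfl⟩
      obtain ⟨φ, hφ⟩ := exists_eq_cyl x
      have hr := radius_pos hρ hx.1
      rw [hφ] at hx ⊢
      rw [rotation_cyl]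
      simpa using hsub _ _ _ hr 1 hx
    · intro x hx
      obtain ⟨φ, hφ⟩ := exists_eq_cyl x
      have hr := radius_pos hρ hx.1
      rw [hφ] at hx
      refine ⟨_, hsub _ _ _ hr (-1) hx, ?_⟩
      rw [rotation_cyl, hφ]
      simp [radius_cyl _ hr.le]

/-! ### Local defining functions -/

/-- The open half space of points whose toroidal angle differs from `φ₀` by less than `π/2`. -/
def halfSpace (φ₀ : ℝ) : Set E3 := {x | 0 < Real.cos φ₀ * x 0 + Real.sin φ₀ * x 1}

/-- The branch of the toroidal angle on `halfSpace φ₀` with values near `φ₀`. -/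
def angleNear (φ₀ : ℝ) (x : E3) : ℝ :=
  φ₀ + Real.arctan ((Real.cos φ₀ * x 1 - Real.sin φ₀ * x 0) /
    (Real.cos φ₀ * x 0 + Real.sin φ₀ * x 1))

theorem isOpen_halfSpace (φ₀ : ℝ) : IsOpen (halfSpace φ₀) :=
  isOpen_lt continuous_const (by fun_prop)

theorem contDiff_coord (i : Fin 3) : ContDiff ℝ ∞ fun x : E3 => x i :=
  (EuclideanSpace.proj (𝕜 := ℝ) i).contDiff

theorem contDiffOn_angleNear (φ₀ : ℝ) : ContDiffOn ℝ ∞ (angleNear φ₀) (halfSpace φ₀) := by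
  refine contDiffOn_const.add (Real.contDiff_arctan.comp_contDiffOn (ContDiffOn.div ?_ ?_ ?_))
  · exact ((contDiff_const.mul (contDiff_coord 1)).sub
      (contDiff_const.mul (contDiff_coord 0))).contDiffOn
  · exact ((contDiff_const.mul (contDiff_coord 0)).add
      (contDiff_const.mul (contDiff_coord 1))).contDiffOn
  · exact fun x hx => ne_of_gt hx

theorem cyl_mem_halfSpace {φ₀ φ r z : ℝ} :
    cyl φ r z ∈ halfSpace φ₀ ↔ 0 < r * Real.cos (φ - φ₀) := by
  have : Real.cos φ₀ * (r * Real.cos φ) + Real.sin φ₀ * (r * Real.sin φ) =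
      r * Real.cos (φ - φ₀) := by rw [Real.cos_sub]; ring
  rw [halfSpace, mem_ofPred_eq, cyl_zero, cyl_one, this]

theorem angleNear_cyl {φ₀ φ r z : ℝ} (hr : r ≠ 0)
    (h : φ - φ₀ ∈ Ioo (-(Real.pi / 2)) (Real.pi / 2)) :
    angleNear φ₀ (cyl φ r z) = φ := by
  have h1 : Real.cos φ₀ * (r * Real.cos φ) + Real.sin φ₀ * (r * Real.sin φ) =
      r * Real.cos (φ - φ₀) := by rw [Real.cos_sub]; ring
  have h2 : Real.cos φ₀ * (r * Real.sin φ) - Real.sin φ₀ * (r * Real.cos φ) =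
      r * Real.sin (φ - φ₀) := by rw [Real.sin_sub]; ring
  rw [angleNear, cyl_zero, cyl_one, h1, h2, mul_div_mul_left _ _ hr, ← Real.tan_eq_sin_div_cos,
    Real.arctan_tan h.1 h.2]
  ring

theorem radius_pos_of_mem_halfSpace {φ₀ : ℝ} {x : E3} (hx : x ∈ halfSpace φ₀) : 0 < radius x := by
  refine Real.sqrt_pos.2 ?_
  by_contra h
  have h0 : x 0 = 0 := by nlinarith [sq_nonneg (x 0), sq_nonneg (x 1)]
  have h1 : x 1 = 0 := by nlinarith [sq_nonneg (x 0), sq_nonneg (x 1)]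
  simp [halfSpace, h0, h1] at hx

/-- The angle relative to `φ₀`, reduced to `(-π, π]`, has positive cosine and hence lies in `(-π/2,
π/2)`, where `arctan` inverts `tan`. -/
theorem eq_cyl_angleNear {φ₀ : ℝ} {x : E3} (hx : x ∈ halfSpace φ₀) :
    x = cyl (angleNear φ₀ x) (radius x) (x 2) := by
  have hr := radius_pos_of_mem_halfSpace hx
  obtain ⟨φ, hφ⟩ := exists_eq_cyl x
  set r := radius x
  rw [hφ, cyl_mem_halfSpace] at hx
  have hc : 0 < Real.cos (φ - φ₀) := (mul_pos_iff_of_pos_left hr).1 hx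
  set δ := toIocMod Real.two_pi_pos (-Real.pi) (φ - φ₀) with hδ
  have hδm := toIocMod_mem_Ioc Real.two_pi_pos (-Real.pi) (φ - φ₀)
  obtain ⟨k, hk⟩ : ∃ k : ℤ, φ - φ₀ = δ + k * (2 * Real.pi) := by
    refine ⟨toIocDiv Real.two_pi_pos (-Real.pi) (φ - φ₀), ?_⟩
    have := toIocMod_add_toIocDiv_zsmul Real.two_pi_pos (-Real.pi) (φ - φ₀)
    rw [zsmul_eq_mul] at this
    linarith
  have hcδ : 0 < Real.cos δ := by rwa [hk, Real.cos_add_int_mul_two_pi] at hc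
  have hδ2 : δ ∈ Ioo (-(Real.pi / 2)) (Real.pi / 2) := by
    have hp := Real.pi_pos
    by_contra hcon
    rw [mem_Ioo, not_and_or, not_lt, not_lt] at hcon
    rcases hcon with h | h
    · have : Real.cos (-δ) ≤ 0 :=
        Real.cos_nonpos_of_pi_div_two_le_of_le (by linarith) (by linarith [hδm.1])
      rw [Real.cos_neg] at this
      linarith
    · have : Real.cos δ ≤ 0 :=
        Real.cos_nonpos_of_pi_div_two_le_of_le (by linarith) (by linarith [hδm.2])
      linarith
  have hx' : x = cyl (φ₀ + δ) r (x 2) := by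
    rw [← cyl_add_two_pi (φ₀ + δ) r (x 2) k]
    have : φ₀ + δ + 2 * Real.pi * k = φ := by linarith
    rw [this]
    exact hφ
  have hang : angleNear φ₀ x = φ₀ + δ := by
    rw [hx']; exact angleNear_cyl hr.ne' (by simpa using hδ2)
  rw [hang]
  exact hx'

theorem contDiffOn_radius (φ₀ : ℝ) : ContDiffOn ℝ ∞ radius (halfSpace φ₀) := by
  refine ContDiffOn.sqrt (((contDiff_coord 0).pow 2).add ((contDiff_coord 1).pow 2)).contDiffOn
    fun x hx => ?_
  exact (Real.sqrt_pos.1 (radius_pos_of_mem_halfSpace hx)).ne'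

/-- The defining function of the ribbons on `halfSpace φ₀`. -/
def localProfile (ρ : ℝ) (n : ℕ) (φ₀ u τ : ℝ) (x : E3) : ℝ :=
  profile u τ (n * angleNear φ₀ x / 2) (radius x - ρ) (x 2)

/-- The defining function of the toroid. -/
def boundaryFun (ρ : ℝ) (x : E3) : ℝ := 1 - (radius x - ρ) ^ 2 - (x 2) ^ 2

theorem mem_ribbon_iff_localProfile {ρ : ℝ} {n : ℕ} {φ₀ u τ : ℝ} {x : E3} (hx : x ∈ halfSpace φ₀) :
    x ∈ ribbon ρ n u τ ↔ x ∈ toroid ρ ∧ localProfile ρ n φ₀ u τ x = 0 := by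
  have hr := radius_pos_of_mem_halfSpace hx
  rw [localProfile, mem_toroid]
  conv_lhs => rw [eq_cyl_angleNear hx]
  rw [cyl_mem_ribbon hr]

theorem mem_toroid_iff_boundaryFun {ρ : ℝ} {x : E3} : x ∈ toroid ρ ↔ 0 ≤ boundaryFun ρ x := by
  rw [mem_toroid, boundaryFun]; constructor <;> intro h <;> linarith

theorem contDiffOn_boundaryFun (ρ φ₀ : ℝ) : ContDiffOn ℝ ∞ (boundaryFun ρ) (halfSpace φ₀) :=
  (contDiffOn_const.sub (((contDiffOn_radius φ₀).sub contDiffOn_const).pow 2)).sub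
    ((contDiff_coord 2).pow 2).contDiffOn

theorem continuous_boundaryFun (ρ : ℝ) : Continuous (boundaryFun ρ) :=
  (continuous_const.sub ((continuous_radius.sub continuous_const).pow 2)).sub
    ((contDiff_coord 2).continuous.pow 2)

theorem contDiffOn_localProfile (ρ : ℝ) (n : ℕ) (φ₀ : ℝ) {u τ : ℝ → ℝ} (hu : ContDiff ℝ ∞ u)
    (hτ : ContDiff ℝ ∞ τ) :
    ContDiffOn ℝ ∞ (fun q : ℝ × E3 => localProfile ρ n φ₀ (u q.1) (τ q.1) q.2)
      (Prod.snd ⁻¹' halfSpace φ₀) := by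
  have hθ : ContDiffOn ℝ ∞ (fun q : ℝ × E3 => (n : ℝ) * angleNear φ₀ q.2 / 2)
      (Prod.snd ⁻¹' halfSpace φ₀) :=
    (contDiffOn_const.mul ((contDiffOn_angleNear φ₀).comp contDiffOn_snd (mapsTo_preimage _ _))).div_const 2
  have hr : ContDiffOn ℝ ∞ (fun q : ℝ × E3 => radius q.2) (Prod.snd ⁻¹' halfSpace φ₀) :=
    (contDiffOn_radius φ₀).comp contDiffOn_snd (mapsTo_preimage _ _)
  have hz : ContDiff ℝ ∞ (fun q : ℝ × E3 => q.2 2) := (contDiff_coord 2).comp contDiff_snd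
  unfold localProfile profile
  exact (((hr.sub contDiffOn_const).add (hu.comp contDiff_fst).contDiffOn).mul
    (Real.contDiff_sin.comp_contDiffOn hθ)).sub
    ((((hτ.comp contDiff_fst).mul hz).contDiffOn).mul (Real.contDiff_cos.comp_contDiffOn hθ))

theorem contDiffOn_localProfile_fixed (ρ : ℝ) (n : ℕ) (φ₀ u τ : ℝ) :
    ContDiffOn ℝ ∞ (localProfile ρ n φ₀ u τ) (halfSpace φ₀) := by
  have hθ : ContDiffOn ℝ ∞ (fun x => (n : ℝ) * angleNear φ₀ x / 2) (halfSpace φ₀) :=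
    (contDiffOn_const.mul (contDiffOn_angleNear φ₀)).div_const 2
  have hr : ContDiffOn ℝ ∞ (fun x => radius x - ρ + u) (halfSpace φ₀) :=
    ((contDiffOn_radius φ₀).sub contDiffOn_const).add contDiffOn_const
  have hz : ContDiff ℝ ∞ (fun x : E3 => τ * x 2) := contDiff_const.mul (contDiff_coord 2)
  exact (hr.mul (Real.contDiff_sin.comp_contDiffOn hθ)).sub
    (hz.contDiffOn.mul (Real.contDiff_cos.comp_contDiffOn hθ))

theorem cyl_mem_halfSpace_self {φ₀ r z : ℝ} (hr : 0 < r) : cyl φ₀ r z ∈ halfSpace φ₀ := by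
  rw [cyl_mem_halfSpace]; simpa

theorem localProfile_cyl {ρ : ℝ} {n : ℕ} {φ₀ u τ φ r z : ℝ} (hr : 0 < r)
    (h : φ - φ₀ ∈ Ioo (-(Real.pi / 2)) (Real.pi / 2)) :
    localProfile ρ n φ₀ u τ (cyl φ r z) = profile u τ (n * φ / 2) (r - ρ) z := by
  rw [localProfile, angleNear_cyl hr.ne' h, radius_cyl _ hr.le, cyl_two]

theorem isClosed_toroid (ρ : ℝ) : IsClosed (toroid ρ) := by
  have : toroid ρ = boundaryFun ρ ⁻¹' Ici 0 := by
    ext x; exact mem_toroid_iff_boundaryFun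
  rw [this]
  exact isClosed_Ici.preimage (continuous_boundaryFun ρ)

theorem boundaryFun_eq_zero_of_mem_frontier {ρ : ℝ} {x : E3} (hx : x ∈ frontier (toroid ρ)) :
    boundaryFun ρ x = 0 := by
  have : toroid ρ = {x | 0 ≤ boundaryFun ρ x} := by
    ext x; exact mem_toroid_iff_boundaryFun
  rw [this] at hx
  have h := frontier_le_subset_eq (f := fun _ : E3 => (0 : ℝ)) continuous_const
    (continuous_boundaryFun ρ) hx
  exact h.symm

theorem cyl_zero_zero (φ : ℝ) : cyl φ 0 0 = 0 := by
  refine E3_ext ?_ ?_ ?_ <;> simp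

theorem hasDerivAt_cyl_radial (φ r z : ℝ) : HasDerivAt (fun s => cyl φ s z) (cyl φ 1 0) r := by
  simpa [cyl_zero_zero] using
    hasDerivAt_cyl (hasDerivAt_const r φ) (hasDerivAt_id r) (hasDerivAt_const r z)

theorem hasDerivAt_cyl_axial (φ r z : ℝ) : HasDerivAt (fun s => cyl φ r s) (cyl φ 0 1) z := by
  simpa [cyl_zero_zero] using
    hasDerivAt_cyl (hasDerivAt_const z φ) (hasDerivAt_const z r) (hasDerivAt_id z)

theorem hasDerivAt_cyl_angular (φ r z : ℝ) :
    HasDerivAt (fun s => cyl s r z) (cyl (φ + Real.pi / 2) r 0) φ := by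
  simpa [cyl_zero_zero] using
    hasDerivAt_cyl (hasDerivAt_id φ) (hasDerivAt_const φ r) (hasDerivAt_const φ z)

/-! ### Derivatives of the defining functions in the cylindrical directions -/

theorem fderiv_apply_eq_of_hasDerivAt {G : E3 → ℝ} {γ : ℝ → E3} {v : E3} {t c : ℝ}
    (hG : DifferentiableAt ℝ G (γ t)) (hγ : HasDerivAt γ v t)
    (h : HasDerivAt (fun s => G (γ s)) c t) : fderiv ℝ G (γ t) v = c :=
  (hG.hasFDerivAt.comp_hasDerivAt t hγ).unique h

theorem differentiableAt_localProfile {ρ : ℝ} {n : ℕ} {φ₀ u τ : ℝ} {x : E3}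
    (hx : x ∈ halfSpace φ₀) : DifferentiableAt ℝ (localProfile ρ n φ₀ u τ) x :=
  ((contDiffOn_localProfile_fixed ρ n φ₀ u τ).differentiableOn (by simp)).differentiableAt
    ((isOpen_halfSpace φ₀).mem_nhds hx)

theorem differentiableAt_boundaryFun {ρ φ₀ : ℝ} {x : E3}
    (hx : x ∈ halfSpace φ₀) : DifferentiableAt ℝ (boundaryFun ρ) x :=
  ((contDiffOn_boundaryFun ρ φ₀).differentiableOn (by simp)).differentiableAt
    ((isOpen_halfSpace φ₀).mem_nhds hx)

theorem zero_mem_Ioo_half_pi : (0 : ℝ) ∈ Ioo (-(Real.pi / 2)) (Real.pi / 2) := by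
  constructor <;> linarith [Real.pi_pos]

theorem fderiv_localProfile_radial (ρ : ℝ) (n : ℕ) (φ u τ : ℝ) {r : ℝ} (hr : 0 < r) (z : ℝ) :
    fderiv ℝ (localProfile ρ n φ u τ) (cyl φ r z) (cyl φ 1 0) = Real.sin (n * φ / 2) := by
  refine fderiv_apply_eq_of_hasDerivAt (γ := fun s => cyl φ s z)
    (differentiableAt_localProfile (cyl_mem_halfSpace_self hr)) (hasDerivAt_cyl_radial φ r z) ?_
  have h1 : HasDerivAt (fun s => profile u τ (n * φ / 2) (s - ρ) z) (Real.sin (n * φ / 2)) r := by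
    unfold profile
    simpa using ((((hasDerivAt_id r).sub_const ρ).add_const u).mul_const
      (Real.sin (n * φ / 2))).sub_const (τ * z * Real.cos (n * φ / 2))
  refine h1.congr_of_eventuallyEq ?_
  filter_upwards [lt_mem_nhds hr] with s hs
  exact localProfile_cyl hs (by rw [sub_self]; exact zero_mem_Ioo_half_pi)

theorem fderiv_localProfile_axial (ρ : ℝ) (n : ℕ) (φ u τ : ℝ) {r : ℝ} (hr : 0 < r) (z : ℝ) :
    fderiv ℝ (localProfile ρ n φ u τ) (cyl φ r z) (cyl φ 0 1) = -(τ * Real.cos (n * φ / 2)) := by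
  refine fderiv_apply_eq_of_hasDerivAt (γ := fun s => cyl φ r s)
    (differentiableAt_localProfile (cyl_mem_halfSpace_self hr)) (hasDerivAt_cyl_axial φ r z) ?_
  have h1 : HasDerivAt (fun s => profile u τ (n * φ / 2) (r - ρ) s)
      (-(τ * Real.cos (n * φ / 2))) z := by
    unfold profile
    simpa using (((hasDerivAt_id z).const_mul τ).mul_const (Real.cos (n * φ / 2))).const_sub
      ((r - ρ + u) * Real.sin (n * φ / 2))
  refine h1.congr_of_eventuallyEq (Eventually.of_forall fun s => ?_)
  exact localProfile_cyl hr (by rw [sub_self]; exact zero_mem_Ioo_half_pi)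

theorem fderiv_localProfile_angular (ρ : ℝ) (n : ℕ) (φ u τ : ℝ) {r : ℝ} (hr : 0 < r) (z : ℝ) :
    fderiv ℝ (localProfile ρ n φ u τ) (cyl φ r z) (cyl (φ + Real.pi / 2) r 0) =
      n / 2 * ((r - ρ + u) * Real.cos (n * φ / 2) + τ * z * Real.sin (n * φ / 2)) := by
  refine fderiv_apply_eq_of_hasDerivAt (γ := fun s => cyl s r z)
    (differentiableAt_localProfile (cyl_mem_halfSpace_self hr)) (hasDerivAt_cyl_angular φ r z) ?_
  have h0 : HasDerivAt (fun s : ℝ => (n : ℝ) * s / 2) (n / 2) φ := by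
    simpa using ((hasDerivAt_id φ).const_mul (n : ℝ)).div_const 2
  have h1 : HasDerivAt (fun s => profile u τ (n * s / 2) (r - ρ) z)
      (n / 2 * ((r - ρ + u) * Real.cos (n * φ / 2) + τ * z * Real.sin (n * φ / 2))) φ := by
    unfold profile
    refine ((h0.sin.const_mul (r - ρ + u)).sub (h0.cos.const_mul (τ * z))).congr_deriv ?_
    ring
  refine h1.congr_of_eventuallyEq ?_
  have hnear : ∀ᶠ s in 𝓝 φ, s - φ ∈ Ioo (-(Real.pi / 2)) (Real.pi / 2) := by
    have hc : ContinuousAt (fun s : ℝ => s - φ) φ := by fun_prop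
    refine hc.eventually (isOpen_Ioo.mem_nhds ?_)
    simpa using zero_mem_Ioo_half_pi
  filter_upwards [hnear] with s hs
  exact localProfile_cyl hr hs

theorem fderiv_boundaryFun_radial (ρ φ : ℝ) {r : ℝ} (hr : 0 < r) (z : ℝ) :
    fderiv ℝ (boundaryFun ρ) (cyl φ r z) (cyl φ 1 0) = -(2 * (r - ρ)) := by
  refine fderiv_apply_eq_of_hasDerivAt (γ := fun s => cyl φ s z)
    (differentiableAt_boundaryFun (cyl_mem_halfSpace_self hr)) (hasDerivAt_cyl_radial φ r z) ?_
  have h1 : HasDerivAt (fun s => 1 - (s - ρ) ^ 2 - z ^ 2) (-(2 * (r - ρ))) r := by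
    simpa using ((((hasDerivAt_id r).sub_const ρ).pow 2).const_sub 1).sub_const (z ^ 2)
  refine h1.congr_of_eventuallyEq ?_
  filter_upwards [lt_mem_nhds hr] with s hs
  rw [boundaryFun, radius_cyl _ hs.le, cyl_two]

theorem fderiv_boundaryFun_axial (ρ φ : ℝ) {r : ℝ} (hr : 0 < r) (z : ℝ) :
    fderiv ℝ (boundaryFun ρ) (cyl φ r z) (cyl φ 0 1) = -(2 * z) := by
  refine fderiv_apply_eq_of_hasDerivAt (γ := fun s => cyl φ r s)
    (differentiableAt_boundaryFun (cyl_mem_halfSpace_self hr)) (hasDerivAt_cyl_axial φ r z) ?_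
  have h1 : HasDerivAt (fun s => 1 - (r - ρ) ^ 2 - s ^ 2) (-(2 * z)) z := by
    simpa using ((hasDerivAt_id z).pow 2).const_sub (1 - (r - ρ) ^ 2)
  refine h1.congr_of_eventuallyEq (Eventually.of_forall fun s => ?_)
  simp only [boundaryFun, radius_cyl _ hr.le, cyl_two]

/-- The radial and axial derivatives `sin θ` and `-τ cos θ` cannot vanish together. -/
theorem fderiv_localProfile_ne_zero (ρ : ℝ) (n : ℕ) (φ u : ℝ) {τ r : ℝ} (hτ : τ ≠ 0) (hr : 0 < r)
    (z : ℝ) : fderiv ℝ (localProfile ρ n φ u τ) (cyl φ r z) ≠ 0 := by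
  intro h
  have h1 := fderiv_localProfile_radial ρ n φ u τ hr z
  have h2 := fderiv_localProfile_axial ρ n φ u τ hr z
  rw [h] at h1 h2
  have h3 : Real.sin (n * φ / 2) = 0 := h1.symm
  have h4 : Real.cos (n * φ / 2) = 0 := by
    have : τ * Real.cos (n * φ / 2) = 0 := by simpa using h2
    exact (mul_eq_zero.1 this).resolve_left hτ
  have := Real.sin_sq_add_cos_sq (n * φ / 2)
  rw [h3, h4] at this
  norm_num at this

/-- Up to the factor `-2`, the expression squared is the Jacobian of the profile and of the boundary
function in the cross-section. The relation `u² + τ² = 1` fixes its size at both ends of every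
chord. -/
theorem sq_transversality {u τ a b θ : ℝ} (hu : u ^ 2 + τ ^ 2 = 1) (hab : a ^ 2 + b ^ 2 = 1)
    (h : profile u τ θ a b = 0) : (b * Real.sin θ + τ * a * Real.cos θ) ^ 2 = τ ^ 2 := by
  have hsc := Real.sin_sq_add_cos_sq θ
  rw [profile] at h
  set S := Real.sin θ
  set C := Real.cos θ
  have e1 : a * S - τ * b * C = -u * S := by linarith
  have e2 : (a * S - τ * b * C) ^ 2 = u ^ 2 * S ^ 2 := by rw [e1]; ring
  linear_combination (S ^ 2 + τ ^ 2 * C ^ 2) * hab - e2 - S ^ 2 * hu + τ ^ 2 * hsc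

theorem linearIndependent_localProfile_boundaryFun {ρ : ℝ} {n : ℕ} {φ u τ r z : ℝ}
    (hu : u ^ 2 + τ ^ 2 = 1) (hτ : τ ≠ 0) (hr : 0 < r) (hb : (r - ρ) ^ 2 + z ^ 2 = 1)
    (h : profile u τ (n * φ / 2) (r - ρ) z = 0) :
    LinearIndependent ℝ ![fderiv ℝ (localProfile ρ n φ u τ) (cyl φ r z),
      fderiv ℝ (boundaryFun ρ) (cyl φ r z)] := by
  rw [LinearIndependent.pair_iff]
  intro a b hab
  have h1 := congrArg (fun L : E3 →L[ℝ] ℝ => L (cyl φ 1 0)) hab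
  have h2 := congrArg (fun L : E3 →L[ℝ] ℝ => L (cyl φ 0 1)) hab
  simp only [add_apply, smul_apply,
    fderiv_localProfile_radial ρ n φ u τ hr z, fderiv_localProfile_axial ρ n φ u τ hr z,
    fderiv_boundaryFun_radial ρ φ hr z, fderiv_boundaryFun_axial ρ φ hr z, smul_eq_mul,
    zero_apply] at h1 h2
  have key := sq_transversality hu hb h
  have hD : z * Real.sin (n * φ / 2) + τ * (r - ρ) * Real.cos (n * φ / 2) ≠ 0 := by
    intro h0
    rw [h0] at key
    exact hτ (pow_eq_zero_iff (two_ne_zero)|>.1 (by linarith))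
  constructor
  -- Cramer's rule for the radial and axial equations, whose determinant is a multiple of the
  -- quantity in `hD`.
  · refine (mul_eq_zero.1 (?_ : a * _ = 0)).resolve_right hD
    linear_combination z * h1 - (r - ρ) * h2
  · refine (mul_eq_zero.1 (?_ : b * _ = 0)).resolve_right hD
    linear_combination -(τ * Real.cos (n * φ / 2)) / 2 * h1 - Real.sin (n * φ / 2) / 2 * h2

/-! ### The sweepout -/

/-- The sweepout. -/
def sweep (ρ : ℝ) (n : ℕ) (t : ℝ) : Set E3 :=
  ribbon ρ n (Real.cos (Real.pi * t)) (Real.sin (Real.pi * t))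

theorem contDiff_cos_pi : ContDiff ℝ ∞ fun t : ℝ => Real.cos (Real.pi * t) :=
  Real.contDiff_cos.comp (contDiff_const.mul contDiff_id)

theorem contDiff_sin_pi : ContDiff ℝ ∞ fun t : ℝ => Real.sin (Real.pi * t) :=
  Real.contDiff_sin.comp (contDiff_const.mul contDiff_id)

theorem sin_pi_pos {t : ℝ} (ht : t ∈ Ioo (0 : ℝ) 1) : 0 < Real.sin (Real.pi * t) :=
  Real.sin_pos_of_pos_of_lt_pi (mul_pos Real.pi_pos ht.1) (by nlinarith [Real.pi_pos, ht.2])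

theorem sin_pi_nonneg {t : ℝ} (ht : t ∈ Icc (0 : ℝ) 1) : 0 ≤ Real.sin (Real.pi * t) :=
  Real.sin_nonneg_of_nonneg_of_le_pi (mul_nonneg Real.pi_pos.le ht.1)
    (by nlinarith [Real.pi_pos, ht.2])

/-- The defining function of the sweepout on `halfSpace φ₀`. -/
def familyProfile (ρ : ℝ) (n : ℕ) (φ₀ : ℝ) (q : ℝ × E3) : ℝ :=
  localProfile ρ n φ₀ (Real.cos (Real.pi * q.1)) (Real.sin (Real.pi * q.1)) q.2

theorem contDiffOn_familyProfile (ρ : ℝ) (n : ℕ) (φ₀ : ℝ) :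
    ContDiffOn ℝ ∞ (familyProfile ρ n φ₀) (Prod.snd ⁻¹' halfSpace φ₀) :=
  contDiffOn_localProfile ρ n φ₀ contDiff_cos_pi contDiff_sin_pi

theorem isOpen_preimage_halfSpace (φ₀ : ℝ) :
    IsOpen (Prod.snd ⁻¹' halfSpace φ₀ : Set (ℝ × E3)) :=
  (isOpen_halfSpace φ₀).preimage continuous_snd

/-- This is the closedness of the total space; it also gives the closedness of each slice, the end
times included. -/
theorem eventually_not_mem_sweep {ρ : ℝ} (hρ : 2 < ρ) (n : ℕ) {t₀ : ℝ} {p : E3}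
    (hp : p ∉ sweep ρ n t₀) : ∀ᶠ q in 𝓝 (t₀, p), q.2 ∉ sweep ρ n q.1 := by
  by_cases hM : p ∈ toroid ρ
  · obtain ⟨φ, hφ⟩ := exists_eq_cyl p
    have hr := radius_pos hρ hM
    have hph : p ∈ halfSpace φ := by rw [hφ]; exact cyl_mem_halfSpace_self hr
    have hne : familyProfile ρ n φ (t₀, p) ≠ 0 := fun h =>
      hp ((mem_ribbon_iff_localProfile hph).2 ⟨hM, h⟩)
    have hU : Prod.snd ⁻¹' halfSpace φ ∈ 𝓝 (t₀, p) := (isOpen_preimage_halfSpace φ).mem_nhds hph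
    have hc := (contDiffOn_familyProfile ρ n φ).continuousOn.continuousAt hU
    filter_upwards [hU, hc.eventually_ne hne] with q hq hq0 hmem
    exact hq0 ((mem_ribbon_iff_localProfile hq).1 hmem).2
  · have hU : Prod.snd ⁻¹' (toroid ρ)ᶜ ∈ 𝓝 (t₀, p) :=
      ((isClosed_toroid ρ).isOpen_compl.preimage continuous_snd).mem_nhds hM
    filter_upwards [hU] with q hq hmem
    exact hq hmem.1

theorem isClosed_sweep {ρ : ℝ} (hρ : 2 < ρ) (n : ℕ) (t : ℝ) : IsClosed (sweep ρ n t) := by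
  rw [← isOpen_compl_iff, isOpen_iff_mem_nhds]
  intro p hp
  have hc : Tendsto (fun x : E3 => (t, x)) (𝓝 p) (𝓝 (t, p)) :=
    (Continuous.prodMk_right t).tendsto p
  exact hc.eventually (eventually_not_mem_sweep hρ n hp)

theorem exists_cyl_of_mem_toroid {ρ : ℝ} (hρ : 2 < ρ) {x : E3} (hx : x ∈ toroid ρ) :
    ∃ φ r z, 0 < r ∧ x = cyl φ r z := by
  obtain ⟨φ, hφ⟩ := exists_eq_cyl x
  exact ⟨φ, _, _, radius_pos hρ hx, hφ⟩

theorem isInteriorFamilyPoint_sweep {ρ : ℝ} (hρ : 2 < ρ) (n : ℕ) {t₀ : ℝ} (ht : t₀ ∈ Ioo (0 : ℝ) 1)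
    {p : E3} (hp : p ∈ sweep ρ n t₀) (hpf : p ∉ frontier (toroid ρ)) :
    IsInteriorFamilyPoint (sweep ρ n) t₀ p := by
  have hM := hp.1
  obtain ⟨φ, r, z, hr, rfl⟩ := exists_cyl_of_mem_toroid hρ hM
  have hint : cyl φ r z ∈ interior (toroid ρ) := by
    by_contra h
    exact hpf ⟨subset_closure hM, h⟩
  have hne := fderiv_localProfile_ne_zero ρ n φ (Real.cos (Real.pi * t₀)) (sin_pi_pos ht).ne' hr z
  refine ⟨Prod.snd ⁻¹' (halfSpace φ ∩ interior (toroid ρ)), familyProfile ρ n φ,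
    ((isOpen_halfSpace φ).inter isOpen_interior).preimage continuous_snd,
    ⟨cyl_mem_halfSpace_self hr, hint⟩,
    (contDiffOn_familyProfile ρ n φ).mono fun q hq => hq.1, hne, fun q hq => ?_⟩
  rw [sweep, mem_ribbon_iff_localProfile hq.1]
  exact and_iff_right (interior_subset hq.2)

theorem isBoundaryFamilyPoint_sweep {ρ : ℝ} (hρ : 2 < ρ) (n : ℕ) {t₀ : ℝ}
    (ht : t₀ ∈ Ioo (0 : ℝ) 1) {p : E3} (hp : p ∈ sweep ρ n t₀) (hpf : p ∈ frontier (toroid ρ)) :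
    IsBoundaryFamilyPoint (sweep ρ n) t₀ p := by
  have hM := hp.1
  obtain ⟨φ, r, z, hr, rfl⟩ := exists_cyl_of_mem_toroid hρ hM
  have hph : cyl φ r z ∈ halfSpace φ := cyl_mem_halfSpace_self hr
  have hb := boundaryFun_eq_zero_of_mem_frontier hpf
  have hb' : (r - ρ) ^ 2 + z ^ 2 = 1 := by
    rw [boundaryFun, radius_cyl _ hr.le, cyl_two] at hb
    linarith
  have hprof := ((cyl_mem_ribbon hr).1 hp).2
  have hli := linearIndependent_localProfile_boundaryFun (Real.cos_sq_add_sin_sq (Real.pi * t₀))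
    (sin_pi_pos ht).ne' hr hb' hprof
  have hf0 := ((mem_ribbon_iff_localProfile hph).1 hp).2
  have hg : ContDiffOn ℝ ∞ (fun q : ℝ × E3 => boundaryFun ρ q.2) (Prod.snd ⁻¹' halfSpace φ) :=
    (contDiffOn_boundaryFun ρ φ).comp contDiffOn_snd fun q hq => hq
  refine ⟨Prod.snd ⁻¹' halfSpace φ, familyProfile ρ n φ, fun q => boundaryFun ρ q.2,
    isOpen_preimage_halfSpace φ, hph, contDiffOn_familyProfile ρ n φ, hg, hf0, hb, hli,
    fun q hq => ?_⟩
  rw [sweep, mem_ribbon_iff_localProfile hq, mem_toroid_iff_boundaryFun, and_comm]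
  rfl

theorem variesSmoothly_sweep {ρ : ℝ} (hρ : 2 < ρ) (n : ℕ) :
    VariesSmoothly (toroid ρ) (sweep ρ n) := fun _ ht =>
  ⟨fun _ hp hpf => isInteriorFamilyPoint_sweep hρ n ht hp hpf,
    fun _ hp hpf => isBoundaryFamilyPoint_sweep hρ n ht hp hpf,
    fun _ hp => eventually_not_mem_sweep hρ n hp⟩

theorem IsInteriorFamilyPoint.isInteriorPoint {S : ℝ → Set E3} {t₀ : ℝ} {p : E3}
    (h : IsInteriorFamilyPoint S t₀ p) : IsInteriorPoint (S t₀) p := by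
  obtain ⟨U, f, hU, hp, hf, hd, hS⟩ := h
  have hs : ContDiff ℝ ∞ fun x : E3 => (t₀, x) := contDiff_const.prodMk contDiff_id
  exact ⟨(fun x => (t₀, x)) ⁻¹' U, fun x => f (t₀, x), hU.preimage hs.continuous, hp,
    hf.comp hs.contDiffOn (mapsTo_preimage _ _), hd, fun x hx => hS (t₀, x) hx⟩

theorem IsBoundaryFamilyPoint.isBoundaryPoint {S : ℝ → Set E3} {t₀ : ℝ} {p : E3}
    (h : IsBoundaryFamilyPoint S t₀ p) : IsBoundaryPoint (S t₀) p := by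
  obtain ⟨U, f, g, hU, hp, hf, hg, hf0, hg0, hd, hS⟩ := h
  have hs : ContDiff ℝ ∞ fun x : E3 => (t₀, x) := contDiff_const.prodMk contDiff_id
  exact ⟨(fun x => (t₀, x)) ⁻¹' U, fun x => f (t₀, x), fun x => g (t₀, x),
    hU.preimage hs.continuous, hp, hf.comp hs.contDiffOn (mapsTo_preimage _ _),
    hg.comp hs.contDiffOn (mapsTo_preimage _ _), hf0, hg0, hd, fun x hx => hS (t₀, x) hx⟩

theorem isProperlyEmbedded_sweep {ρ : ℝ} (hρ : 2 < ρ) (n : ℕ) {t : ℝ} (ht : t ∈ Ioo (0 : ℝ) 1) :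
    IsProperlyEmbedded (toroid ρ) (sweep ρ n t) :=
  ⟨ribbon_subset _ _ _ _, isClosed_sweep hρ n t,
    fun _ hp hpf => (isInteriorFamilyPoint_sweep hρ n ht hp hpf).isInteriorPoint,
    fun _ hp hpf => (isBoundaryFamilyPoint_sweep hρ n ht hp hpf).isBoundaryPoint⟩

/-! ### Tangent planes -/

/-- The parameters with `γ s ∈ S` form a neighbourhood of `t`, whose tangent cone is the whole line;
the derivative of `γ` maps it into the cone of `S`. -/
theorem mem_tangentConeAt_of_hasDerivAt {S : Set E3} {γ : ℝ → E3} {v : E3} {t : ℝ}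
    (hγ : HasDerivAt γ v t) (hS : ∀ᶠ s in 𝓝 t, γ s ∈ S) : v ∈ tangentConeAt ℝ S (γ t) := by
  set W : Set ℝ := {s | γ s ∈ S} with hW
  have hWt : tangentConeAt ℝ W t = univ := tangentConeAt_of_mem_nhds hS
  have h1 := (hγ.hasFDerivAt.hasFDerivWithinAt (s := W)).mapsTo_tangent_cone
    (show (1 : ℝ) ∈ tangentConeAt ℝ W t by rw [hWt]; trivial)
  have h2 : γ '' W ⊆ S := by rintro _ ⟨s, hs, rfl⟩; exact hs
  simpa using tangentConeAt_mono h2 h1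

theorem finrank_span_pair {v₁ v₂ : E3} (hli : LinearIndependent ℝ ![v₁, v₂]) :
    Module.finrank ℝ (Submodule.span ℝ {v₁, v₂}) = 2 := by
  have h := finrank_span_eq_card hli
  rw [Matrix.range_cons_cons_empty] at h
  simpa using h

/-- The tangent space lies between the span of `v₁, v₂` and the kernel of `dF`. Both have dimension
two, as has the orthogonal complement of `N`, so all of them agree. -/
theorem tangentSpace_eq_orthogonal {S : Set E3} {p : E3} {F : E3 → ℝ} {N v₁ v₂ : E3}
    (hF : DifferentiableAt ℝ F p) (hF0 : fderiv ℝ F p ≠ 0) (hSF : ∀ᶠ x in 𝓝 p, x ∈ S → F x = 0)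
    (h₁ : v₁ ∈ tangentConeAt ℝ S p) (h₂ : v₂ ∈ tangentConeAt ℝ S p)
    (hli : LinearIndependent ℝ ![v₁, v₂]) (hN : N ≠ 0) (hN₁ : inner ℝ N v₁ = 0)
    (hN₂ : inner ℝ N v₂ = 0) : tangentSpace S p = (ℝ ∙ N)ᗮ := by
  have hW := finrank_span_pair hli
  have hWT : Submodule.span ℝ {v₁, v₂} ≤ tangentSpace S p := by
    rw [Submodule.span_le]
    rintro x (rfl | rfl)
    · exact Submodule.subset_span h₁
    · exact Submodule.subset_span h₂
  have hWN : Submodule.span ℝ {v₁, v₂} ≤ (ℝ ∙ N)ᗮ := by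
    rw [Submodule.span_le]
    rintro x (rfl | rfl)
    · exact Submodule.mem_orthogonal_singleton_iff_inner_right.2 hN₁
    · exact Submodule.mem_orthogonal_singleton_iff_inner_right.2 hN₂
  have hNf : Module.finrank ℝ ((ℝ ∙ N)ᗮ : Submodule ℝ E3) = 2 := by
    have := Submodule.finrank_add_finrank_orthogonal (ℝ ∙ N : Submodule ℝ E3)
    rw [finrank_span_singleton hN, finrank_euclideanSpace_fin] at this
    omega
  have hTk : tangentSpace S p ≤ LinearMap.ker (fderiv ℝ F p : E3 →ₗ[ℝ] ℝ) := by
    rw [tangentSpace, Submodule.span_le]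
    intro v hv
    set U : Set E3 := {x | x ∈ S → F x = 0} with hU
    have hv' : v ∈ tangentConeAt ℝ (S ∩ U) p := by rwa [tangentConeAt_inter_nhds hSF]
    have hpc : p ∈ closure S := mem_closure_of_nonempty_tangentConeAt ⟨v, hv⟩
    have hFp : F p = 0 := by
      have hpc' : p ∈ closure (S ∩ U) := mem_closure_of_nonempty_tangentConeAt ⟨v, hv'⟩
      have : MapsTo F (S ∩ U) {0} := fun x hx => hx.2 hx.1
      simpa using hF.continuousAt.continuousWithinAt.mem_closure hpc' this
    -- On `S ∩ U` the function vanishes, so `dF` and `0` are both derivatives of `F` within this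
    -- set; they agree on its tangent cone, which is that of `S`.
    have hd1 : HasFDerivWithinAt F (fderiv ℝ F p) (S ∩ U) p := hF.hasFDerivAt.hasFDerivWithinAt
    have hd2 : HasFDerivWithinAt F (0 : E3 →L[ℝ] ℝ) (S ∩ U) p :=
      (hasFDerivWithinAt_const (0 : ℝ) p (S ∩ U)).congr (fun x hx => hx.2 hx.1) hFp
    simpa using hd1.unique_on hd2 hv'
  have hk : Module.finrank ℝ (LinearMap.ker (fderiv ℝ F p : E3 →ₗ[ℝ] ℝ)) = 2 := by
    have h1 := LinearMap.finrank_range_add_finrank_ker (fderiv ℝ F p : E3 →ₗ[ℝ] ℝ)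
    have h2 : LinearMap.range (fderiv ℝ F p : E3 →ₗ[ℝ] ℝ) = ⊤ :=
      LinearMap.range_eq_top.2 (LinearMap.surjective (by
        intro h; exact hF0 (ContinuousLinearMap.coe_injective h)))
    rw [h2, finrank_top, finrank_euclideanSpace_fin, Module.finrank_self] at h1
    omega
  have e1 : Submodule.span ℝ {v₁, v₂} = LinearMap.ker (fderiv ℝ F p : E3 →ₗ[ℝ] ℝ) :=
    Submodule.eq_of_le_of_finrank_eq (hWT.trans hTk) (hW.trans hk.symm)
  have e2 : Submodule.span ℝ {v₁, v₂} = (ℝ ∙ N)ᗮ :=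
    Submodule.eq_of_le_of_finrank_eq hWN (hW.trans hNf.symm)
  rw [← e2]
  exact le_antisymm (e1 ▸ hTk) hWT

/-! ### The segments -/

theorem inner_cyl (φ r z φ' r' z' : ℝ) :
    inner ℝ (cyl φ r z) (cyl φ' r' z') = r * r' * Real.cos (φ - φ') + z * z' := by
  simp only [PiLp.inner_apply, Fin.sum_univ_three, cyl_zero, cyl_one, cyl_two, Real.cos_sub]
  simp
  ring

theorem smul_segmentDir (n k : ℕ) (r : ℝ) :
    r • segmentDir n k = cyl (Real.pi * k / n) r 0 := by
  refine E3_ext ?_ ?_ ?_ <;> simp [segmentDir]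

theorem segmentDir_eq_cyl (n k : ℕ) : segmentDir n k = cyl (Real.pi * k / n) 1 0 := by
  simpa using smul_segmentDir n k 1

theorem linearIndependent_pair_of_inner_eq_zero {v w : E3} (hv : v ≠ 0) (hw : w ≠ 0)
    (h : inner ℝ v w = 0) : LinearIndependent ℝ ![v, w] := by
  rw [LinearIndependent.pair_iff]
  intro a b hab
  have h1 := congrArg (fun x => inner ℝ v x) hab
  have h2 := congrArg (fun x => inner ℝ w x) hab
  simp only [inner_add_right, inner_smul_right, h, real_inner_comm, inner_zero_right, mul_zero,
    add_zero, zero_add, mul_eq_zero, inner_self_eq_zero, hv, hw, or_false] at h1 h2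
  exact ⟨h1, h2⟩

/-- For even `k` the angle `θ` is a multiple of `π`, so `profile` reduces to a multiple of the
height, which is zero on the segment. -/
theorem segment_subset_sweep {ρ : ℝ} (hρ : 2 < ρ) {n : ℕ} (hn : n ≠ 0) {k : ℕ} (hk : Even k)
    (t : ℝ) : segment ρ n k ⊆ sweep ρ n t := by
  have hn' : (n : ℝ) ≠ 0 := by exact_mod_cast hn
  rintro x ⟨r, hr, rfl⟩
  obtain ⟨m, rfl⟩ := hk
  have hr0 : 0 < r := by linarith [hr.1]
  rw [smul_segmentDir, sweep, cyl_mem_ribbon hr0]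
  refine ⟨by nlinarith [hr.1, hr.2], ?_⟩
  have hθ : (n : ℝ) * (Real.pi * (m + m : ℕ) / n) / 2 = m * Real.pi := by
    push_cast; field_simp; ring
  rw [hθ, profile, Real.sin_nat_mul_pi]
  ring

/-- For odd `k` the chord is vertical and meets the segment only at radius `ρ - u`. The horizontal
circle of this radius lies in the ribbon, so its tangent and the vertical direction span the tangent
plane. -/
theorem meetsOrthogonally_sweep {ρ : ℝ} (hρ : 2 < ρ) {n : ℕ} (hn : n ≠ 0) {k : ℕ} (hk : Odd k)
    {t : ℝ} (ht : t ∈ Ioo (0 : ℝ) 1) : MeetsOrthogonally ρ n k (sweep ρ n t) := by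
  have hn' : (n : ℝ) ≠ 0 := by exact_mod_cast hn
  obtain ⟨m, rfl⟩ := hk
  set u := Real.cos (Real.pi * t) with hu
  set τ := Real.sin (Real.pi * t) with hτ
  have hτ0 : 0 < τ := sin_pi_pos ht
  have huτ : u ^ 2 + τ ^ 2 = 1 := Real.cos_sq_add_sin_sq _
  have hu1 : u ^ 2 < 1 := by nlinarith
  have hub : |u| < 1 := (sq_lt_one_iff_abs_lt_one u).1 hu1
  have hub' := abs_lt.1 hub
  set φ := Real.pi * (2 * m + 1 : ℕ) / n with hφ
  have hθ : (n : ℝ) * φ / 2 = m * Real.pi + Real.pi / 2 := by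
    rw [hφ]; push_cast; field_simp
  have hcos : Real.cos (n * φ / 2) = 0 := by
    rw [hθ, Real.cos_add_pi_div_two, Real.sin_nat_mul_pi, neg_zero]
  have hsin : Real.sin (n * φ / 2) ≠ 0 := by
    intro h
    have := Real.sin_sq_add_cos_sq (n * φ / 2)
    rw [h, hcos] at this
    norm_num at this
  have hr0 : 0 < ρ - u := by linarith
  have hmem : ∀ r z : ℝ, 0 < r → (cyl φ r z ∈ sweep ρ n t ↔
      (r - ρ) ^ 2 + z ^ 2 ≤ 1 ∧ r = ρ - u) := fun r z hr => by
    rw [sweep, cyl_mem_ribbon hr, profile, hcos]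
    refine and_congr_right fun _ => ⟨fun h => ?_, fun h => ?_⟩
    · have : (r - ρ + u) * Real.sin (n * φ / 2) = 0 := by linarith
      linarith [(mul_eq_zero.1 this).resolve_right hsin]
    · rw [h]; ring
  refine ⟨⟨cyl φ (ρ - u) 0, (hmem _ _ hr0).2 ⟨by nlinarith, rfl⟩, ρ - u,
    ⟨by linarith, by linarith⟩, (smul_segmentDir _ _ _).symm⟩, ?_⟩
  rintro p ⟨hp, r, hr, rfl⟩
  rw [smul_segmentDir, ← hφ] at hp ⊢
  obtain ⟨-, rfl⟩ := (hmem r 0 (by linarith [hr.1])).1 hp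
  rw [segmentDir_eq_cyl, ← hφ]
  have hph : cyl φ (ρ - u) 0 ∈ halfSpace φ := cyl_mem_halfSpace_self hr0
  refine tangentSpace_eq_orthogonal (F := localProfile ρ n φ u τ)
    (v₁ := cyl (φ + Real.pi / 2) (ρ - u) 0) (v₂ := cyl φ 0 1)
    (differentiableAt_localProfile hph)
    (fderiv_localProfile_ne_zero ρ n φ u hτ0.ne' hr0 0) ?_ ?_ ?_ ?_ ?_ ?_ ?_
  · filter_upwards [(isOpen_halfSpace φ).mem_nhds hph] with x hx hxS
    exact ((mem_ribbon_iff_localProfile hx).1 hxS).2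
  · refine mem_tangentConeAt_of_hasDerivAt (γ := fun s => cyl s (ρ - u) 0)
      (hasDerivAt_cyl_angular φ (ρ - u) 0) (Eventually.of_forall fun s => ?_)
    rw [sweep, cyl_mem_ribbon hr0]
    refine ⟨by nlinarith, ?_⟩
    rw [profile, ← hu]; ring
  · refine mem_tangentConeAt_of_hasDerivAt (γ := fun z => cyl φ (ρ - u) z)
      (hasDerivAt_cyl_axial φ (ρ - u) 0) ?_
    have hc : ContinuousAt (fun z : ℝ => (ρ - u - ρ) ^ 2 + z ^ 2) 0 := by fun_prop
    have : ∀ᶠ z in 𝓝 (0 : ℝ), (ρ - u - ρ) ^ 2 + z ^ 2 < 1 :=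
      hc.eventually (gt_mem_nhds (by nlinarith))
    filter_upwards [this] with z hz
    exact (hmem _ _ hr0).2 ⟨hz.le, rfl⟩
  · refine linearIndependent_pair_of_inner_eq_zero ?_ ?_ ?_
    · rw [← inner_self_ne_zero (𝕜 := ℝ), inner_cyl]
      simpa using hr0.ne'
    · rw [← inner_self_ne_zero (𝕜 := ℝ), inner_cyl]
      simp
    · rw [inner_cyl]; simp
  · rw [← inner_self_ne_zero (𝕜 := ℝ), inner_cyl]
    simp
  · rw [inner_cyl]; simp
  · rw [inner_cyl]; simp

/-! ### The ribbons as twisted bands -/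

/-- The point `(X, Y)` of the disc moved by the projective automorphism of the disc which maps the
centre to `(-u, 0)`. -/
def kleinBoost (u τ X Y : ℝ) : ℝ × ℝ := ((X - u) / (1 - u * X), τ * Y / (1 - u * X))

/-- Parametrisation of the ribbon by straight chords. -/
def ribbonMap (ρ : ℝ) (n : ℕ) (u τ φ l : ℝ) : E3 :=
  cyl φ (ρ + (kleinBoost u τ (l * Real.cos (n * φ / 2)) (l * Real.sin (n * φ / 2))).1)
    (kleinBoost u τ (l * Real.cos (n * φ / 2)) (l * Real.sin (n * φ / 2))).2

theorem one_sub_mul_pos {u X : ℝ} (hu : u ^ 2 < 1) (hX : X ^ 2 ≤ 1) : 0 < 1 - u * X := by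
  nlinarith [sq_nonneg (u - X)]

/-- The sign of `1 - X² - Y²` is preserved, so disc and circle are mapped into themselves. -/
theorem kleinBoost_sq {u τ X Y : ℝ} (hu : u ^ 2 + τ ^ 2 = 1) (hD : 1 - u * X ≠ 0) :
    1 - (kleinBoost u τ X Y).1 ^ 2 - (kleinBoost u τ X Y).2 ^ 2 =
      τ ^ 2 * (1 - X ^ 2 - Y ^ 2) / (1 - u * X) ^ 2 := by
  have hD2 := pow_ne_zero 2 hD
  rw [kleinBoost, eq_div_iff hD2, sub_mul, sub_mul, div_pow, div_pow, div_mul_cancel₀ _ hD2,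
    div_mul_cancel₀ _ hD2]
  linear_combination (-1 + X ^ 2) * hu

theorem kleinBoost_inj {u τ X Y X' Y' : ℝ} (hu : u ^ 2 + τ ^ 2 = 1) (hτ : τ ≠ 0)
    (hD : 1 - u * X ≠ 0) (hD' : 1 - u * X' ≠ 0)
    (h : kleinBoost u τ X Y = kleinBoost u τ X' Y') : X = X' ∧ Y = Y' := by
  rw [kleinBoost, kleinBoost, Prod.mk.injEq, div_eq_div_iff hD hD'] at h
  have hX : X = X' := by
    have : τ ^ 2 * (X - X') = 0 := by linear_combination h.1 + (X - X') * hu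
    linarith [(mul_eq_zero.1 this).resolve_left (pow_ne_zero 2 hτ)]
  subst hX
  refine ⟨rfl, ?_⟩
  have := h.2
  rw [div_left_inj' hD] at this
  exact mul_left_cancel₀ hτ this

theorem mul_cos_sq_le {l : ℝ} (hl : l ^ 2 ≤ 1) (θ : ℝ) : (l * Real.cos θ) ^ 2 ≤ 1 := by
  rw [mul_pow]
  nlinarith [Real.cos_sq_le_one θ, sq_nonneg l, sq_nonneg (Real.cos θ)]

theorem kleinBoost_mem_disc {u τ l : ℝ} (hu : u ^ 2 + τ ^ 2 = 1) (hτ : 0 < τ) (hl : l ^ 2 ≤ 1)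
    (θ : ℝ) : (kleinBoost u τ (l * Real.cos θ) (l * Real.sin θ)).1 ^ 2 +
      (kleinBoost u τ (l * Real.cos θ) (l * Real.sin θ)).2 ^ 2 ≤ 1 := by
  have hD := one_sub_mul_pos (u := u) (by nlinarith) (mul_cos_sq_le hl θ)
  have h := kleinBoost_sq (Y := l * Real.sin θ) hu hD.ne'
  have h2 : 0 ≤ τ ^ 2 * (1 - (l * Real.cos θ) ^ 2 - (l * Real.sin θ) ^ 2) /
      (1 - u * (l * Real.cos θ)) ^ 2 := by
    have : 1 - (l * Real.cos θ) ^ 2 - (l * Real.sin θ) ^ 2 = 1 - l ^ 2 := by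
      linear_combination -l ^ 2 * Real.sin_sq_add_cos_sq θ
    rw [this]
    exact div_nonneg (mul_nonneg (sq_nonneg _) (by linarith)) (sq_nonneg _)
  linarith

/-- The image of `l (cos θ, sin θ)`, seen from `(-u, 0)`, is `τ l / (1 - u l cos θ)` times `(τ cos
θ, sin θ)`: diameters become chords with the same `θ`. -/
theorem profile_kleinBoost {u τ l : ℝ} (hu : u ^ 2 + τ ^ 2 = 1) (θ : ℝ)
    (hD : 1 - u * (l * Real.cos θ) ≠ 0) :
    profile u τ θ (kleinBoost u τ (l * Real.cos θ) (l * Real.sin θ)).1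
      (kleinBoost u τ (l * Real.cos θ) (l * Real.sin θ)).2 = 0 := by
  have key : ∀ A B D S C : ℝ, D ≠ 0 → (A + u * D) * S - τ * B * C = 0 →
      (A / D + u) * S - τ * (B / D) * C = 0 := by
    intro A B D S C hD h
    field_simp
    linarith
  refine key _ _ _ _ _ hD ?_
  linear_combination (-l * Real.cos θ * Real.sin θ) * hu

theorem exists_kleinBoost_eq {u τ θ a b : ℝ} (hu : u ^ 2 + τ ^ 2 = 1) (hτ : 0 < τ)
    (hab : a ^ 2 + b ^ 2 ≤ 1) (h : profile u τ θ a b = 0) :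
    ∃ l : ℝ, l ^ 2 ≤ 1 ∧ kleinBoost u τ (l * Real.cos θ) (l * Real.sin θ) = (a, b) := by
  have hD : 0 < 1 + u * a := by
    have := one_sub_mul_pos (u := u) (X := -a) (by nlinarith) (by nlinarith [sq_nonneg b])
    linarith
  have hsc := Real.sin_sq_add_cos_sq θ
  rw [profile] at h
  set S := Real.sin θ
  set C := Real.cos θ
  -- The inverse boost sends `(a, b)` to `((a + u) / (1 + u a), τ b / (1 + u a))`; `l` is the
  -- component of this vector along `(cos θ, sin θ)`.
  set l := ((a + u) * C + τ * b * S) / (1 + u * a) with hl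
  have hlD : l * (1 + u * a) = (a + u) * C + τ * b * S := div_mul_cancel₀ _ hD.ne'
  have hP : l * C * (1 + u * a) = a + u := by
    linear_combination C * hlD + (-S) * h + (a + u) * hsc
  have hQ : l * S * (1 + u * a) = τ * b := by
    linear_combination S * hlD + C * h + (τ * b) * hsc
  refine ⟨l, ?_, ?_⟩
  · have h1 : l ^ 2 * (1 + u * a) ^ 2 = (a + u) ^ 2 + (τ * b) ^ 2 := by
      linear_combination (l * C * (1 + u * a) + (a + u)) * hP + (l * S * (1 + u * a) + τ * b) * hQ
        - l ^ 2 * (1 + u * a) ^ 2 * hsc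
    have h2 : (1 + u * a) ^ 2 - ((a + u) ^ 2 + (τ * b) ^ 2) = τ ^ 2 * (1 - a ^ 2 - b ^ 2) := by
      linear_combination (a ^ 2 - 1) * hu
    have h3 : 0 ≤ τ ^ 2 * (1 - a ^ 2 - b ^ 2) := mul_nonneg (sq_nonneg _) (by linarith)
    have h4 : 0 < (1 + u * a) ^ 2 := by positivity
    by_contra hcon
    nlinarith
  · have hE : (1 - u * (l * C)) * (1 + u * a) = τ ^ 2 := by
      linear_combination (-u) * hP - hu
    have hE0 : 1 - u * (l * C) ≠ 0 := by
      intro h0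
      rw [h0, zero_mul] at hE
      exact (pow_pos hτ 2).ne hE
    rw [kleinBoost, Prod.mk.injEq, div_eq_iff hE0, div_eq_iff hE0]
    constructor
    · refine mul_right_cancel₀ hD.ne' ?_
      linear_combination hP - a * hE - a * hu
    · refine mul_right_cancel₀ hD.ne' ?_
      linear_combination τ * hQ - b * hE

section

variable {ρ : ℝ} {n : ℕ} {u τ : ℝ}

theorem ribbonMap_mem (hρ : 2 < ρ) (hu : u ^ 2 + τ ^ 2 = 1) (hτ : 0 < τ) (φ : ℝ) {l : ℝ}
    (hl : l ^ 2 ≤ 1) : ribbonMap ρ n u τ φ l ∈ ribbon ρ n u τ := by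
  have hd := kleinBoost_mem_disc hu hτ hl (n * φ / 2)
  have hD := one_sub_mul_pos (u := u) (by nlinarith) (mul_cos_sq_le hl (n * φ / 2))
  have hp := profile_kleinBoost (l := l) hu (n * φ / 2) hD.ne'
  rw [ribbonMap]
  set y := kleinBoost u τ (l * Real.cos (n * φ / 2)) (l * Real.sin (n * φ / 2))
  have hr : 0 < ρ + y.1 := by nlinarith [sq_nonneg y.2]
  rw [cyl_mem_ribbon hr]
  simpa using ⟨hd, hp⟩

theorem exists_ribbonMap_eq (hu : u ^ 2 + τ ^ 2 = 1) (hτ : 0 < τ) {φ r z : ℝ} (hr : 0 < r)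
    (h : cyl φ r z ∈ ribbon ρ n u τ) : ∃ l : ℝ, l ^ 2 ≤ 1 ∧ ribbonMap ρ n u τ φ l = cyl φ r z := by
  rw [cyl_mem_ribbon hr] at h
  obtain ⟨l, hl, hkl⟩ := exists_kleinBoost_eq hu hτ h.1 h.2
  exact ⟨l, hl, by rw [ribbonMap, hkl]; simp⟩

/-- Each full turn adds `nπ` to the half angle and multiplies `l` by `(-1)^n`. This sign
distinguishes the band from the annulus. -/
theorem ribbonMap_inj (hρ : 2 < ρ) (hu : u ^ 2 + τ ^ 2 = 1) (hτ : 0 < τ) {φ φ' l l' : ℝ}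
    (hl : l ^ 2 ≤ 1) (hl' : l' ^ 2 ≤ 1) (h : ribbonMap ρ n u τ φ l = ribbonMap ρ n u τ φ' l') :
    ∃ k : ℤ, φ' = φ + 2 * Real.pi * k ∧ l = (-1) ^ (n * k) * l' := by
  have hu1 : u ^ 2 < 1 := by nlinarith
  have hd := kleinBoost_mem_disc hu hτ hl (n * φ / 2)
  have hd' := kleinBoost_mem_disc hu hτ hl' (n * φ' / 2)
  have hD := one_sub_mul_pos hu1 (mul_cos_sq_le hl (n * φ / 2))
  have hD' := one_sub_mul_pos hu1 (mul_cos_sq_le hl' (n * φ' / 2))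
  rw [ribbonMap, ribbonMap] at h
  obtain ⟨h1, h2, k, rfl⟩ := cyl_inj (by nlinarith [sq_nonneg (kleinBoost u τ
      (l * Real.cos (n * φ / 2)) (l * Real.sin (n * φ / 2))).2])
    (by nlinarith [sq_nonneg (kleinBoost u τ
      (l' * Real.cos (n * φ' / 2)) (l' * Real.sin (n * φ' / 2))).2]) h
  obtain ⟨hX, hY⟩ := kleinBoost_inj hu hτ.ne' hD.ne' hD'.ne' (Prod.ext (add_left_cancel h1) h2)
  refine ⟨k, rfl, ?_⟩
  have e : (n : ℝ) * (φ + 2 * Real.pi * k) / 2 = n * φ / 2 + ((n * k : ℤ) : ℝ) * Real.pi := by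
    push_cast; ring
  rw [e, Real.cos_add_int_mul_pi] at hX
  rw [e, Real.sin_add_int_mul_pi] at hY
  linear_combination Real.cos (n * φ / 2) * hX + Real.sin (n * φ / 2) * hY +
    (-l + (-1) ^ (n * k) * l') * Real.sin_sq_add_cos_sq (n * φ / 2)

theorem continuousOn_ribbonMap (hu : u ^ 2 + τ ^ 2 = 1) (hτ : 0 < τ) :
    ContinuousOn (fun q : ℝ × ℝ => ribbonMap ρ n u τ q.1 q.2) {q | q.2 ^ 2 ≤ 1} := by
  have hD : ∀ q ∈ {q : ℝ × ℝ | q.2 ^ 2 ≤ 1}, 1 - u * (q.2 * Real.cos (n * q.1 / 2)) ≠ 0 :=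
    fun q hq => (one_sub_mul_pos (by nlinarith) (mul_cos_sq_le hq _)).ne'
  refine continuous_cyl.comp_continuousOn (f := fun q : ℝ × ℝ => (q.1,
    ρ + (kleinBoost u τ (q.2 * Real.cos (n * q.1 / 2)) (q.2 * Real.sin (n * q.1 / 2))).1,
    (kleinBoost u τ (q.2 * Real.cos (n * q.1 / 2)) (q.2 * Real.sin (n * q.1 / 2))).2)) ?_
  refine continuousOn_fst.prodMk (ContinuousOn.prodMk ?_ ?_)
  · refine continuousOn_const.add (ContinuousOn.div ?_ ?_ hD) <;> fun_prop
  · refine ContinuousOn.div ?_ ?_ hD <;> fun_prop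

theorem exists_cyl_angle_mem_Ico (hρ : 2 < ρ) {x : E3} (hx : x ∈ toroid ρ) :
    ∃ φ ∈ Ico 0 (2 * Real.pi), ∃ r z, 0 < r ∧ x = cyl φ r z := by
  obtain ⟨φ, r, z, hr, rfl⟩ := exists_cyl_of_mem_toroid hρ hx
  have hm := toIcoMod_mem_Ico Real.two_pi_pos 0 φ
  rw [zero_add] at hm
  refine ⟨_, hm, r, z, hr, ?_⟩
  have h := toIcoMod_add_toIcoDiv_zsmul Real.two_pi_pos 0 φ
  rw [zsmul_eq_mul] at h
  have e : φ = toIcoMod Real.two_pi_pos 0 φ + 2 * Real.pi * toIcoDiv Real.two_pi_pos 0 φ := by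
    linarith
  conv_lhs => rw [e]
  exact cyl_add_two_pi _ r z _

theorem sq_le_one_of_mem {l : ℝ} (hl : l ∈ Icc (-1 : ℝ) 1) : l ^ 2 ≤ 1 :=
  (sq_le_one_iff_abs_le_one l).2 (abs_le.2 hl)

theorem mem_of_sq_le_one {l : ℝ} (hl : l ^ 2 ≤ 1) : l ∈ Icc (-1 : ℝ) 1 :=
  abs_le.1 ((sq_le_one_iff_abs_le_one l).1 hl)

/-- The parametrisation `ribbonMap` over one turn descends to the quotient, and a continuous
bijection from a compact space to a Hausdorff space is a homeomorphism. -/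
theorem nonempty_homeomorph_mobiusBand (hρ : 2 < ρ) (hn : Odd n) (hu : u ^ 2 + τ ^ 2 = 1)
    (hτ : 0 < τ) : Nonempty (ribbon ρ n u τ ≃ₜ MobiusBand) := by
  let g : Icc (0 : ℝ) 1 × Icc (-1 : ℝ) 1 → ribbon ρ n u τ := fun p =>
    ⟨ribbonMap ρ n u τ (2 * Real.pi * p.1) p.2, ribbonMap_mem hρ hu hτ _ (sq_le_one_of_mem p.2.2)⟩
  have hgc : Continuous g := by
    refine Continuous.subtype_mk ?_ _
    refine (continuousOn_ribbonMap hu hτ).comp_continuous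
      (f := fun p : Icc (0 : ℝ) 1 × Icc (-1 : ℝ) 1 => (2 * Real.pi * (p.1 : ℝ), (p.2 : ℝ)))
      (by fun_prop) fun p => sq_le_one_of_mem p.2.2
  have hpar : ∀ k : ℤ, Odd k → ∀ l : ℝ, (-1 : ℝ) ^ ((n : ℤ) * k) * l = -l := fun k hk l => by
    rw [Odd.neg_one_zpow (((Int.odd_coe_nat n).2 hn).mul hk), neg_one_mul]
  have hrel : ∀ p q, mobiusRel p q → g p = g q := by
    rintro ⟨a, l⟩ ⟨a', l'⟩ ⟨h0, h1, h2⟩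
    simp only at h0 h1 h2
    refine Subtype.ext ?_
    simp only [g, h0, h1, h2]
    have e : (n : ℝ) * (2 * Real.pi * 1) / 2 = 0 + ((n * 1 : ℤ) : ℝ) * Real.pi := by
      push_cast; ring
    have e0 : (n : ℝ) * (2 * Real.pi * 0) / 2 = 0 := by ring
    have hc := cyl_add_two_pi 0
    have hn1 : (-1 : ℝ) ^ ((n : ℤ) * 1) = -1 := by simpa using hpar 1 odd_one 1
    rw [ribbonMap, ribbonMap, e, e0, Real.cos_add_int_mul_pi, Real.sin_add_int_mul_pi, hn1]
    have := hc (ρ + (kleinBoost u τ (l * Real.cos 0) (l * Real.sin 0)).1)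
      (kleinBoost u τ (l * Real.cos 0) (l * Real.sin 0)).2 1
    simpa using this.symm
  let G : MobiusBand → ribbon ρ n u τ := Quot.lift g hrel
  have hGc : Continuous G := continuous_quot_lift hrel hgc
  have hGi : Function.Injective G := by
    rintro ⟨p⟩ ⟨q⟩ hpq
    have hpq' : ribbonMap ρ n u τ (2 * Real.pi * p.1) p.2 =
      ribbonMap ρ n u τ (2 * Real.pi * q.1) q.2 := congrArg Subtype.val hpq
    obtain ⟨k, hk, hl⟩ := ribbonMap_inj hρ hu hτ (sq_le_one_of_mem p.2.2) (sq_le_one_of_mem q.2.2)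
      hpq'
    have hk' : (q.1 : ℝ) = p.1 + k := by
      have := Real.pi_pos
      have h2 : 2 * Real.pi * (q.1 : ℝ) = 2 * Real.pi * (p.1 + k) := by rw [hk]; ring
      exact mul_left_cancel₀ (by positivity) h2
    have hp := p.1.2
    have hq := q.1.2
    have hk1 : (k : ℝ) ≤ 1 := by linarith [hp.1, hq.2]
    have hk2 : (-1 : ℝ) ≤ k := by linarith [hp.2, hq.1]
    have hk1' : k ≤ 1 := by exact_mod_cast hk1
    have hk2' : -1 ≤ k := by exact_mod_cast hk2
    -- Both angles lie in one closed turn. The values `k = ±1` pair its two ends, where the sign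
    -- `-1` is the gluing.
    obtain rfl | rfl | rfl : k = -1 ∨ k = 0 ∨ k = 1 := by omega
    · refine (Quot.sound ?_).symm
      push_cast at hk'
      rw [hpar _ (by decide)] at hl
      exact ⟨by linarith [hp.2, hq.1], by linarith [hp.2, hq.1], hl⟩
    · have h1 : p.1 = q.1 := Subtype.ext (by rw [hk']; simp)
      have h2 : p.2 = q.2 := Subtype.ext (by rw [hl]; simp)
      rw [Prod.ext h1 h2]
    · refine Quot.sound ?_
      push_cast at hk'
      rw [hpar _ odd_one] at hl
      exact ⟨by linarith [hp.1, hq.2], by linarith [hp.1, hq.2], by linarith⟩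
  have hGs : Function.Surjective G := by
    rintro ⟨x, hx⟩
    obtain ⟨φ, hφ, r, z, hr, rfl⟩ := exists_cyl_angle_mem_Ico hρ hx.1
    obtain ⟨l, hl, hlx⟩ := exists_ribbonMap_eq hu hτ hr hx
    have hpi := Real.two_pi_pos
    refine ⟨Quot.mk _ (⟨φ / (2 * Real.pi), div_nonneg hφ.1 hpi.le, (div_le_one hpi).2 hφ.2.le⟩,
      ⟨l, mem_of_sq_le_one hl⟩), Subtype.ext ?_⟩
    change ribbonMap ρ n u τ (2 * Real.pi * (φ / (2 * Real.pi))) l = _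
    rw [mul_div_cancel₀ _ hpi.ne', hlx]
  exact ⟨(Continuous.homeoOfEquivCompactToT2 (f := Equiv.ofBijective G ⟨hGi, hGs⟩) hGc).symm⟩

/-- For `n = 2m` the half angle is `mφ`, so its cosine and sine are the coordinates of `z ^ m` and
the parametrisation is defined on the circle without cutting it. -/
theorem nonempty_homeomorph_annulus (hρ : 2 < ρ) (hn : Even n) (hu : u ^ 2 + τ ^ 2 = 1)
    (hτ : 0 < τ) : Nonempty (ribbon ρ n u τ ≃ₜ Annulus) := by
  obtain ⟨m, rfl⟩ := hn
  have hl2 : ∀ v : Icc (0 : ℝ) 1, (2 * (v : ℝ) - 1) ^ 2 ≤ 1 := fun v =>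
    sq_le_one_of_mem ⟨by linarith [v.2.1], by linarith [v.2.2]⟩
  let f : Circle × Icc (0 : ℝ) 1 → E3 := fun p =>
    let y := kleinBoost u τ ((2 * (p.2 : ℝ) - 1) * ((p.1 ^ m : Circle) : ℂ).re)
      ((2 * (p.2 : ℝ) - 1) * ((p.1 ^ m : Circle) : ℂ).im)
    !₂[(ρ + y.1) * (p.1 : ℂ).re, (ρ + y.1) * (p.1 : ℂ).im, y.2]
  have hf : ∀ φ v, f (Circle.exp φ, v) = ribbonMap ρ (m + m) u τ φ (2 * (v : ℝ) - 1) := by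
    intro φ v
    have e : ((m + m : ℕ) : ℝ) * φ / 2 = m * φ := by push_cast; ring
    have h1 : (Circle.exp φ ^ m) = Circle.exp (m * φ) := by
      rw [← nsmul_eq_mul, Circle.exp_nsmul]
    have hre : ∀ x : ℝ, ((Circle.exp x : Circle) : ℂ).re = Real.cos x := fun x => by
      rw [Circle.coe_exp, Complex.exp_ofReal_mul_I_re]
    have him : ∀ x : ℝ, ((Circle.exp x : Circle) : ℂ).im = Real.sin x := fun x => by
      rw [Circle.coe_exp, Complex.exp_ofReal_mul_I_im]
    simp only [f, ribbonMap, e, h1, hre, him, cyl]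
  have hexp : ∀ z : Circle, ∃ φ, z = Circle.exp φ := fun z => ⟨_, (Circle.exp_arg z).symm⟩
  have hfm : ∀ p, f p ∈ ribbon ρ (m + m) u τ := by
    rintro ⟨z, v⟩
    obtain ⟨φ, rfl⟩ := hexp z
    rw [hf]
    exact ribbonMap_mem hρ hu hτ φ (hl2 v)
  have hfc : Continuous f := by
    have hcz : Continuous fun p : Circle × Icc (0 : ℝ) 1 => (p.1 : ℂ) := by fun_prop
    have hczm : Continuous fun p : Circle × Icc (0 : ℝ) 1 => ((p.1 ^ m : Circle) : ℂ) := by fun_prop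
    have hcv : Continuous fun p : Circle × Icc (0 : ℝ) 1 => 2 * (p.2 : ℝ) - 1 := by fun_prop
    have hX := hcv.mul (Complex.continuous_re.comp hczm)
    have hY := hcv.mul (Complex.continuous_im.comp hczm)
    have hD : ∀ p : Circle × Icc (0 : ℝ) 1,
        1 - u * ((2 * (p.2 : ℝ) - 1) * ((p.1 ^ m : Circle) : ℂ).re) ≠ 0 := by
      rintro ⟨z, v⟩
      refine (one_sub_mul_pos (by nlinarith) ?_).ne'
      have h1 : ‖((z ^ m : Circle) : ℂ)‖ = 1 := Circle.norm_coe _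
      have h2 : |((z ^ m : Circle) : ℂ).re| ≤ 1 := h1 ▸ Complex.abs_re_le_norm _
      have h3 := (sq_le_one_iff_abs_le_one _).2 h2
      rw [mul_pow]
      nlinarith [hl2 v, sq_nonneg (2 * (v : ℝ) - 1), sq_nonneg ((z ^ m : Circle) : ℂ).re]
    have h1 := (hX.sub (continuous_const (y := u))).div (continuous_const.sub
      ((continuous_const (y := u)).mul hX)) hD
    have h2 := ((continuous_const (y := τ)).mul hY).div (continuous_const.sub
      ((continuous_const (y := u)).mul hX)) hD
    refine (PiLp.continuous_toLp 2 _).comp (continuous_pi fun i => ?_)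
    fin_cases i
    · exact (continuous_const.add h1).mul (Complex.continuous_re.comp hcz)
    · exact (continuous_const.add h1).mul (Complex.continuous_im.comp hcz)
    · exact h2
  let G : Annulus → ribbon ρ (m + m) u τ := fun p => ⟨f p, hfm p⟩
  have hGc : Continuous G := hfc.subtype_mk _
  have hGi : Function.Injective G := by
    rintro ⟨z, v⟩ ⟨z', v'⟩ h
    have h' : f (z, v) = f (z', v') := congrArg Subtype.val h
    obtain ⟨φ, rfl⟩ := hexp z
    obtain ⟨φ', rfl⟩ := hexp z'
    rw [hf, hf] at h'
    obtain ⟨k, rfl, hl⟩ := ribbonMap_inj hρ hu hτ (hl2 v) (hl2 v') h'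
    have hev : Even (((m + m : ℕ) : ℤ) * k) := Even.mul_right (by simp) k
    rw [hev.neg_one_zpow, one_mul] at hl
    have hv : v = v' := Subtype.ext (by linarith)
    have hz : Circle.exp (φ + 2 * Real.pi * k) = Circle.exp φ :=
      Circle.exp_eq_exp.2 ⟨k, by ring⟩
    rw [hz, hv]
  have hGs : Function.Surjective G := by
    rintro ⟨x, hx⟩
    obtain ⟨φ, r, z, hr, rfl⟩ := exists_cyl_of_mem_toroid hρ hx.1
    obtain ⟨l, hl, hlx⟩ := exists_ribbonMap_eq hu hτ hr hx
    have hlm := mem_of_sq_le_one hl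
    refine ⟨(Circle.exp φ, ⟨(l + 1) / 2, by linarith [hlm.1], by linarith [hlm.2]⟩),
      Subtype.ext ?_⟩
    refine (hf _ _).trans ?_
    have e : 2 * ((l + 1) / 2) - 1 = l := by ring
    change ribbonMap ρ (m + m) u τ φ (2 * ((l + 1) / 2) - 1) = cyl φ r z
    rw [e, hlx]
  exact ⟨(Continuous.homeoOfEquivCompactToT2 (f := Equiv.ofBijective G ⟨hGi, hGs⟩) hGc).symm⟩

end

/-! ### A parametrisation of the sectors of the ribbons by the disc

In polar coordinates `(s, ψ)` around the point `(-u, 0)` of the disc, the chord with direction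
`(cos ψ, sin ψ)` is parametrised by `s = u cos ψ + h σ`, `σ ∈ [-1, 1]`. It is the section of the
ribbon at the toroidal angle `2 (Θ + π j) / n`, where `(cos Θ, sin Θ)` is proportional to
`(cos ψ, τ sin ψ)`. -/

/-- Half the length of the chord. -/
def halfChord (τ ψ : ℝ) : ℝ := √(Real.cos ψ ^ 2 + τ ^ 2 * Real.sin ψ ^ 2)

/-- The signed distance from the point `(-u, 0)`. -/
def chordCoord (u τ ψ σ : ℝ) : ℝ := u * Real.cos ψ + halfChord τ ψ * σ

/-- The angle `Θ`. -/
def liftAngle (τ ψ : ℝ) : ℝ := Real.arccos (Real.cos ψ / halfChord τ ψ)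

/-- The toroidal angle on the `j`-th sheet. -/
def sheetAngle (n : ℕ) (τ : ℝ) (j : ℕ) (ψ : ℝ) : ℝ := 2 * (liftAngle τ ψ + Real.pi * j) / n

/-- The parametrisation of the `j`-th sheet. -/
def sheetPoint (ρ : ℝ) (n : ℕ) (u τ : ℝ) (j : ℕ) (ψ σ : ℝ) : E3 :=
  cyl (sheetAngle n τ j ψ) (ρ - u + chordCoord u τ ψ σ * Real.cos ψ)
    (chordCoord u τ ψ σ * Real.sin ψ)

/-- The speed in the toroidal direction. -/
def angularSpeed (ρ : ℝ) (n : ℕ) (u τ ψ σ : ℝ) : ℝ :=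
  (ρ - u + chordCoord u τ ψ σ * Real.cos ψ) * (2 / n * (τ / halfChord τ ψ ^ 2))

/-- A normal vector of the `j`-th sheet. -/
def sheetNormal (ρ : ℝ) (n : ℕ) (u τ : ℝ) (j : ℕ) (ψ σ : ℝ) : E3 :=
  cyl (sheetAngle n τ j ψ + Real.pi / 2) (chordCoord u τ ψ σ) 0 +
    cyl (sheetAngle n τ j ψ) (angularSpeed ρ n u τ ψ σ * Real.sin ψ)
      (-(angularSpeed ρ n u τ ψ σ * Real.cos ψ))

/-- The Jacobian of the parametrisation. -/
def sheetDensity (ρ : ℝ) (n : ℕ) (u τ ψ σ : ℝ) : ℝ :=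
  halfChord τ ψ * √(chordCoord u τ ψ σ ^ 2 + angularSpeed ρ n u τ ψ σ ^ 2)

section

variable {ρ : ℝ} {n : ℕ} {u τ ψ σ : ℝ}

theorem halfChord_sq (τ ψ : ℝ) :
    halfChord τ ψ ^ 2 = Real.cos ψ ^ 2 + τ ^ 2 * Real.sin ψ ^ 2 :=
  Real.sq_sqrt (by positivity)

theorem halfChord_nonneg (τ ψ : ℝ) : 0 ≤ halfChord τ ψ := Real.sqrt_nonneg _

theorem halfChord_pos (hψ : Real.cos ψ ≠ 0) : 0 < halfChord τ ψ :=
  Real.sqrt_pos.2 (by positivity)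

theorem halfChord_pos_of_pos (hτ : 0 < τ) (ψ : ℝ) : 0 < halfChord τ ψ := by
  refine Real.sqrt_pos.2 ?_
  by_cases h : Real.cos ψ = 0
  · have := Real.sin_sq_add_cos_sq ψ
    rw [h] at this ⊢
    have : Real.sin ψ ^ 2 = 1 := by linarith
    rw [this]; positivity
  · positivity

theorem halfChord_sq_eq (hu : u ^ 2 + τ ^ 2 = 1) (ψ : ℝ) :
    halfChord τ ψ ^ 2 = 1 - u ^ 2 * Real.sin ψ ^ 2 := by
  rw [halfChord_sq]
  linear_combination Real.sin_sq_add_cos_sq ψ + Real.sin ψ ^ 2 * hu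

theorem halfChord_sq_eq' (hu : u ^ 2 + τ ^ 2 = 1) (ψ : ℝ) :
    halfChord τ ψ ^ 2 = τ ^ 2 + u ^ 2 * Real.cos ψ ^ 2 := by
  rw [halfChord_sq]
  linear_combination τ ^ 2 * Real.sin_sq_add_cos_sq ψ - Real.cos ψ ^ 2 * hu

theorem halfChord_le_one (hu : u ^ 2 + τ ^ 2 = 1) (ψ : ℝ) : halfChord τ ψ ≤ 1 := by
  refine abs_le_of_sq_le_sq' ?_ zero_le_one |>.2
  rw [halfChord_sq_eq hu]
  nlinarith [mul_nonneg (sq_nonneg u) (sq_nonneg (Real.sin ψ))]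

theorem le_halfChord (hu : u ^ 2 + τ ^ 2 = 1) (ψ : ℝ) : τ ≤ halfChord τ ψ := by
  refine abs_le_of_sq_le_sq' ?_ (halfChord_nonneg _ _) |>.2
  rw [halfChord_sq_eq' hu]
  nlinarith [mul_nonneg (sq_nonneg u) (sq_nonneg (Real.cos ψ))]

/-- Along the chord, `u cos ψ` is the position of the midpoint and `h` is half the length, so `σ =
±1` are its ends on the circle. -/
theorem one_sub_chord_sq (hu : u ^ 2 + τ ^ 2 = 1) (ψ σ : ℝ) :
    1 - (-u + chordCoord u τ ψ σ * Real.cos ψ) ^ 2 - (chordCoord u τ ψ σ * Real.sin ψ) ^ 2 =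
      halfChord τ ψ ^ 2 * (1 - σ ^ 2) := by
  have h := halfChord_sq_eq hu ψ
  rw [chordCoord]
  linear_combination (-(u * Real.cos ψ + halfChord τ ψ * σ) ^ 2 + u ^ 2) *
    Real.sin_sq_add_cos_sq ψ - h

theorem abs_cos_div_halfChord_le (h : 0 < halfChord τ ψ) :
    |Real.cos ψ / halfChord τ ψ| ≤ 1 := by
  rw [abs_div, abs_of_pos h, div_le_one h, ← abs_of_pos h]
  refine abs_le_of_sq_le_sq ?_ (abs_nonneg _) |> fun h => h
  rw [sq_abs, halfChord_sq]
  nlinarith [mul_nonneg (sq_nonneg τ) (sq_nonneg (Real.sin ψ))]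

theorem cos_liftAngle (h : 0 < halfChord τ ψ) :
    Real.cos (liftAngle τ ψ) = Real.cos ψ / halfChord τ ψ := by
  have := abs_le.1 (abs_cos_div_halfChord_le h)
  exact Real.cos_arccos this.1 this.2

theorem sin_liftAngle (hτ : 0 ≤ τ) (hψ : ψ ∈ Icc 0 Real.pi) (h : 0 < halfChord τ ψ) :
    Real.sin (liftAngle τ ψ) = τ * Real.sin ψ / halfChord τ ψ := by
  have hs := Real.sin_nonneg_of_mem_Icc hψ
  rw [liftAngle, Real.sin_arccos, ← Real.sqrt_sq (show 0 ≤ τ * Real.sin ψ / halfChord τ ψ by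
    have := h.le; positivity)]
  congr 1
  rw [div_pow, div_pow, eq_div_iff (pow_pos h 2).ne', sub_mul, div_mul_cancel₀ _ (pow_pos h 2).ne',
    halfChord_sq]
  ring

/-! ### Derivatives of the half chord and of the lifted angle -/

theorem halfChord_hasDerivAt (hu : u ^ 2 + τ ^ 2 = 1) (h : 0 < halfChord τ ψ) :
    HasDerivAt (halfChord τ) (-(u ^ 2 * Real.sin ψ * Real.cos ψ) / halfChord τ ψ) ψ := by
  have h1 : HasDerivAt (fun ψ => Real.cos ψ ^ 2 + τ ^ 2 * Real.sin ψ ^ 2)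
      (2 * Real.cos ψ * -Real.sin ψ + τ ^ 2 * (2 * Real.sin ψ * Real.cos ψ)) ψ := by
    refine (((Real.hasDerivAt_cos ψ).pow 2).add
      (((Real.hasDerivAt_sin ψ).pow 2).const_mul (τ ^ 2))).congr_deriv ?_
    simp
  refine (h1.sqrt (Real.sqrt_pos.1 h).ne').congr_deriv ?_
  change _ / (2 * halfChord τ ψ) = _
  rw [div_eq_div_iff (by positivity) h.ne']
  linear_combination (2 * Real.cos ψ * Real.sin ψ * halfChord τ ψ) * hu

theorem cos_div_halfChord_hasDerivAt (hu : u ^ 2 + τ ^ 2 = 1) (h : 0 < halfChord τ ψ) :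
    HasDerivAt (fun ψ => Real.cos ψ / halfChord τ ψ)
      (-(τ ^ 2 * Real.sin ψ) / halfChord τ ψ ^ 3) ψ := by
  refine ((Real.hasDerivAt_cos ψ).div (halfChord_hasDerivAt hu h) h.ne').congr_deriv ?_
  have h2 := halfChord_sq_eq' hu ψ
  have e : -Real.sin ψ * halfChord τ ψ - Real.cos ψ *
      (-(u ^ 2 * Real.sin ψ * Real.cos ψ) / halfChord τ ψ) =
      -(τ ^ 2 * Real.sin ψ) / halfChord τ ψ := by
    rw [eq_div_iff h.ne', sub_mul, ← mul_div_assoc, div_mul_cancel₀ _ h.ne']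
    linear_combination (-Real.sin ψ) * h2
  rw [e, div_div]
  congr 1
  ring

theorem cos_ne_zero_eventually (hc : Real.cos ψ ≠ 0) :
    ∀ᶠ x in 𝓝 ψ, 0 < Real.cos x * Real.cos ψ := by
  have : ContinuousAt (fun x => Real.cos x * Real.cos ψ) ψ := by fun_prop
  exact this.eventually (lt_mem_nhds (mul_self_pos.2 hc))

/-- For `τ = 0` the lifted angle is `0` or `π` according to the sign of `cos ψ`. Its only jump is at
`ψ = π/2`, which the sheets leave out. -/
theorem liftAngle_zero_eventuallyEq (hc : Real.cos ψ ≠ 0) :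
    liftAngle 0 =ᶠ[𝓝 ψ] fun _ => liftAngle 0 ψ := by
  filter_upwards [cos_ne_zero_eventually hc] with x hx
  have e : ∀ y, halfChord 0 y = |Real.cos y| := fun y => by
    simp [halfChord, Real.sqrt_sq_eq_abs]
  have : Real.cos x / |Real.cos x| = Real.cos ψ / |Real.cos ψ| := by
    rcases lt_or_gt_of_ne hc with h | h
    · have hx' : Real.cos x < 0 := by nlinarith
      rw [abs_of_neg h, abs_of_neg hx', div_neg, div_neg, div_self h.ne, div_self hx'.ne]
    · have hx' : 0 < Real.cos x := by nlinarith
      rw [abs_of_pos h, abs_of_pos hx', div_self h.ne', div_self hx'.ne']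
  rw [liftAngle, liftAngle, e, e, this]

theorem sq_cos_div_halfChord_lt (hτ : 0 < τ) (hψ : ψ ∈ Ioo 0 Real.pi) :
    |Real.cos ψ / halfChord τ ψ| < 1 := by
  have h := halfChord_pos_of_pos hτ ψ
  have hs := Real.sin_pos_of_mem_Ioo hψ
  rw [← sq_lt_one_iff_abs_lt_one, div_pow, div_lt_one (pow_pos h 2), halfChord_sq]
  have : 0 < τ ^ 2 * Real.sin ψ ^ 2 := by positivity
  linarith

theorem liftAngle_hasDerivAt_of_pos (hu : u ^ 2 + τ ^ 2 = 1) (hτ : 0 < τ)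
    (hψ : ψ ∈ Ioo 0 Real.pi) : HasDerivAt (liftAngle τ) (τ / halfChord τ ψ ^ 2) ψ := by
  have h := halfChord_pos_of_pos hτ ψ
  have hs := Real.sin_pos_of_mem_Ioo hψ
  have hlt := abs_lt.1 (sq_cos_div_halfChord_lt hτ hψ)
  have hd := (Real.hasDerivAt_arccos hlt.1.ne' hlt.2.ne).comp ψ
    (cos_div_halfChord_hasDerivAt hu h)
  refine hd.congr_deriv ?_
  rw [← Real.sin_arccos]
  change -(1 / Real.sin (liftAngle τ ψ)) * _ = _
  rw [sin_liftAngle hτ.le (Ioo_subset_Icc_self hψ) h]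
  field_simp

theorem liftAngle_hasDerivAt (hu : u ^ 2 + τ ^ 2 = 1) (hτ : 0 ≤ τ) (hψ : ψ ∈ Ioo 0 Real.pi)
    (hc : Real.cos ψ ≠ 0) : HasDerivAt (liftAngle τ) (τ / halfChord τ ψ ^ 2) ψ := by
  rcases hτ.eq_or_lt with rfl | hτ
  · rw [zero_div]
    exact (hasDerivAt_const ψ _).congr_of_eventuallyEq (liftAngle_zero_eventuallyEq hc)
  · exact liftAngle_hasDerivAt_of_pos hu hτ hψ

theorem contDiffAt_halfChord (h : 0 < halfChord τ ψ) : ContDiffAt ℝ ∞ (halfChord τ) ψ := by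
  refine ContDiffAt.sqrt ?_ (Real.sqrt_pos.1 h).ne'
  exact (Real.contDiff_cos.contDiffAt.pow 2).add
    (contDiffAt_const.mul (Real.contDiff_sin.contDiffAt.pow 2))

theorem contDiffAt_liftAngle (hτ : 0 ≤ τ) (hψ : ψ ∈ Ioo 0 Real.pi)
    (hc : Real.cos ψ ≠ 0) : ContDiffAt ℝ ∞ (liftAngle τ) ψ := by
  rcases hτ.eq_or_lt with rfl | hτ
  · exact contDiffAt_const.congr_of_eventuallyEq (liftAngle_zero_eventuallyEq hc)
  · have h := halfChord_pos_of_pos hτ ψ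
    have hlt := abs_lt.1 (sq_cos_div_halfChord_lt hτ hψ)
    exact (Real.contDiffAt_arccos hlt.1.ne' hlt.2.ne).comp ψ
      (Real.contDiff_cos.contDiffAt.div (contDiffAt_halfChord h) h.ne')

theorem sheetRadius_pos (hρ : 2 < ρ) (hu : u ^ 2 + τ ^ 2 = 1) (ψ : ℝ) (hσ : σ ∈ Icc (-1) 1) :
    0 < ρ - u + chordCoord u τ ψ σ * Real.cos ψ := by
  have h := one_sub_chord_sq hu ψ σ
  have h1 : 0 ≤ halfChord τ ψ ^ 2 * (1 - σ ^ 2) :=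
    mul_nonneg (sq_nonneg _) (by linarith [sq_le_one_of_mem hσ])
  have h2 : (-u + chordCoord u τ ψ σ * Real.cos ψ) ^ 2 ≤ 1 := by
    nlinarith [sq_nonneg (chordCoord u τ ψ σ * Real.sin ψ)]
  have := (abs_le.1 ((sq_le_one_iff_abs_le_one _).1 h2)).1
  linarith

theorem sheetRadius_le (hu : u ^ 2 + τ ^ 2 = 1) (ψ : ℝ) (hσ : σ ∈ Icc (-1) 1) :
    ρ - u + chordCoord u τ ψ σ * Real.cos ψ ≤ ρ + 1 := by
  have h := one_sub_chord_sq hu ψ σ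
  have h1 : 0 ≤ halfChord τ ψ ^ 2 * (1 - σ ^ 2) :=
    mul_nonneg (sq_nonneg _) (by linarith [sq_le_one_of_mem hσ])
  have h2 : (-u + chordCoord u τ ψ σ * Real.cos ψ) ^ 2 ≤ 1 := by
    nlinarith [sq_nonneg (chordCoord u τ ψ σ * Real.sin ψ)]
  have := (abs_le.1 ((sq_le_one_iff_abs_le_one _).1 h2)).2
  linarith

theorem mul_sheetAngle (hn : n ≠ 0) (τ : ℝ) (j : ℕ) (ψ : ℝ) :
    (n : ℝ) * sheetAngle n τ j ψ / 2 = liftAngle τ ψ + (j : ℤ) * Real.pi := by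
  have hn' : (n : ℝ) ≠ 0 := by exact_mod_cast hn
  rw [sheetAngle]
  push_cast
  field_simp

theorem profile_liftAngle (hτ : 0 ≤ τ) (hψ : ψ ∈ Icc 0 Real.pi) (h : 0 < halfChord τ ψ) (s : ℝ) :
    profile u τ (liftAngle τ ψ) (-u + s * Real.cos ψ) (s * Real.sin ψ) = 0 := by
  rw [profile, cos_liftAngle h, sin_liftAngle hτ hψ h]
  ring

theorem sheetPoint_mem (hρ : 2 < ρ) (hn : n ≠ 0) (hu : u ^ 2 + τ ^ 2 = 1) (hτ : 0 ≤ τ)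
    (hψ : ψ ∈ Icc 0 Real.pi) (h : 0 < halfChord τ ψ) (hσ : σ ∈ Icc (-1) 1) (j : ℕ) :
    sheetPoint ρ n u τ j ψ σ ∈ ribbon ρ n u τ := by
  rw [sheetPoint, cyl_mem_ribbon (sheetRadius_pos hρ hu ψ hσ), mul_sheetAngle hn,
    profile_add_int_mul_pi]
  have e : ρ - u + chordCoord u τ ψ σ * Real.cos ψ - ρ = -u + chordCoord u τ ψ σ * Real.cos ψ := by
    ring
  rw [e, profile_liftAngle hτ hψ h, mul_zero]
  refine ⟨?_, rfl⟩
  have h := one_sub_chord_sq hu ψ σ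
  have h1 : 0 ≤ halfChord τ ψ ^ 2 * (1 - σ ^ 2) :=
    mul_nonneg (sq_nonneg _) (by linarith [sq_le_one_of_mem hσ])
  linarith

/-- The derivative of the parametrisation in the direction of the chord. -/
def chordTangent (n : ℕ) (τ : ℝ) (j : ℕ) (ψ : ℝ) : E3 :=
  cyl (sheetAngle n τ j ψ) (halfChord τ ψ * Real.cos ψ) (halfChord τ ψ * Real.sin ψ)

/-- The derivative of the signed distance with respect to `ψ`. -/
def chordCoordDeriv (u τ ψ σ : ℝ) : ℝ :=
  -(u * Real.sin ψ) + -(u ^ 2 * Real.sin ψ * Real.cos ψ) / halfChord τ ψ * σ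

/-- The derivative of the parametrisation with respect to `ψ`. -/
def turnTangent (ρ : ℝ) (n : ℕ) (u τ : ℝ) (j : ℕ) (ψ σ : ℝ) : E3 :=
  cyl (sheetAngle n τ j ψ)
    (chordCoordDeriv u τ ψ σ * Real.cos ψ - chordCoord u τ ψ σ * Real.sin ψ)
    (chordCoordDeriv u τ ψ σ * Real.sin ψ + chordCoord u τ ψ σ * Real.cos ψ) +
  cyl (sheetAngle n τ j ψ + Real.pi / 2) (angularSpeed ρ n u τ ψ σ) 0

theorem sheetPoint_hasDerivAt_chord (ρ : ℝ) (n : ℕ) (u τ : ℝ) (j : ℕ) (ψ σ : ℝ) :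
    HasDerivAt (fun σ => sheetPoint ρ n u τ j ψ σ) (chordTangent n τ j ψ) σ := by
  have hs : HasDerivAt (fun σ => chordCoord u τ ψ σ) (halfChord τ ψ) σ := by
    unfold chordCoord
    simpa using ((hasDerivAt_id σ).const_mul (halfChord τ ψ)).const_add (u * Real.cos ψ)
  have := hasDerivAt_cyl (hasDerivAt_const σ (sheetAngle n τ j ψ))
    ((hs.mul_const (Real.cos ψ)).const_add (ρ - u)) (hs.mul_const (Real.sin ψ))
  refine this.congr_deriv ?_
  simp [cyl_zero_zero, chordTangent]

theorem chordCoord_hasDerivAt (hu : u ^ 2 + τ ^ 2 = 1) (hc : Real.cos ψ ≠ 0) (σ : ℝ) :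
    HasDerivAt (fun ψ => chordCoord u τ ψ σ) (chordCoordDeriv u τ ψ σ) ψ := by
  refine (((Real.hasDerivAt_cos ψ).const_mul u).add
    ((halfChord_hasDerivAt hu (halfChord_pos hc)).mul_const σ)).congr_deriv ?_
  rw [chordCoordDeriv]
  ring

theorem sheetAngle_hasDerivAt (n : ℕ) (hu : u ^ 2 + τ ^ 2 = 1) (hτ : 0 ≤ τ)
    (hψ : ψ ∈ Ioo 0 Real.pi) (hc : Real.cos ψ ≠ 0) (j : ℕ) :
    HasDerivAt (sheetAngle n τ j) (2 / n * (τ / halfChord τ ψ ^ 2)) ψ := by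
  refine ((((liftAngle_hasDerivAt hu hτ hψ hc).add_const (Real.pi * j)).const_mul 2).div_const
    (n : ℝ)).congr_deriv ?_
  ring

theorem sheetPoint_hasDerivAt_turn (ρ : ℝ) (n : ℕ) (hu : u ^ 2 + τ ^ 2 = 1) (hτ : 0 ≤ τ)
    (hψ : ψ ∈ Ioo 0 Real.pi) (hc : Real.cos ψ ≠ 0) (j : ℕ) (σ : ℝ) :
    HasDerivAt (fun ψ => sheetPoint ρ n u τ j ψ σ) (turnTangent ρ n u τ j ψ σ) ψ := by
  have hs := chordCoord_hasDerivAt (τ := τ) hu hc σ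
  refine (hasDerivAt_cyl (sheetAngle_hasDerivAt n hu hτ hψ hc j)
    ((hs.mul (Real.hasDerivAt_cos ψ)).const_add (ρ - u))
    (hs.mul (Real.hasDerivAt_sin ψ))).congr_deriv ?_
  rw [turnTangent, angularSpeed]
  congr 2
  ring

theorem inner_chordTangent_self (n : ℕ) (τ : ℝ) (j : ℕ) (ψ : ℝ) :
    inner ℝ (chordTangent n τ j ψ) (chordTangent n τ j ψ) = halfChord τ ψ ^ 2 := by
  rw [chordTangent, inner_cyl, sub_self, Real.cos_zero]
  linear_combination halfChord τ ψ ^ 2 * Real.sin_sq_add_cos_sq ψ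

theorem cos_sub_add_pi_div_two (φ : ℝ) : Real.cos (φ - (φ + Real.pi / 2)) = 0 := by
  simp

theorem cos_add_pi_div_two_sub (φ : ℝ) : Real.cos (φ + Real.pi / 2 - φ) = 0 := by
  simp

theorem inner_turnTangent_chordTangent (ρ : ℝ) (n : ℕ) (u τ : ℝ) (j : ℕ) (ψ σ : ℝ) :
    inner ℝ (turnTangent ρ n u τ j ψ σ) (chordTangent n τ j ψ) =
      halfChord τ ψ * chordCoordDeriv u τ ψ σ := by
  rw [turnTangent, chordTangent, inner_add_left, inner_cyl, inner_cyl, sub_self, Real.cos_zero,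
    cos_add_pi_div_two_sub]
  linear_combination (halfChord τ ψ * chordCoordDeriv u τ ψ σ) * Real.sin_sq_add_cos_sq ψ

theorem inner_turnTangent_self (ρ : ℝ) (n : ℕ) (u τ : ℝ) (j : ℕ) (ψ σ : ℝ) :
    inner ℝ (turnTangent ρ n u τ j ψ σ) (turnTangent ρ n u τ j ψ σ) =
      chordCoordDeriv u τ ψ σ ^ 2 + chordCoord u τ ψ σ ^ 2 + angularSpeed ρ n u τ ψ σ ^ 2 := by
  rw [turnTangent, inner_add_left, inner_add_right, inner_add_right, inner_cyl, inner_cyl,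
    inner_cyl, inner_cyl, sub_self, sub_self, Real.cos_zero, cos_add_pi_div_two_sub,
    cos_sub_add_pi_div_two]
  linear_combination (chordCoordDeriv u τ ψ σ ^ 2 + chordCoord u τ ψ σ ^ 2) *
    Real.sin_sq_add_cos_sq ψ

theorem inner_sheetNormal_chordTangent (ρ : ℝ) (n : ℕ) (u τ : ℝ) (j : ℕ) (ψ σ : ℝ) :
    inner ℝ (sheetNormal ρ n u τ j ψ σ) (chordTangent n τ j ψ) = 0 := by
  rw [sheetNormal, chordTangent, inner_add_left, inner_cyl, inner_cyl, sub_self, Real.cos_zero,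
    cos_add_pi_div_two_sub]
  ring

theorem inner_sheetNormal_turnTangent (ρ : ℝ) (n : ℕ) (u τ : ℝ) (j : ℕ) (ψ σ : ℝ) :
    inner ℝ (sheetNormal ρ n u τ j ψ σ) (turnTangent ρ n u τ j ψ σ) = 0 := by
  rw [sheetNormal, turnTangent, inner_add_left, inner_add_right, inner_add_right, inner_cyl,
    inner_cyl, inner_cyl, inner_cyl, sub_self, sub_self, Real.cos_zero, cos_add_pi_div_two_sub,
    cos_sub_add_pi_div_two]
  linear_combination (-(angularSpeed ρ n u τ ψ σ * chordCoord u τ ψ σ)) *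
    Real.sin_sq_add_cos_sq ψ

theorem inner_sheetNormal_self (ρ : ℝ) (n : ℕ) (u τ : ℝ) (j : ℕ) (ψ σ : ℝ) :
    inner ℝ (sheetNormal ρ n u τ j ψ σ) (sheetNormal ρ n u τ j ψ σ) =
      chordCoord u τ ψ σ ^ 2 + angularSpeed ρ n u τ ψ σ ^ 2 := by
  rw [sheetNormal, inner_add_left, inner_add_right, inner_add_right, inner_cyl, inner_cyl,
    inner_cyl, inner_cyl, sub_self, sub_self, Real.cos_zero, cos_add_pi_div_two_sub,
    cos_sub_add_pi_div_two]
  linear_combination angularSpeed ρ n u τ ψ σ ^ 2 * Real.sin_sq_add_cos_sq ψ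

/-- Here `(-u, 0)` lies on the circle and `|u cos ψ| = h`, so it is an end of every chord and is
reached only for `|σ| = 1`. -/
theorem chordCoord_ne_zero (hu : u ^ 2 = 1) (hc : Real.cos ψ ≠ 0) (hσ : σ ∈ Ioo (-1) 1) :
    chordCoord u 0 ψ σ ≠ 0 := by
  intro h
  have e : halfChord 0 ψ ^ 2 = Real.cos ψ ^ 2 := by rw [halfChord_sq]; ring
  rw [chordCoord] at h
  have h1 : Real.cos ψ ^ 2 * (1 - σ ^ 2) = 0 := by
    have h2 : u * Real.cos ψ = -(halfChord 0 ψ * σ) := by linarith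
    have h3 : (u * Real.cos ψ) ^ 2 = (halfChord 0 ψ * σ) ^ 2 := by rw [h2]; ring
    rw [mul_pow, mul_pow, hu, e] at h3
    linarith
  have h4 : 0 < 1 - σ ^ 2 := by nlinarith [hσ.1, hσ.2]
  have : 0 < Real.cos ψ ^ 2 * (1 - σ ^ 2) := by positivity
  exact this.ne' h1

/-- For `τ ≠ 0` the sheet turns, so the angular speed is not zero; for `τ = 0` it is flat, and the
other summand is the polar radius around `(-u, 0)`. -/
theorem sheet_regular (hρ : 2 < ρ) (hn : n ≠ 0) (hu : u ^ 2 + τ ^ 2 = 1)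
    (hc : Real.cos ψ ≠ 0) (hσ : σ ∈ Ioo (-1) 1) :
    0 < chordCoord u τ ψ σ ^ 2 + angularSpeed ρ n u τ ψ σ ^ 2 := by
  rcases eq_or_ne τ 0 with rfl | hτ
  · have := chordCoord_ne_zero (ψ := ψ) (by simpa using hu) hc hσ
    positivity
  · have h : angularSpeed ρ n u τ ψ σ ≠ 0 := by
      have h1 := sheetRadius_pos hρ hu ψ (Ioo_subset_Icc_self hσ)
      have h2 : 0 < halfChord τ ψ := halfChord_pos hc
      have hn' : (n : ℝ) ≠ 0 := by exact_mod_cast hn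
      rw [angularSpeed]
      positivity
    positivity

/-- The derivative of `s` in `ψ` cancels: sliding points along their chords does not affect the area
element. -/
theorem gram_tangents (ρ : ℝ) (n : ℕ) (u τ : ℝ) (j : ℕ) (ψ σ : ℝ) :
    inner ℝ (turnTangent ρ n u τ j ψ σ) (turnTangent ρ n u τ j ψ σ) *
      inner ℝ (chordTangent n τ j ψ) (chordTangent n τ j ψ) -
      inner ℝ (turnTangent ρ n u τ j ψ σ) (chordTangent n τ j ψ) ^ 2 =
      halfChord τ ψ ^ 2 * (chordCoord u τ ψ σ ^ 2 + angularSpeed ρ n u τ ψ σ ^ 2) := by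
  rw [inner_turnTangent_self, inner_turnTangent_chordTangent, inner_chordTangent_self]
  ring

theorem linearIndependent_of_gram_ne_zero {v w : E3}
    (h : inner ℝ v v * inner ℝ w w - inner ℝ v w ^ 2 ≠ 0) : LinearIndependent ℝ ![v, w] := by
  rw [LinearIndependent.pair_iff]
  intro a b hab
  have h1 := congrArg (fun x => inner ℝ v x) hab
  have h2 := congrArg (fun x => inner ℝ w x) hab
  simp only [inner_add_right, inner_smul_right, inner_zero_right] at h1 h2
  rw [real_inner_comm] at h2
  constructor
  · refine (mul_eq_zero.1 (?_ : a * _ = 0)).resolve_right h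
    linear_combination inner ℝ w w * h1 - inner ℝ v w * h2
  · refine (mul_eq_zero.1 (?_ : b * _ = 0)).resolve_right h
    linear_combination inner ℝ v v * h2 - inner ℝ v w * h1

theorem tangentSpace_ribbon_sheetPoint (hρ : 2 < ρ) (hn : n ≠ 0) (hu : u ^ 2 + τ ^ 2 = 1)
    (hτ : 0 ≤ τ) (hψ : ψ ∈ Ioo 0 Real.pi) (hc : Real.cos ψ ≠ 0) (hσ : σ ∈ Ioo (-1) 1) (j : ℕ) :
    tangentSpace (ribbon ρ n u τ) (sheetPoint ρ n u τ j ψ σ) =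
      (ℝ ∙ sheetNormal ρ n u τ j ψ σ)ᗮ := by
  have hreg := sheet_regular (n := n) hρ hn hu hc hσ
  have hh : 0 < halfChord τ ψ := halfChord_pos hc
  have hr := sheetRadius_pos hρ hu ψ (Ioo_subset_Icc_self hσ)
  have hph : sheetPoint ρ n u τ j ψ σ ∈ halfSpace (sheetAngle n τ j ψ) :=
    cyl_mem_halfSpace_self hr
  have hn' : (n : ℝ) ≠ 0 := by exact_mod_cast hn
  refine tangentSpace_eq_orthogonal (F := localProfile ρ n (sheetAngle n τ j ψ) u τ)
    (v₁ := turnTangent ρ n u τ j ψ σ) (v₂ := chordTangent n τ j ψ)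
    (differentiableAt_localProfile hph) ?_ ?_ ?_ ?_ ?_ ?_
    (inner_sheetNormal_turnTangent ρ n u τ j ψ σ) (inner_sheetNormal_chordTangent ρ n u τ j ψ σ)
  · rcases hτ.eq_or_lt with rfl | hτ
    -- On a flat disc the radial and axial derivatives vanish, so the angular one is used; up to
    -- sign it is `n/2 · s cos² ψ / h`.
    · intro h0
      have h1 := fderiv_localProfile_angular ρ n (sheetAngle n 0 j ψ) u 0 hr
        (chordCoord u 0 ψ σ * Real.sin ψ)
      have h2 : fderiv ℝ (localProfile ρ n (sheetAngle n 0 j ψ) u 0)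
        (cyl (sheetAngle n 0 j ψ) (ρ - u + chordCoord u 0 ψ σ * Real.cos ψ)
          (chordCoord u 0 ψ σ * Real.sin ψ)) = 0 := h0
      have h3 := chordCoord_ne_zero (ψ := ψ) (by simpa using hu) hc hσ
      rw [h2, mul_sheetAngle hn, Real.cos_add_int_mul_pi, cos_liftAngle hh] at h1
      have h4 : (n : ℝ) / 2 * ((chordCoord u 0 ψ σ * Real.cos ψ) *
          ((-1) ^ (j : ℤ) * (Real.cos ψ / halfChord 0 ψ))) ≠ 0 := by
        have h5 : ((-1 : ℝ)) ^ (j : ℤ) ≠ 0 := zpow_ne_zero _ (by norm_num)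
        positivity
      apply h4
      rw [zero_apply] at h1
      refine Eq.trans ?_ h1.symm
      ring
    · exact fderiv_localProfile_ne_zero ρ n _ u hτ.ne' hr _
  · filter_upwards [(isOpen_halfSpace _).mem_nhds hph] with x hx hxS
    exact ((mem_ribbon_iff_localProfile hx).1 hxS).2
  · refine mem_tangentConeAt_of_hasDerivAt (γ := fun ψ => sheetPoint ρ n u τ j ψ σ)
      (sheetPoint_hasDerivAt_turn ρ n hu hτ hψ hc j σ) ?_
    filter_upwards [isOpen_Ioo.mem_nhds hψ, cos_ne_zero_eventually hc] with x hx hxc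
    exact sheetPoint_mem hρ hn hu hτ (Ioo_subset_Icc_self hx)
      (halfChord_pos (left_ne_zero_of_mul hxc.ne')) (Ioo_subset_Icc_self hσ) j
  · refine mem_tangentConeAt_of_hasDerivAt (γ := fun σ => sheetPoint ρ n u τ j ψ σ)
      (sheetPoint_hasDerivAt_chord ρ n u τ j ψ σ) ?_
    filter_upwards [isOpen_Ioo.mem_nhds hσ] with x hx
    exact sheetPoint_mem hρ hn hu hτ (Ioo_subset_Icc_self hψ) hh (Ioo_subset_Icc_self hx) j
  · refine linearIndependent_of_gram_ne_zero ?_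
    rw [gram_tangents]
    positivity
  · rw [← inner_self_ne_zero (𝕜 := ℝ), inner_sheetNormal_self]
    exact hreg.ne'

end

/-! ### Sheets as maps of the Euclidean plane -/

/-- The Euclidean plane of parameters `(ψ, σ)`. -/
abbrev E2 := EuclideanSpace ℝ (Fin 2)

/-- The domain of the parameters `(ψ, σ)`. -/
def sheetDomain : Set E2 :=
  {q | q 0 ∈ Ioo 0 Real.pi ∧ Real.cos (q 0) ≠ 0 ∧ q 1 ∈ Ioo (-1) 1}

/-- The `j`-th sheet, as a map of the plane. -/
def sheet (ρ : ℝ) (n : ℕ) (u τ : ℝ) (j : ℕ) (q : E2) : E3 := sheetPoint ρ n u τ j (q 0) (q 1)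

theorem isOpen_sheetDomain : IsOpen sheetDomain := by
  have h0 : Continuous fun q : E2 => q 0 := by fun_prop
  have h1 : Continuous fun q : E2 => q 1 := by fun_prop
  exact (isOpen_Ioo.preimage h0).inter (((isOpen_compl_singleton (x := (0 : ℝ))).preimage
    (Real.continuous_cos.comp h0)).inter (isOpen_Ioo.preimage h1))

section

variable {ρ : ℝ} {n : ℕ} {u τ : ℝ}

theorem contDiffOn_sheet (ρ : ℝ) (n : ℕ) (u : ℝ) (hτ : 0 ≤ τ) (j : ℕ) :
    ContDiffOn ℝ ∞ (sheet ρ n u τ j) sheetDomain := by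
  intro q hq
  have c0 : ContDiffAt ℝ ∞ (fun q : E2 => q 0) q := by fun_prop
  have c1 : ContDiffAt ℝ ∞ (fun q : E2 => q 1) q := by fun_prop
  have hΘ : ContDiffAt ℝ ∞ (fun q : E2 => liftAngle τ (q 0)) q :=
    ContDiffAt.comp (g := liftAngle τ) q (contDiffAt_liftAngle hτ hq.1 hq.2.1) c0
  have hh : ContDiffAt ℝ ∞ (fun q : E2 => halfChord τ (q 0)) q :=
    ContDiffAt.comp (g := halfChord τ) q (contDiffAt_halfChord (halfChord_pos hq.2.1)) c0
  have hs : ContDiffAt ℝ ∞ (fun q : E2 => chordCoord u τ (q 0) (q 1)) q :=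
    (contDiffAt_const.mul c0.cos).add (hh.mul c1)
  refine ContDiffAt.contDiffWithinAt ?_
  refine contDiff_cyl.contDiffAt.comp q (ContDiffAt.prodMk (f := fun q : E2 =>
    sheetAngle n τ j (q 0)) ?_ (ContDiffAt.prodMk ?_ ?_))
  · exact (contDiffAt_const.mul (hΘ.add contDiffAt_const)).div_const _
  · exact contDiffAt_const.add (hs.mul c0.cos)
  · exact hs.mul c0.sin

theorem fderiv_sheet_zero (ρ : ℝ) (n : ℕ) (hu : u ^ 2 + τ ^ 2 = 1) (hτ : 0 ≤ τ) (j : ℕ) {q : E2}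
    (hq : q ∈ sheetDomain) : fderiv ℝ (sheet ρ n u τ j) q (EuclideanSpace.single 0 1) =
      turnTangent ρ n u τ j (q 0) (q 1) := by
  have hd : DifferentiableAt ℝ (sheet ρ n u τ j) q :=
    ((contDiffOn_sheet ρ n u hτ j).contDiffAt (isOpen_sheetDomain.mem_nhds hq)).differentiableAt
      (by simp)
  have hγ : HasDerivAt (fun t : ℝ => q + (t - q 0) • (EuclideanSpace.single 0 1 : E2))
      (EuclideanSpace.single 0 1) (q 0) := by
    simpa using (((hasDerivAt_id (q 0)).sub_const (q 0)).smul_const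
      (EuclideanSpace.single 0 1 : E2)).const_add q
  have h0 : q + (q 0 - q 0) • (EuclideanSpace.single 0 1 : E2) = q := by simp
  have := HasFDerivAt.comp_hasDerivAt (q 0) (f := fun t : ℝ => q + (t - q 0) •
    (EuclideanSpace.single 0 1 : E2)) (by rw [h0]; exact hd.hasFDerivAt) hγ
  refine this.unique ?_
  refine (sheetPoint_hasDerivAt_turn ρ n hu hτ hq.1 hq.2.1 j (q 1)).congr_of_eventuallyEq
    (Eventually.of_forall fun t => ?_)
  simp [sheet]

theorem fderiv_sheet_one (ρ : ℝ) (n : ℕ) (u : ℝ) (hτ : 0 ≤ τ) (j : ℕ) {q : E2}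
    (hq : q ∈ sheetDomain) : fderiv ℝ (sheet ρ n u τ j) q (EuclideanSpace.single 1 1) =
      chordTangent n τ j (q 0) := by
  have hd : DifferentiableAt ℝ (sheet ρ n u τ j) q :=
    ((contDiffOn_sheet ρ n u hτ j).contDiffAt (isOpen_sheetDomain.mem_nhds hq)).differentiableAt
      (by simp)
  have hγ : HasDerivAt (fun t : ℝ => q + (t - q 1) • (EuclideanSpace.single 1 1 : E2))
      (EuclideanSpace.single 1 1) (q 1) := by
    simpa using (((hasDerivAt_id (q 1)).sub_const (q 1)).smul_const
      (EuclideanSpace.single 1 1 : E2)).const_add q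
  have h0 : q + (q 1 - q 1) • (EuclideanSpace.single 1 1 : E2) = q := by simp
  have := HasFDerivAt.comp_hasDerivAt (q 1) (f := fun t : ℝ => q + (t - q 1) •
    (EuclideanSpace.single 1 1 : E2)) (by rw [h0]; exact hd.hasFDerivAt) hγ
  refine this.unique ?_
  refine (sheetPoint_hasDerivAt_chord ρ n u τ j (q 0) (q 1)).congr_of_eventuallyEq
    (Eventually.of_forall fun t => ?_)
  simp [sheet]

theorem normDet_fderiv_sheet (ρ : ℝ) (n : ℕ) (hu : u ^ 2 + τ ^ 2 = 1) (hτ : 0 ≤ τ) (j : ℕ) {q : E2}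
    (hq : q ∈ sheetDomain) : (fderiv ℝ (sheet ρ n u τ j) q : E2 →ₗ[ℝ] E3).normDet =
      sheetDensity ρ n u τ (q 0) (q 1) := by
  rw [normDet_eq_sqrt_det_gram _ (EuclideanSpace.basisFun (Fin 2) ℝ), Matrix.det_fin_two]
  simp only [Matrix.gram_apply, EuclideanSpace.basisFun_apply, ContinuousLinearMap.coe_coe]
  rw [fderiv_sheet_zero ρ n hu hτ j hq, fderiv_sheet_one ρ n u hτ j hq,
    real_inner_comm (turnTangent ρ n u τ j (q 0) (q 1)) (chordTangent n τ j (q 0)), ← sq, gram_tangents,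
    Real.sqrt_mul (sq_nonneg _), Real.sqrt_sq (halfChord_nonneg _ _), sheetDensity]

theorem injective_fderiv_sheet (hρ : 2 < ρ) (hn : n ≠ 0) (hu : u ^ 2 + τ ^ 2 = 1) (hτ : 0 ≤ τ)
    (j : ℕ) {q : E2} (hq : q ∈ sheetDomain) :
    Function.Injective (fderiv ℝ (sheet ρ n u τ j) q) := by
  have hli : LinearIndependent ℝ ![turnTangent ρ n u τ j (q 0) (q 1), chordTangent n τ j (q 0)] := by
    refine linearIndependent_of_gram_ne_zero ?_
    rw [gram_tangents]
    exact (mul_pos (pow_pos (halfChord_pos hq.2.1) 2) (sheet_regular hρ hn hu hq.2.1 hq.2.2)).ne'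
  rw [injective_iff_map_eq_zero]
  intro v hv
  have e : v = v 0 • EuclideanSpace.single 0 1 + v 1 • EuclideanSpace.single 1 1 := by
    ext i; fin_cases i <;> simp
  rw [e, map_add, map_smul, map_smul, fderiv_sheet_zero ρ n hu hτ j hq,
    fderiv_sheet_one ρ n u hτ j hq] at hv
  have := LinearIndependent.pair_iff.1 hli _ _ hv
  rw [e, this.1, this.2, zero_smul, zero_smul, add_zero]

theorem eq_of_sin_sub_eq_zero {ψ ψ' : ℝ} (h : ψ ∈ Ioo 0 Real.pi) (h' : ψ' ∈ Ioo 0 Real.pi)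
    (hs : Real.sin ψ * Real.cos ψ' = Real.cos ψ * Real.sin ψ') : ψ = ψ' := by
  have : Real.sin (ψ - ψ') = 0 := by rw [Real.sin_sub]; linarith
  rw [Real.sin_eq_zero_iff_of_lt_of_lt (by linarith [h.1, h'.2]) (by linarith [h.2, h'.1])] at this
  linarith

theorem liftAngle_mem_Ioo (hτ : 0 < τ) {ψ : ℝ} (hψ : ψ ∈ Ioo 0 Real.pi) :
    liftAngle τ ψ ∈ Ioo 0 Real.pi := by
  have h := abs_lt.1 (sq_cos_div_halfChord_lt hτ hψ)
  exact ⟨Real.arccos_pos.2 h.2, Real.arccos_lt_pi.2 h.1⟩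

/-- If `s ≠ 0`, the position in the disc determines `ψ`. At `s = 0` all chords meet, which forces `τ
> 0`, and the toroidal angle determines `ψ`. In both cases `j` is known modulo `n`. -/
theorem sheet_inj (hρ : 2 < ρ) (hn : n ≠ 0) (hu : u ^ 2 + τ ^ 2 = 1) (hτ : 0 ≤ τ)
    {j j' : ℕ} (hj : j < n) (hj' : j' < n) {q q' : E2} (hq : q ∈ sheetDomain)
    (hq' : q' ∈ sheetDomain) (h : sheet ρ n u τ j q = sheet ρ n u τ j' q') : j = j' ∧ q = q' := by
  have hh := halfChord_pos (τ := τ) hq.2.1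
  have hh' := halfChord_pos (τ := τ) hq'.2.1
  have hn' : (n : ℝ) ≠ 0 := by exact_mod_cast hn
  obtain ⟨h1, h2, k, hk⟩ := cyl_inj (sheetRadius_pos hρ hu _ (Ioo_subset_Icc_self hq.2.2))
    (sheetRadius_pos hρ hu _ (Ioo_subset_Icc_self hq'.2.2)) h
  replace h1 : chordCoord u τ (q 0) (q 1) * Real.cos (q 0) =
    chordCoord u τ (q' 0) (q' 1) * Real.cos (q' 0) := by linarith
  replace hk : liftAngle τ (q' 0) + Real.pi * j' = liftAngle τ (q 0) + Real.pi * (j + n * k) := by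
    rw [sheetAngle, sheetAngle, div_eq_iff hn', add_mul, div_mul_cancel₀ _ hn'] at hk
    linarith
  have hψ : q 0 = q' 0 := by
    by_cases hs : chordCoord u τ (q 0) (q 1) = 0
    · have hτ' : 0 < τ := by
        refine hτ.lt_of_ne fun h0 => ?_
        subst h0
        exact chordCoord_ne_zero (by simpa using hu) hq.2.1 hq.2.2 hs
      have hΘ := liftAngle_mem_Ioo hτ' hq.1
      have hΘ' := liftAngle_mem_Ioo hτ' hq'.1
      -- Two lifted angles in `(0, π)` differ by less than `π`, so this integer has absolute value
      -- below one.
      have hz : ((j : ℤ) + n * k - j' : ℤ) = 0 := by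
        have e : liftAngle τ (q' 0) - liftAngle τ (q 0) =
            Real.pi * ((j : ℤ) + n * k - j' : ℤ) := by
          push_cast; linarith
        have l1 : Real.pi * ((j : ℤ) + n * k - j' : ℤ) < Real.pi * (1 : ℤ) := by
          rw [← e]; push_cast; linarith [hΘ.1, hΘ'.2]
        have l2 : Real.pi * (-1 : ℤ) < Real.pi * ((j : ℤ) + n * k - j' : ℤ) := by
          rw [← e]; push_cast; linarith [hΘ.2, hΘ'.1]
        have l1 := lt_of_mul_lt_mul_left l1 Real.pi_pos.le
        have l2 := lt_of_mul_lt_mul_left l2 Real.pi_pos.le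
        rw [Int.cast_lt] at l1 l2
        omega
      have hz' : (j : ℝ) + n * k - j' = 0 := by exact_mod_cast hz
      have hΘe : liftAngle τ (q' 0) = liftAngle τ (q 0) := by
        linear_combination hk + Real.pi * hz'
      have hc := congrArg Real.cos hΘe
      have hsn := congrArg Real.sin hΘe
      rw [cos_liftAngle hh, cos_liftAngle hh', div_eq_div_iff hh'.ne' hh.ne'] at hc
      rw [sin_liftAngle hτ (Ioo_subset_Icc_self hq.1) hh,
        sin_liftAngle hτ (Ioo_subset_Icc_self hq'.1) hh', div_eq_div_iff hh'.ne' hh.ne'] at hsn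
      refine eq_of_sin_sub_eq_zero hq.1 hq'.1 ?_
      have : τ * halfChord τ (q 0) * (Real.sin (q 0) * Real.cos (q' 0) -
          Real.cos (q 0) * Real.sin (q' 0)) = 0 := by
        linear_combination τ * Real.sin (q 0) * hc - Real.cos (q 0) * hsn
      have := (mul_eq_zero.1 this).resolve_left (mul_pos hτ' hh).ne'
      linarith
    · have hs' : chordCoord u τ (q' 0) (q' 1) ≠ 0 := by
        intro h0
        rw [h0, zero_mul] at h1
        exact (mul_ne_zero hs hq.2.1) h1
      refine eq_of_sin_sub_eq_zero hq.1 hq'.1 ?_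
      have : chordCoord u τ (q' 0) (q' 1) * (Real.sin (q 0) * Real.cos (q' 0) -
          Real.cos (q 0) * Real.sin (q' 0)) = 0 := by
        linear_combination -Real.sin (q 0) * h1 + Real.cos (q 0) * h2
      have := (mul_eq_zero.1 this).resolve_left hs'
      linarith
  rw [← hψ] at hk h1
  constructor
  · have : (j' : ℝ) = (j + n * k : ℤ) := by
      push_cast
      exact mul_left_cancel₀ Real.pi_pos.ne' (by linarith)
    have hz : (j' : ℤ) = j + n * k := by exact_mod_cast this
    have h1 : k < 1 := by
      by_contra hk1
      have : (n : ℤ) * 1 ≤ n * k := by gcongr; omega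
      omega
    have h2 : -1 < k := by
      by_contra hk1
      have : (n : ℤ) * k ≤ n * (-1) := by gcongr; omega
      omega
    have : k = 0 := by omega
    subst this
    omega
  · have h3 := mul_right_cancel₀ hq.2.1 h1
    rw [chordCoord, chordCoord, add_right_inj] at h3
    have h4 := mul_left_cancel₀ hh.ne' h3
    ext i
    fin_cases i
    · exact hψ
    · exact h4

end

/-! ### The part of a ribbon not covered by the sheets is negligible -/

theorem area_range_eq_zero {γ : ℝ → E3} (hγ : ContDiff ℝ 1 γ) : area (range γ) = 0 := by
  have h : dimH (range γ) ≤ 1 := by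
    simpa using hγ.dimH_range_le
  have h2 : dimH (range γ) < ((2 : NNReal) : ℝ≥0∞) := lt_of_le_of_lt h (by norm_num)
  have h0 := hausdorffMeasure_of_dimH_lt h2
  have h3 : μH[((2 : ℕ) : ℝ)] (range γ) = 0 := by simpa using h0
  rw [area, Measure.euclideanHausdorffMeasure_def, Measure.smul_apply, h3, smul_zero]

/-- The curves of a ribbon which are not covered by the sheets. -/
def seams (ρ : ℝ) (n : ℕ) (u τ : ℝ) : Set E3 :=
  (⋃ k : ℤ, range fun r => cyl (2 * Real.pi * k / n) r 0) ∪
  (⋃ k : ℤ, range fun z => cyl (2 * (Real.pi / 2 + Real.pi * k) / n) (ρ - u) z) ∪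
  (range fun φ => cyl φ (ρ - u) 0) ∪
  -- The rims of the meridian discs; they are needed for `τ = 0` only.
  (⋃ k : ℤ, range fun β => cyl (2 * Real.pi * k / n) (ρ + Real.cos β) (Real.sin β)) ∪
  (if τ = 0 then ∅ else (range fun φ => ribbonMap ρ n u τ φ 1) ∪
    range fun φ => ribbonMap ρ n u τ φ (-1))

section

variable {ρ : ℝ} {n : ℕ} {u τ : ℝ}

theorem contDiff_ribbonMap (ρ : ℝ) (n : ℕ) (hu : u ^ 2 < 1) {l : ℝ} (hl : l ^ 2 ≤ 1) :
    ContDiff ℝ 1 fun φ => ribbonMap ρ n u τ φ l := by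
  have hc : ContDiff ℝ 1 fun φ : ℝ => l * Real.cos (n * φ / 2) :=
    contDiff_const.mul ((contDiff_const.mul contDiff_id).div_const 2).cos
  have hs : ContDiff ℝ 1 fun φ : ℝ => l * Real.sin (n * φ / 2) :=
    contDiff_const.mul ((contDiff_const.mul contDiff_id).div_const 2).sin
  have hd : ∀ φ : ℝ, 1 - u * (l * Real.cos (n * φ / 2)) ≠ 0 := fun φ =>
    (one_sub_mul_pos hu (mul_cos_sq_le hl (n * φ / 2))).ne'
  have hD : ContDiff ℝ 1 fun φ : ℝ => 1 - u * (l * Real.cos (n * φ / 2)) :=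
    contDiff_const.sub (contDiff_const.mul hc)
  exact (contDiff_cyl.of_le (by simp)).comp (contDiff_id.prodMk
    ((contDiff_const.add ((hc.sub contDiff_const).div hD hd)).prodMk
      ((contDiff_const.mul hs).div hD hd)))

theorem area_seams (ρ : ℝ) (n : ℕ) (hu : u ^ 2 + τ ^ 2 = 1) : area (seams ρ n u τ) = 0 := by
  have hcyl : ContDiff ℝ 1 fun q : ℝ × ℝ × ℝ => cyl q.1 q.2.1 q.2.2 := contDiff_cyl.of_le (by simp)
  refine measure_union_null (measure_union_null (measure_union_null (measure_union_null ?_ ?_) ?_)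
    ?_) ?_
  · exact measure_iUnion_null fun k => area_range_eq_zero
      (hcyl.comp (contDiff_const.prodMk (contDiff_id.prodMk contDiff_const)))
  · exact measure_iUnion_null fun k => area_range_eq_zero
      (hcyl.comp (contDiff_const.prodMk (contDiff_const.prodMk contDiff_id)))
  · exact area_range_eq_zero (hcyl.comp (contDiff_id.prodMk (contDiff_const.prodMk contDiff_const)))
  · exact measure_iUnion_null fun k => area_range_eq_zero (hcyl.comp (contDiff_const.prodMk
      ((contDiff_const.add Real.contDiff_cos).prodMk Real.contDiff_sin)))
  · split_ifs with h
    · exact measure_empty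
    · have hu' : u ^ 2 < 1 := by have : 0 < τ ^ 2 := by positivity
                                 linarith
      exact measure_union_null (area_range_eq_zero (contDiff_ribbonMap ρ n hu' (by norm_num)))
        (area_range_eq_zero (contDiff_ribbonMap ρ n hu' (by norm_num)))

theorem exists_polar {X Y : ℝ} (hY : Y ≠ 0) :
    ∃ s, ∃ ψ ∈ Ioo 0 Real.pi, s ≠ 0 ∧ X = s * Real.cos ψ ∧ Y = s * Real.sin ψ := by
  have key : ∀ X Y : ℝ, 0 < Y →
      ∃ s, ∃ ψ ∈ Ioo 0 Real.pi, s ≠ 0 ∧ X = s * Real.cos ψ ∧ Y = s * Real.sin ψ := by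
    intro X Y hY
    have hn : ‖(⟨X, Y⟩ : ℂ)‖ ≠ 0 := by
      rw [norm_ne_zero_iff]
      intro h
      exact hY.ne' (congrArg Complex.im h)
    refine ⟨‖(⟨X, Y⟩ : ℂ)‖, Complex.arg ⟨X, Y⟩, ?_, hn, ?_, ?_⟩
    · have h0 : Complex.arg ⟨X, Y⟩ ≠ 0 := fun h => hY.ne' (Complex.arg_eq_zero_iff.1 h).2
      exact ⟨(Complex.arg_nonneg_iff.2 hY.le).lt_of_ne' h0, Complex.arg_lt_pi_iff.2 (Or.inr hY.ne')⟩
    · rw [Complex.norm_mul_cos_arg]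
    · rw [Complex.norm_mul_sin_arg]
  rcases hY.lt_or_gt with h | h
  · obtain ⟨s, ψ, hψ, hs, h1, h2⟩ := key (-X) (-Y) (by linarith)
    exact ⟨-s, ψ, hψ, neg_ne_zero.2 hs, by linarith, by linarith⟩
  · exact key X Y h

/-- Off the seams a point is interior to the disc and has polar coordinates around `(-u, 0)` with
`cos ψ ≠ 0`. Vanishing of `profile` then says `sin(θ - Θ) = 0`, so `θ = Θ + πm`, and the sheet is
the one with index `m mod n`. -/
theorem ribbon_subset_sheets_union_seams (hρ : 2 < ρ) (hn : n ≠ 0) (hu : u ^ 2 + τ ^ 2 = 1)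
    (hτ : 0 ≤ τ) : ribbon ρ n u τ ⊆
      (⋃ j ∈ Finset.range n, sheet ρ n u τ j '' sheetDomain) ∪ seams ρ n u τ := by
  intro x hx
  obtain ⟨φ, r, z, hr, rfl⟩ := exists_cyl_of_mem_toroid hρ (ribbon_subset _ _ _ _ hx)
  have hn' : (n : ℝ) ≠ 0 := by exact_mod_cast hn
  have hx' := (cyl_mem_ribbon hr).1 hx
  have hpr := hx'.2
  rw [profile] at hpr
  have hsin : Real.sin (n * φ / 2) = 0 → ∃ k : ℤ, φ = 2 * Real.pi * k / n := by
    intro h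
    obtain ⟨k, hk⟩ := Real.sin_eq_zero_iff.1 h
    exact ⟨k, by rw [eq_div_iff hn']; linarith⟩
  rcases hx'.1.eq_or_lt with hb | hb
  · right
    rcases hτ.eq_or_lt with rfl | hτ
    · have hp : (r - ρ + u) * Real.sin (n * φ / 2) = 0 := by linarith
      rcases mul_eq_zero.1 hp with h | h
      · have hz : z = 0 := by
          have : r - ρ = -u := by linarith
          rw [this] at hb
          have : z ^ 2 = 0 := by linarith
          simpa using this
        refine Or.inl (Or.inl (Or.inr ⟨φ, ?_⟩))
        have : ρ - u = r := by linarith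
        simp only [this, hz]
      · obtain ⟨k, hk⟩ := hsin h
        refine Or.inl (Or.inr (mem_iUnion.2 ⟨k, Complex.arg ⟨r - ρ, z⟩, ?_⟩))
        have hnorm : ‖(⟨r - ρ, z⟩ : ℂ)‖ = 1 := by
          rw [Complex.norm_def, Complex.normSq_mk, ← sq, ← sq, hb, Real.sqrt_one]
        have e1 := Complex.norm_mul_cos_arg ⟨r - ρ, z⟩
        have e2 := Complex.norm_mul_sin_arg ⟨r - ρ, z⟩
        rw [hnorm, one_mul] at e1 e2
        simp only [e1, e2, ← hk]
        congr 1; ring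
    · right
      rw [if_neg hτ.ne']
      obtain ⟨l, hl, hlx⟩ := exists_ribbonMap_eq hu hτ hr hx
      have hD := one_sub_mul_pos (u := u) (by nlinarith) (mul_cos_sq_le hl (n * φ / 2))
      have hk := kleinBoost_sq (Y := l * Real.sin (n * φ / 2)) hu hD.ne'
      have hrad := kleinBoost_mem_disc hu hτ hl (n * φ / 2)
      have hl1 : l ^ 2 = 1 := by
        have h1 := hlx
        rw [ribbonMap] at h1
        have hrr : 0 < ρ + (kleinBoost u τ (l * Real.cos (n * φ / 2))
            (l * Real.sin (n * φ / 2))).1 := by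
          have : (kleinBoost u τ (l * Real.cos (n * φ / 2))
            (l * Real.sin (n * φ / 2))).1 ^ 2 ≤ 1 := by
            nlinarith [sq_nonneg (kleinBoost u τ (l * Real.cos (n * φ / 2))
              (l * Real.sin (n * φ / 2))).2]
          have := (abs_le.1 ((sq_le_one_iff_abs_le_one _).1 this)).1
          linarith
        obtain ⟨e1, e2, -⟩ := cyl_inj hrr hr h1
        rw [e2] at hk
        have e3 : (kleinBoost u τ (l * Real.cos (n * φ / 2))
            (l * Real.sin (n * φ / 2))).1 = r - ρ := by linarith
        rw [e3, sub_sub, hb, sub_self, eq_comm, div_eq_zero_iff] at hk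
        have h2 := hk.resolve_right (pow_pos hD 2).ne'
        have h3 := (mul_eq_zero.1 h2).resolve_left (pow_pos hτ 2).ne'
        linear_combination -h3 - l ^ 2 * Real.sin_sq_add_cos_sq (n * φ / 2)
      rcases mul_self_eq_one_iff.1 ((sq l).symm.trans hl1) with h | h
      · exact Or.inl ⟨φ, by rw [← hlx, h]⟩
      · exact Or.inr ⟨φ, by rw [← hlx, h]⟩
  · by_cases hz : z = 0
    · right
      subst hz
      have hp : (r - ρ + u) * Real.sin (n * φ / 2) = 0 := by linarith
      rcases mul_eq_zero.1 hp with h | h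
      · refine Or.inl (Or.inl (Or.inr ⟨φ, ?_⟩))
        have : ρ - u = r := by linarith
        simp only [this]
      · obtain ⟨k, hk⟩ := hsin h
        exact Or.inl (Or.inl (Or.inl (Or.inl (mem_iUnion.2 ⟨k, r, by rw [hk]⟩))))
    by_cases hX : r - ρ + u = 0
    · right
      have hτ' : τ ≠ 0 := by
        rintro rfl
        have : r - ρ = -u := by linarith
        rw [this] at hb
        nlinarith [sq_nonneg z]
      rw [hX, zero_mul, zero_sub, neg_eq_zero] at hpr
      have hc := (mul_eq_zero.1 hpr).resolve_left (mul_ne_zero hτ' hz)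
      obtain ⟨k, hk⟩ := Real.cos_eq_zero_iff.1 hc
      refine Or.inl (Or.inl (Or.inl (Or.inr (mem_iUnion.2 ⟨k, z, ?_⟩))))
      have e1 : ρ - u = r := by linarith
      have e2 : 2 * (Real.pi / 2 + Real.pi * k) / n = φ := by
        rw [div_eq_iff hn']; linarith
      simp only [e1, e2]
    left
    obtain ⟨s, ψ, hψ, hs, hsX, hsY⟩ := exists_polar (X := r - ρ + u) hz
    have hc : Real.cos ψ ≠ 0 := by
      intro h
      rw [h, mul_zero] at hsX
      exact hX hsX
    have hh := halfChord_pos (τ := τ) hc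
    have hsσ : chordCoord u τ ψ ((s - u * Real.cos ψ) / halfChord τ ψ) = s := by
      rw [chordCoord, mul_div_cancel₀ _ hh.ne']; ring
    have hchord := one_sub_chord_sq hu ψ ((s - u * Real.cos ψ) / halfChord τ ψ)
    set σ := (s - u * Real.cos ψ) / halfChord τ ψ with hσdef
    have hσ : σ ∈ Ioo (-1) 1 := by
      rw [hsσ, ← hsY, ← hsX] at hchord
      have h1 : 0 < halfChord τ ψ ^ 2 * (1 - σ ^ 2) := by
        rw [← hchord]
        have : -u + (r - ρ + u) = r - ρ := by ring
        rw [this]; linarith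
      have h2 := pos_of_mul_pos_right h1 (sq_nonneg _)
      have := abs_lt.1 ((sq_lt_one_iff_abs_lt_one σ).1 (by linarith))
      exact this
    have hΘ : Real.sin (n * φ / 2 - liftAngle τ ψ) = 0 := by
      rw [Real.sin_sub, cos_liftAngle hh, sin_liftAngle hτ (Ioo_subset_Icc_self hψ) hh]
      rw [hsX, hsY] at hpr
      have : s * (Real.sin (n * φ / 2) * Real.cos ψ -
          Real.cos (n * φ / 2) * (τ * Real.sin ψ)) = 0 := by linarith
      have := (mul_eq_zero.1 this).resolve_left hs
      rw [← mul_div_assoc, ← mul_div_assoc, ← sub_div, this, zero_div]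
    obtain ⟨m, hm⟩ := Real.sin_eq_zero_iff.1 hΘ
    have hnz : (n : ℤ) ≠ 0 := by exact_mod_cast hn
    have hm0 := Int.emod_nonneg m hnz
    have hm1 := Int.emod_lt_of_pos m (show (0 : ℤ) < n by omega)
    refine mem_iUnion₂.2 ⟨(m % n).toNat, Finset.mem_range.2 (by omega), !₂[ψ, σ],
      ⟨by simpa using hψ, by simpa using hc, by simpa using hσ⟩, ?_⟩
    have hcast : (((m % n).toNat : ℕ) : ℝ) = ((m % n : ℤ) : ℝ) := by
      rw [← Int.cast_natCast, Int.toNat_of_nonneg hm0]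
    have hdm : (m : ℝ) = (m % n : ℤ) + n * (m / n : ℤ) := by
      exact_mod_cast (Int.emod_add_mul_ediv m n).symm
    have hφ : φ = sheetAngle n τ (m % n).toNat ψ + 2 * Real.pi * (m / n : ℤ) := by
      rw [sheetAngle, hcast]
      field_simp
      rw [hdm] at hm
      linarith
    change sheetPoint ρ n u τ _ ψ σ = _
    rw [sheetPoint, hsσ, ← hsX, ← hsY, hφ, cyl_add_two_pi]
    congr 1
    ring

theorem iUnion_sheets_subset_ribbon (hρ : 2 < ρ) (hn : n ≠ 0) (hu : u ^ 2 + τ ^ 2 = 1)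
    (hτ : 0 ≤ τ) : (⋃ j ∈ Finset.range n, sheet ρ n u τ j '' sheetDomain) ⊆ ribbon ρ n u τ := by
  refine iUnion₂_subset fun j _ => ?_
  rintro _ ⟨q, hq, rfl⟩
  exact sheetPoint_mem hρ hn hu hτ (Ioo_subset_Icc_self hq.1) (halfChord_pos hq.2.1)
    (Ioo_subset_Icc_self hq.2.2) j

theorem iUnion_sheets_ae_eq_ribbon (hρ : 2 < ρ) (hn : n ≠ 0) (hu : u ^ 2 + τ ^ 2 = 1)
    (hτ : 0 ≤ τ) : (⋃ j ∈ Finset.range n, sheet ρ n u τ j '' sheetDomain) =ᵐ[area]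
      ribbon ρ n u τ := by
  refine (LE.le.eventuallyLE (iUnion_sheets_subset_ribbon hρ hn hu hτ)).antisymm ?_
  rw [ae_le_set]
  refine measure_mono_null ?_ (area_seams ρ n hu)
  intro x hx
  exact (ribbon_subset_sheets_union_seams hρ hn hu hτ hx.1).resolve_left hx.2

theorem measurableSet_image_sheet (hρ : 2 < ρ) (hu : u ^ 2 + τ ^ 2 = 1) (hτ : 0 ≤ τ)
    {j : ℕ} (hj : j < n) : MeasurableSet (sheet ρ n u τ j '' sheetDomain) :=
  isOpen_sheetDomain.measurableSet.image_of_continuousOn_injOn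
    (contDiffOn_sheet ρ n u hτ j).continuousOn
    fun _ hq _ hq' h => (sheet_inj hρ (by omega) hu hτ hj hj hq hq' h).2

theorem pairwise_disjoint_sheets (hρ : 2 < ρ) (hn : n ≠ 0) (hu : u ^ 2 + τ ^ 2 = 1) (hτ : 0 ≤ τ) :
    (↑(Finset.range n) : Set ℕ).Pairwise
      (Function.onFun Disjoint fun j => sheet ρ n u τ j '' sheetDomain) := by
  intro j hj j' hj' hne
  rw [Function.onFun, disjoint_left]
  rintro _ ⟨q, hq, rfl⟩ ⟨q', hq', h⟩
  exact hne (sheet_inj hρ hn hu hτ (Finset.mem_range.1 hj') (Finset.mem_range.1 hj) hq' hq h).1.symm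

theorem finrank_E2 : Module.finrank ℝ E2 = 2 := by simp

theorem area_ribbon (hρ : 2 < ρ) (hn : n ≠ 0) (hu : u ^ 2 + τ ^ 2 = 1) (hτ : 0 ≤ τ) :
    area (ribbon ρ n u τ) =
      n * ∫⁻ q in sheetDomain, ENNReal.ofReal (sheetDensity ρ n u τ (q 0) (q 1)) := by
  rw [← measure_congr (iUnion_sheets_ae_eq_ribbon hρ hn hu hτ),
    measure_biUnion_finset (pairwise_disjoint_sheets hρ hn hu hτ)
      fun j hj => measurableSet_image_sheet hρ hu hτ (Finset.mem_range.1 hj)]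
  have key : ∀ j ∈ Finset.range n, area (sheet ρ n u τ j '' sheetDomain) =
      ∫⁻ q in sheetDomain, ENNReal.ofReal (sheetDensity ρ n u τ (q 0) (q 1)) := by
    intro j hj
    have := euclideanHausdorffMeasure_image_eq_lintegral_normDet isOpen_sheetDomain
      ((contDiffOn_sheet ρ n u hτ j).of_le (by simp))
      (fun _ hq _ hq' h => (sheet_inj hρ hn hu hτ (Finset.mem_range.1 hj)
        (Finset.mem_range.1 hj) hq hq' h).2)
      (fun q hq => injective_fderiv_sheet hρ hn hu hτ j hq) subset_rfl
      isOpen_sheetDomain.measurableSet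
    rw [finrank_E2] at this
    rw [area, this]
    refine setLIntegral_congr_fun isOpen_sheetDomain.measurableSet fun q hq => ?_
    simp only [normDet_fderiv_sheet ρ n hu hτ j hq]
  rw [Finset.sum_congr rfl key, Finset.sum_const, Finset.card_range, nsmul_eq_mul]

theorem integrableOn_ribbon_iff (hρ : 2 < ρ) (hn : n ≠ 0) (hu : u ^ 2 + τ ^ 2 = 1) (hτ : 0 ≤ τ)
    (g : E3 → ℝ) : IntegrableOn g (ribbon ρ n u τ) area ↔ ∀ j ∈ Finset.range n,
      IntegrableOn (fun q => sheetDensity ρ n u τ (q 0) (q 1) * g (sheet ρ n u τ j q))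
        sheetDomain := by
  rw [← integrableOn_congr_set_ae (iUnion_sheets_ae_eq_ribbon hρ hn hu hτ),
    integrableOn_finset_iUnion]
  refine forall₂_congr fun j hj => ?_
  have := integrableOn_image_iff_normDet isOpen_sheetDomain
      ((contDiffOn_sheet ρ n u hτ j).of_le (by simp))
      (fun _ hq _ hq' h => (sheet_inj hρ hn hu hτ (Finset.mem_range.1 hj)
        (Finset.mem_range.1 hj) hq hq' h).2)
      (fun q hq => injective_fderiv_sheet hρ hn hu hτ j hq) g
  rw [finrank_E2] at this
  rw [this]
  refine integrableOn_congr_fun (fun q hq => ?_) isOpen_sheetDomain.measurableSet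
  simp only [normDet_fderiv_sheet ρ n hu hτ j hq]

theorem setIntegral_ribbon (hρ : 2 < ρ) (hn : n ≠ 0) (hu : u ^ 2 + τ ^ 2 = 1) (hτ : 0 ≤ τ)
    {g : E3 → ℝ} (hg : IntegrableOn g (ribbon ρ n u τ) area) :
    ∫ p in ribbon ρ n u τ, g p ∂area = ∑ j ∈ Finset.range n,
      ∫ q in sheetDomain, sheetDensity ρ n u τ (q 0) (q 1) * g (sheet ρ n u τ j q) := by
  rw [← setIntegral_congr_set (iUnion_sheets_ae_eq_ribbon hρ hn hu hτ),
    integral_biUnion_finset _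
      (fun j hj => measurableSet_image_sheet hρ hu hτ (Finset.mem_range.1 hj))
      (pairwise_disjoint_sheets hρ hn hu hτ)]
  · refine Finset.sum_congr rfl fun j hj => ?_
    have := setIntegral_image_eq_normDet isOpen_sheetDomain
      ((contDiffOn_sheet ρ n u hτ j).of_le (by simp))
      (fun _ hq _ hq' h => (sheet_inj hρ hn hu hτ (Finset.mem_range.1 hj)
        (Finset.mem_range.1 hj) hq hq' h).2)
      (fun q hq => injective_fderiv_sheet hρ hn hu hτ j hq) g
    rw [finrank_E2] at this
    rw [area, this]
    refine setIntegral_congr_fun isOpen_sheetDomain.measurableSet fun q hq => ?_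
    simp only [normDet_fderiv_sheet ρ n hu hτ j hq]
  · intro j hj
    refine hg.mono_set (Subset.trans ?_ (iUnion_sheets_subset_ribbon hρ hn hu hτ))
    exact subset_biUnion_of_mem (u := fun j => sheet ρ n u τ j '' sheetDomain) hj

end

/-! ### The area of the ribbons -/

theorem lintegral_ofReal_Ioo {a b : ℝ} (hab : a ≤ b) {f : ℝ → ℝ} (hf : Continuous f)
    (h0 : ∀ x ∈ Ioo a b, 0 ≤ f x) :
    ∫⁻ x in Ioo a b, ENNReal.ofReal (f x) = ENNReal.ofReal (∫ x in a..b, f x) := by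
  rw [intervalIntegral.integral_of_le hab, integral_Ioc_eq_integral_Ioo]
  refine (ofReal_integral_eq_lintegral_ofReal ?_ ?_).symm
  · exact hf.continuousOn.integrableOn_Icc.mono_set Ioo_subset_Icc_self
  · exact (ae_restrict_iff' measurableSet_Ioo).2 (Eventually.of_forall h0)

/-- The measurable identification of the plane with `ℝ × ℝ`. -/
def planeEquiv : E2 ≃ᵐ ℝ × ℝ :=
  (MeasurableEquiv.toLp 2 (Fin 2 → ℝ)).symm.trans MeasurableEquiv.finTwoArrow

theorem planeEquiv_apply (q : E2) : planeEquiv q = (q 0, q 1) := rfl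

theorem measurePreserving_planeEquiv : MeasurePreserving planeEquiv :=
  (volume_preserving_finTwoArrow ℝ).comp
    (EuclideanSpace.volume_preserving_symm_measurableEquiv_toLp (Fin 2))

theorem sheetDomain_eq_preimage :
    sheetDomain = planeEquiv ⁻¹' ((Ioo 0 Real.pi \ {Real.pi / 2}) ×ˢ Ioo (-1) 1) := by
  ext q
  rw [mem_preimage, planeEquiv_apply, mem_prod, Set.mem_sdiff, sheetDomain, mem_ofPred_eq, ← and_assoc]
  refine and_congr_left fun _ => and_congr_right fun h => not_congr ?_
  rw [mem_singleton_iff]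
  constructor
  · intro hc
    exact Real.injOn_cos (Ioo_subset_Icc_self h)
      ⟨by linarith [Real.pi_pos], by linarith [Real.pi_pos]⟩ (by rw [hc, Real.cos_pi_div_two])
  · exact fun h => (congrArg Real.cos h).trans Real.cos_pi_div_two

theorem lintegral_sheetDomain {f : ℝ → ℝ → ℝ≥0∞} (hf : Measurable (Function.uncurry f)) :
    ∫⁻ q in sheetDomain, f (q 0) (q 1) =
      ∫⁻ ψ in Ioo 0 Real.pi, ∫⁻ σ in Ioo (-1) 1, f ψ σ := by
  rw [sheetDomain_eq_preimage]
  have := measurePreserving_planeEquiv.setLIntegral_comp_preimage_emb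
    planeEquiv.measurableEmbedding (Function.uncurry f)
    ((Ioo 0 Real.pi \ {Real.pi / 2}) ×ˢ Ioo (-1) 1)
  simp only [planeEquiv_apply, Function.uncurry_apply_pair] at this
  rw [this, Measure.volume_eq_prod, setLIntegral_prod _ hf.aemeasurable]
  exact setLIntegral_congr (sdiff_null_ae_eq_self (measure_singleton _))

theorem volume_sheetDomain_lt_top : volume sheetDomain < ⊤ := by
  have := lintegral_sheetDomain (f := fun _ _ => 1) (by fun_prop)
  simp only [lintegral_const, one_mul, Measure.restrict_apply_univ, Real.volume_Ioo] at this
  rw [this]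
  exact ENNReal.mul_lt_top ENNReal.ofReal_lt_top ENNReal.ofReal_lt_top

section

variable {ρ : ℝ} {n : ℕ} {u τ ψ σ : ℝ}

theorem continuous_halfChord (τ : ℝ) : Continuous (halfChord τ) := by
  unfold halfChord; fun_prop

/-- An upper bound for the density of the sheets. -/
def densityBound (u τ ψ σ : ℝ) : ℝ :=
  (1 + (halfChord τ ψ ^ 2 * chordCoord u τ ψ σ ^ 2 + 16 / 25 * (τ ^ 2 / halfChord τ ψ ^ 2))) / 2

theorem densityBound_nonneg (u τ ψ σ : ℝ) : 0 ≤ densityBound u τ ψ σ := by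
  unfold densityBound; positivity

/-- The integral of the upper bound over a chord. -/
def areaBound (τ ψ : ℝ) : ℝ :=
  1 + 4 / 3 * (halfChord τ ψ ^ 2) ^ 2 - τ ^ 2 * halfChord τ ψ ^ 2 +
    16 / 25 * τ * (τ / halfChord τ ψ ^ 2)

/-- The radius is at most `ρ + 1`, so the hypothesis on `n` bounds `2R/n` by `4/5`, whose square is
the constant `16/25`. -/
theorem sheetDensity_sq_le (hρ : 2 < ρ) (hn : 5 * (ρ + 1) / 2 ≤ n) (hu : u ^ 2 + τ ^ 2 = 1)
    (hh : 0 < halfChord τ ψ) (hσ : σ ∈ Icc (-1) 1) :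
    sheetDensity ρ n u τ ψ σ ^ 2 ≤
      halfChord τ ψ ^ 2 * chordCoord u τ ψ σ ^ 2 + 16 / 25 * (τ ^ 2 / halfChord τ ψ ^ 2) := by
  have hn0 : (0 : ℝ) < n := by linarith
  have hR := sheetRadius_pos hρ hu ψ hσ
  have hR' := sheetRadius_le (ρ := ρ) hu ψ hσ
  rw [sheetDensity, mul_pow, Real.sq_sqrt (by positivity), mul_add, angularSpeed]
  set R := ρ - u + chordCoord u τ ψ σ * Real.cos ψ
  have h1 : R * (2 / n) ≤ 4 / 5 := by
    rw [← mul_div_assoc, div_le_iff₀ hn0]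
    linarith
  have h2 : (R * (2 / n)) ^ 2 ≤ (4 / 5) ^ 2 := pow_le_pow_left₀ (by positivity) h1 2
  have e : halfChord τ ψ ^ 2 * (R * (2 / n * (τ / halfChord τ ψ ^ 2))) ^ 2 =
      (R * (2 / n)) ^ 2 * (τ ^ 2 / halfChord τ ψ ^ 2) := by
    field_simp
  rw [e, show (16 / 25 : ℝ) = (4 / 5) ^ 2 by norm_num]
  gcongr

theorem sheetDensity_le (hρ : 2 < ρ) (hn : 5 * (ρ + 1) / 2 ≤ n) (hu : u ^ 2 + τ ^ 2 = 1)
    (hh : 0 < halfChord τ ψ) (hσ : σ ∈ Icc (-1) 1) :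
    sheetDensity ρ n u τ ψ σ ≤ densityBound u τ ψ σ := by
  have := sheetDensity_sq_le hρ hn hu hh hσ
  rw [densityBound]
  -- This is `x ≤ (1 + x²) / 2`, which replaces the square root by an explicitly integrable
  -- function.
  nlinarith [sq_nonneg (sheetDensity ρ n u τ ψ σ - 1)]

theorem sheetDensity_nonneg : 0 ≤ sheetDensity ρ n u τ ψ σ :=
  mul_nonneg (halfChord_nonneg _ _) (Real.sqrt_nonneg _)

/-- A bound independent of `u` and `τ`, the majorant for dominated convergence. -/
theorem sheetDensity_le_three (hρ : 2 < ρ) (hn : 5 * (ρ + 1) / 2 ≤ n) (hu : u ^ 2 + τ ^ 2 = 1)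
    (hτ : 0 ≤ τ) (hh : 0 < halfChord τ ψ) (hσ : σ ∈ Icc (-1) 1) :
    sheetDensity ρ n u τ ψ σ ≤ 3 := by
  refine (sheetDensity_le hρ hn hu hh hσ).trans ?_
  have h1 := halfChord_le_one hu ψ
  have h2 := le_halfChord hu ψ
  have h3 : τ ^ 2 / halfChord τ ψ ^ 2 ≤ 1 := by
    rw [div_le_one (pow_pos hh 2)]
    exact pow_le_pow_left₀ hτ h2 2
  have h4 : chordCoord u τ ψ σ ^ 2 ≤ 4 := by
    have a1 : (u * Real.cos ψ) ^ 2 ≤ 1 := by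
      rw [mul_pow]
      exact mul_le_one₀ (by nlinarith) (sq_nonneg _) (Real.cos_sq_le_one ψ)
    have a2 : (halfChord τ ψ * σ) ^ 2 ≤ 1 := by
      rw [mul_pow]
      exact mul_le_one₀ (pow_le_one₀ hh.le h1) (sq_nonneg _) (sq_le_one_of_mem hσ)
    rw [chordCoord]
    nlinarith [sq_nonneg (u * Real.cos ψ - halfChord τ ψ * σ)]
  have h5 : halfChord τ ψ ^ 2 * chordCoord u τ ψ σ ^ 2 ≤ 1 * 4 := by
    gcongr
    exact pow_le_one₀ hh.le h1
  rw [densityBound]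
  linarith

/-- The bound is quadratic in `σ`, and the term linear in `σ` drops out by symmetry. The relation
`u² cos² ψ = h² - τ²` eliminates `u`. -/
theorem integral_density_bound (u τ ψ : ℝ) (hu : u ^ 2 + τ ^ 2 = 1) :
    ∫ σ in (-1 : ℝ)..1, densityBound u τ ψ σ =
    areaBound τ ψ := by
  have h2 := halfChord_sq_eq' hu ψ
  have hd : ∀ σ ∈ uIcc (-1 : ℝ) 1, HasDerivAt (fun σ => (1 + 16 / 25 * (τ ^ 2 / halfChord τ ψ ^ 2)) / 2 * σ
      + halfChord τ ψ ^ 2 * ((u * Real.cos ψ) ^ 2 * σ + u * Real.cos ψ * halfChord τ ψ * σ ^ 2 +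
        halfChord τ ψ ^ 2 * (σ ^ 3 / 3)) / 2)
      (densityBound u τ ψ σ) σ := by
    intro σ _
    have i := hasDerivAt_id σ
    refine ((i.const_mul ((1 + 16 / 25 * (τ ^ 2 / halfChord τ ψ ^ 2)) / 2)).add
      (((((i.const_mul ((u * Real.cos ψ) ^ 2)).add ((i.pow 2).const_mul
        (u * Real.cos ψ * halfChord τ ψ))).add (((i.pow 3).div_const 3).const_mul
        (halfChord τ ψ ^ 2))).const_mul (halfChord τ ψ ^ 2)).div_const 2)).congr_deriv ?_
    rw [densityBound, chordCoord]
    simp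
    ring
  have hc : Continuous fun σ => densityBound u τ ψ σ := by
    unfold densityBound chordCoord
    fun_prop
  rw [intervalIntegral.integral_eq_sub_of_hasDerivAt hd (hc.intervalIntegrable _ _)]
  rw [areaBound]
  linear_combination (-halfChord τ ψ ^ 2) * h2

/-- The integrand is the derivative of the lifted angle, which rises from `arccos 1` to `arccos
(-1)` for every `τ > 0`. The contribution of the turning therefore stays bounded as `τ → 0`. -/
theorem integral_liftAngle_deriv (hu : u ^ 2 + τ ^ 2 = 1) (hτ : 0 < τ) :
    ∫ ψ in (0 : ℝ)..Real.pi, τ / halfChord τ ψ ^ 2 = Real.pi := by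
  have hc : Continuous fun ψ => τ / halfChord τ ψ ^ 2 :=
    continuous_const.div ((continuous_halfChord τ).pow 2)
      fun ψ => (pow_pos (halfChord_pos_of_pos hτ ψ) 2).ne'
  have hl : Continuous (liftAngle τ) :=
    Real.continuous_arccos.comp (Real.continuous_cos.div (continuous_halfChord τ)
      fun ψ => (halfChord_pos_of_pos hτ ψ).ne')
  rw [intervalIntegral.integral_eq_sub_of_hasDerivAt_of_le Real.pi_pos.le hl.continuousOn
    (fun x hx => liftAngle_hasDerivAt_of_pos hu hτ hx) (hc.intervalIntegrable _ _)]
  simp [liftAngle, halfChord]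

theorem integral_area_bound (hu : u ^ 2 + τ ^ 2 = 1) (hτ : 0 < τ) :
    ∫ ψ in (0 : ℝ)..Real.pi, (areaBound τ ψ) =
    Real.pi * (3 / 2 - τ ^ 2 / 6 + 16 / 25 * τ) := by
  have hc : Continuous fun ψ => τ / halfChord τ ψ ^ 2 :=
    continuous_const.div ((continuous_halfChord τ).pow 2)
      fun ψ => (pow_pos (halfChord_pos_of_pos hτ ψ) 2).ne'
  have h2 : ∫ ψ in (0 : ℝ)..Real.pi, Real.sin ψ ^ 2 = Real.pi / 2 := by
    rw [integral_sin_sq]; simp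
  have h4 : ∫ ψ in (0 : ℝ)..Real.pi, Real.sin ψ ^ 4 = Real.pi * (3 / 8) := by
    have := integral_sin_pow_even 2
    norm_num [Finset.prod_range_succ] at this
    exact this
  have e : ∀ ψ, areaBound τ ψ = (1 + 4 / 3 - τ ^ 2) +
        (-(8 / 3) * u ^ 2 + τ ^ 2 * u ^ 2) * Real.sin ψ ^ 2 + 4 / 3 * u ^ 4 * Real.sin ψ ^ 4 +
        16 / 25 * τ * (τ / halfChord τ ψ ^ 2) := by
    intro ψ
    have h := halfChord_sq_eq hu ψ
    rw [areaBound, add_left_inj, h]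
    ring
  simp_rw [e]
  have i2 : IntervalIntegrable (fun ψ : ℝ => (-(8 / 3) * u ^ 2 + τ ^ 2 * u ^ 2) * Real.sin ψ ^ 2)
      volume 0 Real.pi := Continuous.intervalIntegrable (by fun_prop) _ _
  have i4 : IntervalIntegrable (fun ψ : ℝ => 4 / 3 * u ^ 4 * Real.sin ψ ^ 4)
      volume 0 Real.pi := Continuous.intervalIntegrable (by fun_prop) _ _
  have i0 : IntervalIntegrable (fun _ : ℝ => 1 + 4 / 3 - τ ^ 2) volume 0 Real.pi :=
    Continuous.intervalIntegrable (by fun_prop) _ _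
  have ic : IntervalIntegrable (fun ψ : ℝ => 16 / 25 * τ * (τ / halfChord τ ψ ^ 2))
      volume 0 Real.pi := (hc.const_smul (16 / 25 * τ)).intervalIntegrable _ _
  rw [intervalIntegral.integral_add ((i0.add i2).add i4) ic,
    intervalIntegral.integral_add (i0.add i2) i4, intervalIntegral.integral_add i0 i2,
    intervalIntegral.integral_const_mul, intervalIntegral.integral_const_mul,
    intervalIntegral.integral_const_mul, intervalIntegral.integral_const, h2, h4,
    integral_liftAngle_deriv hu hτ]
  have hu2 : u ^ 2 = 1 - τ ^ 2 := by linarith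
  have hu4 : u ^ 4 = (1 - τ ^ 2) ^ 2 := by rw [← hu2]; ring
  rw [hu4, hu2, smul_eq_mul]
  ring

theorem area_ribbon_lt (hρ : 2 < ρ) (hn : 5 * (ρ + 1) / 2 ≤ n) (hu : u ^ 2 + τ ^ 2 = 1)
    (hτ : 0 < τ) : area (ribbon ρ n u τ) < ENNReal.ofReal (2 * n * Real.pi) := by
  have hn0 : (0 : ℝ) < n := by linarith
  have hn' : n ≠ 0 := by exact_mod_cast hn0.ne'
  have hh := fun ψ => halfChord_pos_of_pos hτ ψ
  have hhc := continuous_halfChord τ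
  have hB : Continuous fun p : ℝ × ℝ => densityBound u τ p.1 p.2 := by
    have h1 : Continuous fun p : ℝ × ℝ => halfChord τ p.1 := hhc.comp continuous_fst
    have h2 : Continuous fun p : ℝ × ℝ => τ ^ 2 / halfChord τ p.1 ^ 2 :=
      continuous_const.div (h1.pow 2) fun p => (pow_pos (hh p.1) 2).ne'
    unfold densityBound chordCoord
    fun_prop
  have hG : Continuous fun ψ => areaBound τ ψ := by
    have h2 : Continuous fun ψ => τ / halfChord τ ψ ^ 2 :=
      continuous_const.div (hhc.pow 2) fun ψ => (pow_pos (hh ψ) 2).ne'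
    unfold areaBound
    fun_prop
  have hG' : ∀ ψ, ∫⁻ σ in Ioo (-1) 1, ENNReal.ofReal (densityBound u τ ψ σ) =
      ENNReal.ofReal (areaBound τ ψ) := by
    intro ψ
    rw [← integral_density_bound u τ ψ hu]
    have hc : Continuous fun σ => densityBound u τ ψ σ := by
      unfold densityBound chordCoord; fun_prop
    exact lintegral_ofReal_Ioo (f := fun σ => densityBound u τ ψ σ) (by norm_num) hc
      fun x _ => densityBound_nonneg u τ ψ x
  have hG0 : ∀ ψ, 0 ≤ areaBound τ ψ := by
    intro ψ
    rw [← integral_density_bound u τ ψ hu]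
    exact intervalIntegral.integral_nonneg (by norm_num) fun x _ => densityBound_nonneg u τ ψ x
  have key : ∫⁻ q in sheetDomain, ENNReal.ofReal (sheetDensity ρ n u τ (q 0) (q 1)) ≤
      ENNReal.ofReal (Real.pi * (3 / 2 - τ ^ 2 / 6 + 16 / 25 * τ)) := by
    refine (setLIntegral_mono' isOpen_sheetDomain.measurableSet fun q hq =>
      ENNReal.ofReal_le_ofReal (sheetDensity_le hρ hn hu (hh _)
        (Ioo_subset_Icc_self hq.2.2))).trans ?_
    rw [lintegral_sheetDomain (f := fun ψ σ => ENNReal.ofReal (densityBound u τ ψ σ))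
      (ENNReal.measurable_ofReal.comp hB.measurable)]
    simp_rw [hG']
    rw [lintegral_ofReal_Ioo Real.pi_pos.le hG fun x _ => hG0 x, integral_area_bound hu hτ]
  rw [area_ribbon hρ hn' hu hτ.le]
  have hτ1 : τ ≤ 1 := by nlinarith [sq_nonneg u]
  -- The factor increases with `τ` on `[0, 1]` and equals `148/75 < 2` at `τ = 1`.
  have hlt : Real.pi * (3 / 2 - τ ^ 2 / 6 + 16 / 25 * τ) < 2 * Real.pi := by
    rw [mul_comm 2]
    exact mul_lt_mul_of_pos_left (by nlinarith) Real.pi_pos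
  calc (n : ℝ≥0∞) * _ ≤ n * ENNReal.ofReal (Real.pi * (3 / 2 - τ ^ 2 / 6 + 16 / 25 * τ)) := by
        gcongr
    _ < n * ENNReal.ofReal (2 * Real.pi) := by
        refine ENNReal.mul_lt_mul_right (by exact_mod_cast hn') (ENNReal.natCast_ne_top n) ?_
        exact (ENNReal.ofReal_lt_ofReal_iff (by positivity)).2 hlt
    _ = ENNReal.ofReal (2 * n * Real.pi) := by
        rw [← ENNReal.ofReal_natCast, ← ENNReal.ofReal_mul (by positivity)]
        congr 1; ring

/-- With the sign `ε = u cos ψ / |cos ψ|` one has `s = |cos ψ| (ε + σ)`, and `|ε + σ| = 1 + εσ`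
because `|σ| < 1`. -/
theorem sheetDensity_zero (ρ : ℝ) (n : ℕ) (hu : u ^ 2 = 1) (hc : Real.cos ψ ≠ 0)
    (hσ : σ ∈ Ioo (-1) 1) :
    sheetDensity ρ n u 0 ψ σ = Real.cos ψ ^ 2 * (1 + u * (Real.cos ψ / |Real.cos ψ|) * σ) := by
  have e : halfChord 0 ψ = |Real.cos ψ| := by simp [halfChord, Real.sqrt_sq_eq_abs]
  have hc' : 0 < |Real.cos ψ| := abs_pos.2 hc
  set ε := u * (Real.cos ψ / |Real.cos ψ|) with hε
  have hε2 : ε ^ 2 = 1 := by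
    rw [hε, mul_pow, div_pow, sq_abs, hu, one_mul, div_self (pow_ne_zero 2 hc)]
  have hs : chordCoord u 0 ψ σ = |Real.cos ψ| * (ε + σ) := by
    rw [chordCoord, e, hε]
    field_simp
  have hεσ : |ε * σ| < 1 := by
    rw [← sq_lt_one_iff_abs_lt_one, mul_pow, hε2, one_mul, sq_lt_one_iff_abs_lt_one]
    exact abs_lt.2 hσ
  have h1 : |ε + σ| = 1 + ε * σ := by
    rw [← abs_of_pos (show 0 < 1 + ε * σ by linarith [(abs_lt.1 hεσ).1]), ← sq_eq_sq_iff_abs_eq_abs]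
    linear_combination (1 - σ ^ 2) * hε2
  rw [sheetDensity, angularSpeed, zero_div, mul_zero, mul_zero, zero_pow two_ne_zero, add_zero,
    Real.sqrt_sq_eq_abs, hs, e, abs_mul, abs_abs, h1, ← mul_assoc, ← sq, sq_abs]

/-- A sheet is half of one meridian disc together with the opposite half of the next. The part odd
in `σ` integrates to zero, which leaves the integral of `2 cos² ψ`, namely `π`, for each sheet. -/
theorem area_ribbon_zero (hρ : 2 < ρ) (hn : n ≠ 0) (hu : u ^ 2 = 1) :
    area (ribbon ρ n u 0) = ENNReal.ofReal (n * Real.pi) := by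
  have hm : Measurable (Function.uncurry fun ψ σ : ℝ =>
      ENNReal.ofReal (Real.cos ψ ^ 2 * (1 + u * (Real.cos ψ / |Real.cos ψ|) * σ))) := by
    refine ENNReal.measurable_ofReal.comp ?_
    fun_prop
  have hin : ∀ ψ, ∫⁻ σ in Ioo (-1) 1,
      ENNReal.ofReal (Real.cos ψ ^ 2 * (1 + u * (Real.cos ψ / |Real.cos ψ|) * σ)) =
      ENNReal.ofReal (2 * Real.cos ψ ^ 2) := by
    intro ψ
    set ε := u * (Real.cos ψ / |Real.cos ψ|) with hε
    -- Only an inequality, because `ε = 0` at `cos ψ = 0` by the convention for division by zero.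
    have hε2 : ε ^ 2 ≤ 1 := by
      rw [hε, mul_pow, div_pow, sq_abs, hu, one_mul]
      exact div_self_le_one _
    rw [lintegral_ofReal_Ioo (by norm_num) (by fun_prop)]
    · congr 1
      rw [intervalIntegral.integral_const_mul, intervalIntegral.integral_add
        (Continuous.intervalIntegrable (by fun_prop) _ _)
        (Continuous.intervalIntegrable (by fun_prop) _ _), intervalIntegral.integral_const_mul,
        integral_id, intervalIntegral.integral_const, smul_eq_mul]
      ring
    · intro σ hσ
      refine mul_nonneg (sq_nonneg _) ?_
      have h1 : |ε * σ| ≤ 1 := by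
        rw [← sq_le_one_iff_abs_le_one, mul_pow]
        exact mul_le_one₀ hε2 (sq_nonneg _) (sq_le_one_of_mem (Ioo_subset_Icc_self hσ))
      linarith [(abs_le.1 h1).1]
  rw [area_ribbon hρ hn (by simpa using hu) le_rfl]
  have key : ∫⁻ q in sheetDomain, ENNReal.ofReal (sheetDensity ρ n u 0 (q 0) (q 1)) =
      ENNReal.ofReal Real.pi := by
    rw [setLIntegral_congr_fun isOpen_sheetDomain.measurableSet (fun q hq => by
      rw [sheetDensity_zero ρ n hu hq.2.1 hq.2.2]), lintegral_sheetDomain hm]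
    simp_rw [hin]
    rw [lintegral_ofReal_Ioo Real.pi_pos.le (by fun_prop) fun x _ => by positivity,
      intervalIntegral.integral_const_mul, integral_cos_sq]
    congr 1
    simp
    ring
  rw [key, ← ENNReal.ofReal_natCast, ← ENNReal.ofReal_mul (by positivity)]

end

/-! ### Continuity in the sense of varifolds -/

/-- The projection written as an explicit function of the normal, continuous wherever the normal is
not zero. -/
theorem starProjection_orthogonal_span_eq (N : E3) :
    (ℝ ∙ N)ᗮ.starProjection =
      ContinuousLinearMap.id ℝ E3 - (‖N‖ ^ 2)⁻¹ • (innerSL ℝ N).smulRight N := by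
  rw [Submodule.starProjection_orthogonal']
  congr 1
  ext1 w
  rw [Submodule.starProjection_singleton]
  simp [div_eq_inv_mul, smul_smul]

theorem continuousOn_starProjection_orthogonal_span :
    ContinuousOn (fun N : E3 => (ℝ ∙ N)ᗮ.starProjection) {0}ᶜ := by
  simp_rw [starProjection_orthogonal_span_eq]
  refine continuousOn_const.sub (ContinuousOn.fun_smul ?_ ?_)
  · exact ContinuousOn.inv₀ (by fun_prop) fun N hN => pow_ne_zero 2 (norm_ne_zero_iff.2 hN)
  · have : Continuous fun N : E3 => (innerSL ℝ N).smulRight N := by fun_prop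
    exact this.continuousOn

theorem norm_le_of_mem_toroid {ρ : ℝ} (hρ : 2 < ρ) {x : E3} (hx : x ∈ toroid ρ) :
    ‖x‖ ≤ ρ + 2 := by
  obtain ⟨φ, r, z, hr, rfl⟩ := exists_cyl_of_mem_toroid hρ hx
  rw [cyl_mem_toroid hr.le] at hx
  refine abs_le_of_sq_le_sq' ?_ (by linarith) |>.2
  rw [← real_inner_self_eq_norm_sq, inner_cyl, sub_self, Real.cos_zero]
  have h1 : (r - ρ) ^ 2 ≤ 1 := by nlinarith [sq_nonneg z]
  have h2 := (abs_le.1 ((sq_le_one_iff_abs_le_one _).1 h1)).2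
  nlinarith [sq_nonneg (r - ρ)]

theorem isBounded_toroid {ρ : ℝ} (hρ : 2 < ρ) : Bornology.IsBounded (toroid ρ) :=
  (Metric.isBounded_closedBall (x := (0 : E3)) (r := ρ + 2)).subset fun x hx => by
    simpa using norm_le_of_mem_toroid hρ hx

theorem isCompact_toroid {ρ : ℝ} (hρ : 2 < ρ) : IsCompact (toroid ρ) :=
  Metric.isCompact_of_isClosed_isBounded (isClosed_toroid ρ) (isBounded_toroid hρ)

/-- The weighted test function on the `j`-th sheet at time `t`. -/
def sheetIntegrand (ρ : ℝ) (n : ℕ) (φ : C(E3 × (E3 →L[ℝ] E3), ℝ)) (j : ℕ) (t : ℝ) (q : E2) : ℝ :=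
  sheetDensity ρ n (Real.cos (Real.pi * t)) (Real.sin (Real.pi * t)) (q 0) (q 1) *
    φ (sheet ρ n (Real.cos (Real.pi * t)) (Real.sin (Real.pi * t)) j q,
      (ℝ ∙ sheetNormal ρ n (Real.cos (Real.pi * t)) (Real.sin (Real.pi * t)) j (q 0)
        (q 1))ᗮ.starProjection)

section

variable {ρ : ℝ} {n : ℕ}

theorem sheetNormal_ne_zero {u τ : ℝ} (hρ : 2 < ρ) (hn : n ≠ 0) (hu : u ^ 2 + τ ^ 2 = 1) (j : ℕ)
    {q : E2} (hq : q ∈ sheetDomain) : sheetNormal ρ n u τ j (q 0) (q 1) ≠ 0 := by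
  intro h
  have h1 := inner_sheetNormal_self ρ n u τ j (q 0) (q 1)
  rw [h, inner_zero_left] at h1
  exact (sheet_regular (n := n) hρ hn hu hq.2.1 hq.2.2).ne h1

/-- Continuity holds up to the end times: on the domain `cos ψ ≠ 0`, so `h` stays positive even at
`τ = 0`, and the normal never vanishes there. -/
theorem continuousOn_sheetIntegrand (hρ : 2 < ρ) (hn : n ≠ 0)
    (φ : C(E3 × (E3 →L[ℝ] E3), ℝ)) (j : ℕ) :
    ContinuousOn (fun p : ℝ × E2 => sheetIntegrand ρ n φ j p.1 p.2) (univ ×ˢ sheetDomain) := by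
  have cu : Continuous fun p : ℝ × E2 => Real.cos (Real.pi * p.1) := by fun_prop
  have cτ : Continuous fun p : ℝ × E2 => Real.sin (Real.pi * p.1) := by fun_prop
  have cψ : Continuous fun p : ℝ × E2 => p.2 0 := by fun_prop
  have cσ : Continuous fun p : ℝ × E2 => p.2 1 := by fun_prop
  have ch : Continuous fun p : ℝ × E2 => halfChord (Real.sin (Real.pi * p.1)) (p.2 0) := by
    unfold halfChord; fun_prop
  have hh : ∀ p ∈ (univ : Set ℝ) ×ˢ sheetDomain,
      halfChord (Real.sin (Real.pi * p.1)) (p.2 0) ≠ 0 := fun p hp =>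
    (halfChord_pos hp.2.2.1).ne'
  have cs : Continuous fun p : ℝ × E2 =>
      chordCoord (Real.cos (Real.pi * p.1)) (Real.sin (Real.pi * p.1)) (p.2 0) (p.2 1) :=
    (cu.mul (Real.continuous_cos.comp cψ)).add (ch.mul cσ)
  have cφ : ContinuousOn (fun p : ℝ × E2 => sheetAngle n (Real.sin (Real.pi * p.1)) j (p.2 0))
      (univ ×ˢ sheetDomain) :=
    (continuousOn_const.mul ((Real.continuous_arccos.comp_continuousOn
      ((Real.continuous_cos.comp cψ).continuousOn.div ch.continuousOn hh)).add
        continuousOn_const)).div_const _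
  have cR : Continuous fun p : ℝ × E2 => ρ - Real.cos (Real.pi * p.1) +
      chordCoord (Real.cos (Real.pi * p.1)) (Real.sin (Real.pi * p.1)) (p.2 0) (p.2 1) *
        Real.cos (p.2 0) := (continuous_const.sub cu).add (cs.mul (Real.continuous_cos.comp cψ))
  have cA : ContinuousOn (fun p : ℝ × E2 => angularSpeed ρ n (Real.cos (Real.pi * p.1))
      (Real.sin (Real.pi * p.1)) (p.2 0) (p.2 1)) (univ ×ˢ sheetDomain) :=
    cR.continuousOn.mul (continuousOn_const.mul (cτ.continuousOn.div (ch.pow 2).continuousOn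
      fun p hp => pow_ne_zero 2 (hh p hp)))
  have cyl_comp : ∀ {f g h : ℝ × E2 → ℝ}, ContinuousOn f (univ ×ˢ sheetDomain) →
      ContinuousOn g (univ ×ˢ sheetDomain) → ContinuousOn h (univ ×ˢ sheetDomain) →
      ContinuousOn (fun p => cyl (f p) (g p) (h p)) (univ ×ˢ sheetDomain) := fun hf hg hh' =>
    contDiff_cyl.continuous.comp_continuousOn (hf.prodMk (hg.prodMk hh'))
  have csin := (Real.continuous_sin.comp cψ).continuousOn (s := univ ×ˢ sheetDomain)
  have ccos := (Real.continuous_cos.comp cψ).continuousOn (s := univ ×ˢ sheetDomain)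
  have cN : ContinuousOn (fun p : ℝ × E2 => sheetNormal ρ n (Real.cos (Real.pi * p.1))
      (Real.sin (Real.pi * p.1)) j (p.2 0) (p.2 1)) (univ ×ˢ sheetDomain) :=
    (cyl_comp (cφ.add continuousOn_const) cs.continuousOn continuousOn_const).add
      (cyl_comp cφ (cA.mul csin) (cA.mul ccos).neg)
  refine ContinuousOn.mul ?_ (φ.continuous.comp_continuousOn (ContinuousOn.prodMk ?_ ?_))
  · exact ch.continuousOn.mul (((cs.pow 2).continuousOn.add (cA.pow 2)).sqrt)
  · exact cyl_comp cφ cR.continuousOn (cs.continuousOn.mul csin)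
  · exact continuousOn_starProjection_orthogonal_span.comp cN fun p hp =>
      sheetNormal_ne_zero hρ hn (Real.cos_sq_add_sin_sq _) j hp.2

theorem exists_bound_sheetIntegrand (hρ : 2 < ρ) (hn : 5 * (ρ + 1) / 2 ≤ n)
    (φ : C(E3 × (E3 →L[ℝ] E3), ℝ)) (j : ℕ) :
    ∃ C, ∀ t ∈ Icc (0 : ℝ) 1, ∀ q ∈ sheetDomain, ‖sheetIntegrand ρ n φ j t q‖ ≤ C := by
  have hn' : n ≠ 0 := by
    rintro rfl
    norm_num at hn
    linarith
  obtain ⟨C, hC⟩ := ((isCompact_toroid hρ).prod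
    (isCompact_closedBall (0 : E3 →L[ℝ] E3) 1)).exists_bound_of_continuousOn φ.continuous.continuousOn
  refine ⟨3 * C, fun t ht q hq => ?_⟩
  have hu := Real.cos_sq_add_sin_sq (Real.pi * t)
  have hτ := sin_pi_nonneg ht
  have hh := halfChord_pos (τ := Real.sin (Real.pi * t)) hq.2.1
  rw [sheetIntegrand, norm_mul, Real.norm_of_nonneg sheetDensity_nonneg]
  refine mul_le_mul (sheetDensity_le_three hρ hn hu hτ hh (Ioo_subset_Icc_self hq.2.2))
    (hC _ ⟨?_, ?_⟩) (norm_nonneg _) (by norm_num)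
  · exact ribbon_subset _ _ _ _ (sheetPoint_mem hρ hn' hu hτ (Ioo_subset_Icc_self hq.1) hh
      (Ioo_subset_Icc_self hq.2.2) j)
  · rw [mem_closedBall_zero_iff]
    exact Submodule.starProjection_norm_le _

theorem varifoldIntegrand_sheet (hρ : 2 < ρ) (hn : n ≠ 0) (φ : C(E3 × (E3 →L[ℝ] E3), ℝ)) (j : ℕ)
    {t : ℝ} (ht : t ∈ Icc (0 : ℝ) 1) {q : E2} (hq : q ∈ sheetDomain) :
    sheetDensity ρ n (Real.cos (Real.pi * t)) (Real.sin (Real.pi * t)) (q 0) (q 1) *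
      varifoldIntegrand (sweep ρ n t) φ
        (sheet ρ n (Real.cos (Real.pi * t)) (Real.sin (Real.pi * t)) j q) =
      sheetIntegrand ρ n φ j t q := by
  have h := tangentSpace_ribbon_sheetPoint hρ hn (Real.cos_sq_add_sin_sq (Real.pi * t))
    (sin_pi_nonneg ht) hq.1 hq.2.1 hq.2.2 j
  simp only [varifoldIntegrand, sweep, sheet, sheetIntegrand, h]

/-- All surfaces are parametrised over the same domain of finite volume, so the integrals are finite
sums of parameter integrals with a constant majorant. -/
theorem isVarifoldContinuous_sweep (hρ : 2 < ρ) (hn : 5 * (ρ + 1) / 2 ≤ n) :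
    IsVarifoldContinuous (sweep ρ n) := by
  have hn' : n ≠ 0 := by
    rintro rfl
    norm_num at hn
    linarith
  intro φ
  have hmeas : ∀ j t, AEStronglyMeasurable (sheetIntegrand ρ n φ j t)
      (volume.restrict sheetDomain) := fun j t =>
    ContinuousOn.aestronglyMeasurable ((continuousOn_sheetIntegrand hρ hn' φ j).comp
      (f := fun q => (t, q)) (by fun_prop) fun q hq => ⟨mem_univ _, hq⟩)
      isOpen_sheetDomain.measurableSet
  have hbound : ∀ j, ∃ C, ∀ t ∈ Icc (0 : ℝ) 1, ∀ᵐ q ∂volume.restrict sheetDomain,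
      ‖sheetIntegrand ρ n φ j t q‖ ≤ C := fun j => by
    obtain ⟨C, hC⟩ := exists_bound_sheetIntegrand hρ hn φ j
    exact ⟨C, fun t ht => (ae_restrict_iff' isOpen_sheetDomain.measurableSet).2
      (Eventually.of_forall fun q hq => hC t ht q hq)⟩
  have hconst : ∀ C : ℝ, IntegrableOn (fun _ : E2 => C) sheetDomain := fun C =>
    integrableOn_const volume_sheetDomain_lt_top.ne
  have hint : ∀ t ∈ Icc (0 : ℝ) 1, IntegrableOn (varifoldIntegrand (sweep ρ n t) φ)
      (sweep ρ n t) area := by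
    intro t ht
    refine (integrableOn_ribbon_iff hρ hn' (Real.cos_sq_add_sin_sq _) (sin_pi_nonneg ht) _).2
      fun j _ => ?_
    refine (integrableOn_congr_fun (fun q hq => varifoldIntegrand_sheet hρ hn' φ j ht hq)
      isOpen_sheetDomain.measurableSet).2 ?_
    obtain ⟨C, hC⟩ := hbound j
    exact (hconst C).mono' (hmeas j t) (hC t ht)
  refine ⟨hint, ?_⟩
  have hsum : ContinuousOn (fun t => ∑ j ∈ Finset.range n, ∫ q in sheetDomain,
      sheetIntegrand ρ n φ j t q) (Icc 0 1) := by
    refine continuousOn_finsetSum _ fun j _ => ?_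
    obtain ⟨C, hC⟩ := hbound j
    refine continuousOn_of_dominated (fun t _ => hmeas j t) hC (hconst C) ?_
    refine (ae_restrict_iff' isOpen_sheetDomain.measurableSet).2
      (Eventually.of_forall fun q hq => ?_)
    exact (continuousOn_sheetIntegrand hρ hn' φ j).comp (f := fun t => (t, q)) (by fun_prop)
      fun t _ => ⟨mem_univ _, hq⟩
  refine hsum.congr fun t ht => ?_
  refine (setIntegral_ribbon hρ hn' (Real.cos_sq_add_sin_sq _) (sin_pi_nonneg ht)
    (hint t ht)).trans (Finset.sum_congr rfl fun j _ => ?_)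
  exact setIntegral_congr_fun isOpen_sheetDomain.measurableSet
    fun q hq => varifoldIntegrand_sheet hρ hn' φ j ht hq

theorem area_sweep_lt (hρ : 2 < ρ) (hn : 5 * (ρ + 1) / 2 ≤ n) {t : ℝ} (ht : t ∈ Icc (0 : ℝ) 1) :
    area (sweep ρ n t) < ENNReal.ofReal (2 * n * Real.pi) := by
  have hu := Real.cos_sq_add_sin_sq (Real.pi * t)
  have hn0 : (0 : ℝ) < n := by linarith
  rcases (sin_pi_nonneg ht).eq_or_lt with h | h
  · rw [sweep, ← h, area_ribbon_zero hρ (by exact_mod_cast hn0.ne') (by rw [← h] at hu; simpa using hu)]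
    refine (ENNReal.ofReal_lt_ofReal_iff (by positivity)).2 ?_
    have : 0 < n * Real.pi := by positivity
    linarith
  · exact area_ribbon_lt hρ hn hu h

/-- A set of finite two-dimensional measure is null for the three-dimensional one. -/
theorem volume_sweep (hρ : 2 < ρ) (hn : 5 * (ρ + 1) / 2 ≤ n) {t : ℝ} (ht : t ∈ Icc (0 : ℝ) 1) :
    volume (sweep ρ n t) = 0 := by
  have h := (area_sweep_lt hρ hn ht).trans ENNReal.ofReal_lt_top
  rw [← EuclideanSpace.euclideanHausdorffMeasure_eq_volume]
  exact (Measure.euclideanHausdorffMeasure_zero_or_top (show 2 < 3 by norm_num) _).resolve_right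
    h.ne

end

/-! ### Sectors -/

section

variable {ρ : ℝ} {n : ℕ}

theorem mem_sector (hρ : 2 < ρ) {x : E3} : x ∈ sector ρ (1 / n) ↔
    ∃ φ ∈ Icc 0 (2 * Real.pi / n), ∃ r z, 0 < r ∧ (r - ρ) ^ 2 + z ^ 2 ≤ 1 ∧ x = cyl φ r z := by
  constructor
  · rintro ⟨y₁, y₂, φ, hy, h0, h1, rfl⟩
    have h2 : y₁ ^ 2 ≤ 1 := by nlinarith [sq_nonneg y₂]
    have h3 := (abs_le.1 ((sq_le_one_iff_abs_le_one _).1 h2)).1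
    exact ⟨φ, ⟨h0, by rwa [mul_one_div] at h1⟩, ρ + y₁, y₂, by linarith, by simpa using hy, rfl⟩
  · rintro ⟨φ, hφ, r, z, hr, hy, rfl⟩
    refine ⟨r - ρ, z, φ, hy, hφ.1, by rw [mul_one_div]; exact hφ.2, ?_⟩
    rw [add_sub_cancel, cyl]

theorem sector_subset_toroid (hρ : 2 < ρ) : sector ρ (1 / n) ⊆ toroid ρ := by
  intro x hx
  obtain ⟨φ, -, r, z, hr, hy, rfl⟩ := (mem_sector hρ).1 hx
  exact (cyl_mem_toroid hr.le).2 hy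

theorem two_pi_div_lt (hn : 8 ≤ n) : 2 * Real.pi / n < Real.pi / 2 := by
  have : (8 : ℝ) ≤ n := by exact_mod_cast hn
  rw [div_lt_iff₀ (by linarith)]
  nlinarith [Real.pi_pos]

theorem mem_Ioo_of_mem_sectorAngle (hn : 8 ≤ n) {φ : ℝ} (hφ : φ ∈ Icc 0 (2 * Real.pi / n)) :
    φ - 0 ∈ Ioo (-(Real.pi / 2)) (Real.pi / 2) := by
  have := two_pi_div_lt hn
  constructor <;> linarith [hφ.1, hφ.2, Real.pi_pos]

/-- One branch of the toroidal angle serves the whole sector, so a single local profile defines the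
regions. -/
theorem sector_subset_halfSpace (hρ : 2 < ρ) (hn : 8 ≤ n) : sector ρ (1 / n) ⊆ halfSpace 0 := by
  intro x hx
  obtain ⟨φ, hφ, r, z, hr, hy, rfl⟩ := (mem_sector hρ).1 hx
  rw [cyl_mem_halfSpace]
  exact mul_pos hr (Real.cos_pos_of_mem_Ioo (mem_Ioo_of_mem_sectorAngle hn hφ))

theorem isClosed_sector (hρ : 2 < ρ) : IsClosed (sector ρ (1 / n)) := by
  have hK : IsCompact (Icc 0 (2 * Real.pi / n) ×ˢ {y : ℝ × ℝ | (y.1 - ρ) ^ 2 + y.2 ^ 2 ≤ 1}) := by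
    refine isCompact_Icc.prod (IsCompact.of_isClosed_subset
      ((isCompact_Icc (a := ρ - 1) (b := ρ + 1)).prod (isCompact_Icc (a := (-1 : ℝ)) (b := 1)))
      (isClosed_le (by fun_prop) continuous_const) fun y hy => ?_)
    have h1 := abs_le.1 ((sq_le_one_iff_abs_le_one (y.1 - ρ)).1
      (by nlinarith [sq_nonneg y.2, mem_ofPred_eq ▸ hy]))
    have h2 := abs_le.1 ((sq_le_one_iff_abs_le_one y.2).1
      (by nlinarith [sq_nonneg (y.1 - ρ), mem_ofPred_eq ▸ hy]))
    exact ⟨⟨by linarith [h1.1], by linarith [h1.2]⟩, h2⟩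
  have e : sector ρ (1 / n) = (fun q : ℝ × ℝ × ℝ => cyl q.1 q.2.1 q.2.2) ''
      (Icc 0 (2 * Real.pi / n) ×ˢ {y : ℝ × ℝ | (y.1 - ρ) ^ 2 + y.2 ^ 2 ≤ 1}) := ?_
  · rw [e]
    exact (hK.image contDiff_cyl.continuous).isClosed
  ext x
  rw [mem_sector hρ]
  constructor
  · rintro ⟨φ, hφ, r, z, -, hy, rfl⟩
    exact ⟨(φ, r, z), ⟨hφ, hy⟩, rfl⟩
  · rintro ⟨⟨φ, r, z⟩, ⟨hφ, hy⟩, rfl⟩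
    have h1 : (r - ρ) ^ 2 + z ^ 2 ≤ 1 := hy
    have h2 := abs_le.1 ((sq_le_one_iff_abs_le_one (r - ρ)).1 (by nlinarith [sq_nonneg z]))
    exact ⟨φ, hφ, r, z, by linarith [h2.1], hy, rfl⟩

theorem isBounded_sector (hρ : 2 < ρ) : Bornology.IsBounded (sector ρ (1 / n)) :=
  (isBounded_toroid hρ).subset (sector_subset_toroid hρ)

/-- Parametrised pieces whose union contains the boundary of the sector. -/
def sectorFace (ρ : ℝ) (n : ℕ) : Fin 3 → ℝ × ℝ → E3
  | 0, q => cyl 0 (ρ + (2 * q.1 - 1)) (2 * q.2 - 1)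
  | 1, q => cyl (2 * Real.pi / n) (ρ + (2 * q.1 - 1)) (2 * q.2 - 1)
  | 2, q => cyl (2 * Real.pi / n * q.1) (ρ + Real.cos (2 * Real.pi * q.2))
      (Real.sin (2 * Real.pi * q.2))

theorem contDiff_sectorFace (ρ : ℝ) (n : ℕ) (i : Fin 3) : ContDiff ℝ 1 (sectorFace ρ n i) := by
  have hc : ContDiff ℝ 1 fun q : ℝ × ℝ × ℝ => cyl q.1 q.2.1 q.2.2 := contDiff_cyl.of_le (by simp)
  fin_cases i
  · exact hc.comp (f := fun q : ℝ × ℝ => (0, ρ + (2 * q.1 - 1), 2 * q.2 - 1)) (by fun_prop)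
  · exact hc.comp (f := fun q : ℝ × ℝ => (2 * Real.pi / n, ρ + (2 * q.1 - 1), 2 * q.2 - 1))
      (by fun_prop)
  · exact hc.comp (f := fun q : ℝ × ℝ => (2 * Real.pi / n * q.1, ρ + Real.cos (2 * Real.pi * q.2),
      Real.sin (2 * Real.pi * q.2))) (by fun_prop)

theorem exists_unit_eq {y : ℝ} (h : y ^ 2 ≤ 1) : ∃ a ∈ Icc (0 : ℝ) 1, 2 * a - 1 = y := by
  have := abs_le.1 ((sq_le_one_iff_abs_le_one y).1 h)
  exact ⟨(y + 1) / 2, ⟨by linarith [this.1], by linarith [this.2]⟩, by ring⟩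

theorem exists_angle_eq {y z : ℝ} (h : y ^ 2 + z ^ 2 = 1) :
    ∃ b ∈ Icc (0 : ℝ) 1, Real.cos (2 * Real.pi * b) = y ∧ Real.sin (2 * Real.pi * b) = z := by
  have hnorm : ‖(⟨y, z⟩ : ℂ)‖ = 1 := by
    rw [Complex.norm_def, Complex.normSq_mk, ← sq, ← sq, h, Real.sqrt_one]
  have e1 := Complex.norm_mul_cos_arg ⟨y, z⟩
  have e2 := Complex.norm_mul_sin_arg ⟨y, z⟩
  rw [hnorm, one_mul] at e1 e2
  change _ = y at e1
  change _ = z at e2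
  have hpi := Real.two_pi_pos
  have hm := toIcoMod_mem_Ico hpi 0 (Complex.arg ⟨y, z⟩)
  rw [zero_add] at hm
  have hk := toIcoMod_add_toIcoDiv_zsmul hpi 0 (Complex.arg ⟨y, z⟩)
  set a := toIcoMod hpi 0 (Complex.arg ⟨y, z⟩)
  refine ⟨a / (2 * Real.pi), ⟨div_nonneg hm.1 hpi.le, (div_le_one hpi).2 hm.2.le⟩, ?_, ?_⟩
  · rw [mul_div_cancel₀ _ hpi.ne', ← e1, ← hk, zsmul_eq_mul, Real.cos_add_int_mul_two_pi]
  · rw [mul_div_cancel₀ _ hpi.ne', ← e2, ← hk, zsmul_eq_mul, Real.sin_add_int_mul_two_pi]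

theorem mem_interior_sector (hρ : 2 < ρ) (hn : 8 ≤ n) {φ r z : ℝ} (hφ : φ ∈ Ioo 0 (2 * Real.pi / n))
    (hr : 0 < r) (hy : (r - ρ) ^ 2 + z ^ 2 < 1) : cyl φ r z ∈ interior (sector ρ (1 / n)) := by
  have hm := mem_Ioo_of_mem_sectorAngle hn (Ioo_subset_Icc_self hφ)
  have hO : IsOpen ((halfSpace 0 ∩ angleNear 0 ⁻¹' Ioo 0 (2 * Real.pi / n)) ∩
      boundaryFun ρ ⁻¹' Ioi 0) :=
    ((contDiffOn_angleNear 0).continuousOn.isOpen_inter_preimage (isOpen_halfSpace 0)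
      isOpen_Ioo).inter (isOpen_Ioi.preimage (continuous_boundaryFun ρ))
  refine interior_maximal ?_ hO ⟨⟨?_, ?_⟩, ?_⟩
  · rintro x ⟨⟨hx1, hx2⟩, hx3⟩
    rw [mem_sector hρ]
    refine ⟨angleNear 0 x, Ioo_subset_Icc_self hx2, radius x, x 2, radius_pos_of_mem_halfSpace hx1,
      ?_, eq_cyl_angleNear hx1⟩
    rw [mem_preimage, mem_Ioi, boundaryFun] at hx3
    linarith
  · rw [cyl_mem_halfSpace]
    exact mul_pos hr (Real.cos_pos_of_mem_Ioo hm)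
  · rw [mem_preimage, angleNear_cyl hr.ne' hm]
    exact hφ
  · rw [mem_preimage, mem_Ioi, boundaryFun, radius_cyl _ hr.le, cyl_two]
    linarith

theorem frontier_sector_subset (hρ : 2 < ρ) (hn : 8 ≤ n) :
    frontier (sector ρ (1 / n)) ⊆ ⋃ i, sectorFace ρ n i '' (Icc 0 1 ×ˢ Icc 0 1) := by
  intro x hx
  rw [(isClosed_sector hρ).frontier_eq] at hx
  obtain ⟨φ, hφ, r, z, hr, hy, rfl⟩ := (mem_sector hρ).1 hx.1
  have hn0 : (0 : ℝ) < n := by exact_mod_cast (show 0 < n by omega)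
  have hpos : 0 < 2 * Real.pi / n := div_pos Real.two_pi_pos hn0
  obtain ⟨a, ha, ha'⟩ := exists_unit_eq (show (r - ρ) ^ 2 ≤ 1 by nlinarith [sq_nonneg z])
  obtain ⟨b, hb, hb'⟩ := exists_unit_eq (show z ^ 2 ≤ 1 by nlinarith [sq_nonneg (r - ρ)])
  rcases hφ.1.eq_or_lt with h0 | h0
  · refine mem_iUnion.2 ⟨0, (a, b), ⟨ha, hb⟩, ?_⟩
    simp only [sectorFace, ha', hb', ← h0, add_sub_cancel]
  rcases hφ.2.eq_or_lt with h1 | h1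
  · refine mem_iUnion.2 ⟨1, (a, b), ⟨ha, hb⟩, ?_⟩
    simp only [sectorFace, ha', hb', ← h1, add_sub_cancel]
  rcases hy.eq_or_lt with h2 | h2
  · obtain ⟨c, hc, hc1, hc2⟩ := exists_angle_eq h2
    refine mem_iUnion.2 ⟨2, (φ / (2 * Real.pi / n), c), ⟨⟨div_nonneg hφ.1 hpos.le,
      (div_le_one hpos).2 hφ.2⟩, hc⟩, ?_⟩
    simp only [sectorFace, hc1, hc2, mul_div_cancel₀ _ hpos.ne', add_sub_cancel]
  · exact (hx.2 (mem_interior_sector hρ hn ⟨h0, h1⟩ hr h2)).elim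

theorem hasFinitePerimeter_sector (hρ : 2 < ρ) (hn : 8 ≤ n) :
    HasFinitePerimeter (sector ρ (1 / n)) :=
  hasFinitePerimeter_of_frontier_subset (isClosed_sector hρ).measurableSet (isBounded_sector hρ)
    (contDiff_sectorFace ρ n) (frontier_sector_subset hρ hn)

/-! ### The sets bounded by the ribbons in the sector -/

/-- The part of the sector on one side of the ribbon. -/
def sublevel (ρ : ℝ) (n : ℕ) (u τ : ℝ) : Set E3 :=
  sector ρ (1 / n) ∩ {x | localProfile ρ n 0 u τ x < 0}

variable {u τ : ℝ}

theorem continuousOn_localProfile (ρ : ℝ) (n : ℕ) (φ₀ u τ : ℝ) :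
    ContinuousOn (localProfile ρ n φ₀ u τ) (halfSpace φ₀) :=
  (contDiffOn_localProfile_fixed ρ n φ₀ u τ).continuousOn

theorem measurableSet_sublevel (hρ : 2 < ρ) (hn : 8 ≤ n) (u τ : ℝ) :
    MeasurableSet (sublevel ρ n u τ) := by
  have e : sublevel ρ n u τ =
      sector ρ (1 / n) ∩ (halfSpace 0 ∩ localProfile ρ n 0 u τ ⁻¹' Iio 0) := by
    rw [← inter_assoc, inter_eq_left.2 (sector_subset_halfSpace hρ hn)]
    rfl
  rw [e]
  exact (isClosed_sector hρ).measurableSet.inter ((continuousOn_localProfile ρ n 0 u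
    τ).isOpen_inter_preimage (isOpen_halfSpace 0) isOpen_Iio).measurableSet

/-- Inside the sector a strict sign of the profile persists nearby, and then the point is exterior
or interior to the sublevel set. -/
theorem localProfile_eq_zero_of_mem_frontier (hρ : 2 < ρ) (hn : 8 ≤ n) {x : E3}
    (hx : x ∈ frontier (sublevel ρ n u τ)) (hxs : x ∈ interior (sector ρ (1 / n))) :
    localProfile ρ n 0 u τ x = 0 := by
  have hxh := sector_subset_halfSpace hρ hn (interior_subset hxs)
  have hc := (continuousOn_localProfile ρ n 0 u τ).continuousAt ((isOpen_halfSpace 0).mem_nhds hxh)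
  refine le_antisymm (not_lt.1 fun h => ?_) (not_lt.1 fun h => ?_)
  · have h1 := mem_closure_iff_frequently.1 (frontier_subset_closure hx)
    obtain ⟨y, hy, hy'⟩ := (h1.and_eventually (hc.eventually (lt_mem_nhds h))).exists
    exact lt_asymm hy.2 hy'
  · refine hx.2 (mem_interior_iff_mem_nhds.2 ?_)
    filter_upwards [hc.eventually (gt_mem_nhds h), mem_interior_iff_mem_nhds.1 hxs] with y h1 h2
    exact ⟨h2, h1⟩

/-- A parametrisation of the part of the ribbon in the sector. -/
def ribbonFace (ρ : ℝ) (n : ℕ) (u τ : ℝ) (q : ℝ × ℝ) : E3 :=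
  ribbonMap ρ n u τ (2 * Real.pi / n * q.1) (Real.cos (Real.pi * q.2))

/-- The chord coordinate `cos(π q₂)` stays in `[-1, 1]` for every `q`, so the denominator vanishes
nowhere and the face is `C¹` on the whole plane, as the perimeter criterion requires. -/
theorem contDiff_ribbonFace (ρ : ℝ) (n : ℕ) (hu : u ^ 2 < 1) (τ : ℝ) :
    ContDiff ℝ 1 (ribbonFace ρ n u τ) := by
  have hl : ContDiff ℝ 1 fun q : ℝ × ℝ => Real.cos (Real.pi * q.2) := by fun_prop
  have hc : ContDiff ℝ 1 fun q : ℝ × ℝ =>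
      Real.cos (Real.pi * q.2) * Real.cos (n * (2 * Real.pi / n * q.1) / 2) := by fun_prop
  have hs : ContDiff ℝ 1 fun q : ℝ × ℝ =>
      Real.cos (Real.pi * q.2) * Real.sin (n * (2 * Real.pi / n * q.1) / 2) := by fun_prop
  have hd : ∀ q : ℝ × ℝ,
      1 - u * (Real.cos (Real.pi * q.2) * Real.cos (n * (2 * Real.pi / n * q.1) / 2)) ≠ 0 :=
    fun q => (one_sub_mul_pos hu (mul_cos_sq_le (Real.cos_sq_le_one _) _)).ne'
  have hD := contDiff_const (c := (1 : ℝ)).sub (contDiff_const (c := u).mul hc)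
  exact (contDiff_cyl.of_le (by simp)).comp ((contDiff_const.mul contDiff_fst).prodMk
    ((contDiff_const.add ((hc.sub contDiff_const).div hD hd)).prodMk
      ((contDiff_const.mul hs).div hD hd)))

theorem mem_image_ribbonFace (hρ : 2 < ρ) (hn : 8 ≤ n) (hu : u ^ 2 + τ ^ 2 = 1) (hτ : 0 < τ)
    {x : E3} (hx : x ∈ ribbon ρ n u τ) (hxs : x ∈ sector ρ (1 / n)) :
    x ∈ ribbonFace ρ n u τ '' (Icc 0 1 ×ˢ Icc 0 1) := by
  obtain ⟨φ, hφ, r, z, hr, hy, rfl⟩ := (mem_sector hρ).1 hxs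
  obtain ⟨l, hl, hlx⟩ := exists_ribbonMap_eq hu hτ hr hx
  have hl' := abs_le.1 ((sq_le_one_iff_abs_le_one l).1 hl)
  have hn0 : (0 : ℝ) < n := by exact_mod_cast (show 0 < n by omega)
  have hpos : 0 < 2 * Real.pi / n := div_pos Real.two_pi_pos hn0
  refine ⟨(φ / (2 * Real.pi / n), Real.arccos l / Real.pi), ⟨⟨div_nonneg hφ.1 hpos.le,
    (div_le_one hpos).2 hφ.2⟩, ⟨div_nonneg (Real.arccos_nonneg l) Real.pi_pos.le,
    (div_le_one Real.pi_pos).2 (Real.arccos_le_pi l)⟩⟩, ?_⟩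
  simp only [ribbonFace, mul_div_cancel₀ _ hpos.ne', mul_div_cancel₀ _ Real.pi_pos.ne',
    Real.cos_arccos hl'.1 hl'.2, hlx]

theorem hasFinitePerimeter_sublevel (hρ : 2 < ρ) (hn : 8 ≤ n) (hu : u ^ 2 + τ ^ 2 = 1)
    (hτ : 0 < τ) : HasFinitePerimeter (sublevel ρ n u τ) := by
  refine hasFinitePerimeter_of_frontier_subset (measurableSet_sublevel hρ hn u τ)
    ((isBounded_sector hρ).subset inter_subset_left) (ι := Option (Fin 3))
    (f := fun i => i.elim (ribbonFace ρ n u τ) (sectorFace ρ n)) ?_ ?_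
  · rintro (_ | i)
    · exact contDiff_ribbonFace ρ n (by nlinarith) τ
    · exact contDiff_sectorFace ρ n i
  · intro x hx
    have hxc : x ∈ sector ρ (1 / n) :=
      closure_minimal inter_subset_left (isClosed_sector hρ) (frontier_subset_closure hx)
    by_cases hi : x ∈ interior (sector ρ (1 / n))
    · refine mem_iUnion.2 ⟨none, mem_image_ribbonFace hρ hn hu hτ ?_ hxc⟩
      exact (mem_ribbon_iff_localProfile (sector_subset_halfSpace hρ hn hxc)).2
        ⟨sector_subset_toroid hρ hxc, localProfile_eq_zero_of_mem_frontier hρ hn hx hi⟩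
    · have hxf : x ∈ frontier (sector ρ (1 / n)) := by
        rw [(isClosed_sector hρ).frontier_eq]
        exact ⟨hxc, hi⟩
      obtain ⟨i, hi⟩ := mem_iUnion.1 (frontier_sector_subset hρ hn hxf)
      exact mem_iUnion.2 ⟨some i, hi⟩

/-- Moving along a chord changes the sign of the profile. -/
theorem exists_localProfile_pos_and_neg (hρ : 2 < ρ) (hn : 8 ≤ n) (hτ : τ ≠ 0) {x : E3}
    (hxs : x ∈ sector ρ (1 / n)) (hx : localProfile ρ n 0 u τ x = 0) {V : Set E3} (hV : V ∈ 𝓝 x) :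
    (∃ y ∈ V, localProfile ρ n 0 u τ y < 0) ∧ ∃ y ∈ V, 0 < localProfile ρ n 0 u τ y := by
  obtain ⟨φ, hφ, r, z, hr, hy, rfl⟩ := (mem_sector hρ).1 hxs
  have hm := mem_Ioo_of_mem_sectorAngle hn hφ
  -- In the cross-section `profile` is affine with gradient `(sin θ, -τ cos θ)`, of squared length
  -- `κ`. A displacement by `s` times this gradient changes its value by `s κ`.
  set θ := n * φ / 2 with hθ
  set κ := Real.sin θ ^ 2 + τ ^ 2 * Real.cos θ ^ 2 with hκ
  have hκ0 : 0 < κ := by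
    rcases eq_or_ne (Real.cos θ) 0 with h | h
    · have := Real.sin_sq_add_cos_sq θ
      rw [h] at this
      rw [hκ, h]
      linarith
    · positivity
  rw [localProfile_cyl hr hm] at hx
  have hγ : Continuous fun s : ℝ => cyl φ (r + s * Real.sin θ) (z - s * (τ * Real.cos θ)) :=
    contDiff_cyl.continuous.comp (f := fun s : ℝ => (φ, r + s * Real.sin θ, z - s * (τ * Real.cos θ)))
      (by fun_prop)
  have h0 : cyl φ (r + 0 * Real.sin θ) (z - 0 * (τ * Real.cos θ)) = cyl φ r z := by simp
  have hVs : ∀ᶠ s in 𝓝 (0 : ℝ), cyl φ (r + s * Real.sin θ) (z - s * (τ * Real.cos θ)) ∈ V :=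
    hγ.continuousAt.eventually (by beta_reduce; rw [h0]; exact hV)
  have hrs : ∀ᶠ s in 𝓝 (0 : ℝ), 0 < r + s * Real.sin θ := by
    have : ContinuousAt (fun s : ℝ => r + s * Real.sin θ) 0 := by fun_prop
    exact this.eventually (lt_mem_nhds (by simpa using hr))
  have hval : ∀ s, 0 < r + s * Real.sin θ →
      localProfile ρ n 0 u τ (cyl φ (r + s * Real.sin θ) (z - s * (τ * Real.cos θ))) = s * κ := by
    intro s hs
    rw [localProfile_cyl hs hm]
    rw [profile] at hx ⊢
    rw [hκ]
    linear_combination hx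
  constructor
  · obtain ⟨s, ⟨h1, h2⟩, hs⟩ := (((hVs.and hrs).filter_mono (nhdsWithin_le_nhds (s := Iio 0))).and
      self_mem_nhdsWithin).exists
    exact ⟨_, h1, by rw [hval s h2]; exact mul_neg_of_neg_of_pos hs hκ0⟩
  · obtain ⟨s, ⟨h1, h2⟩, hs⟩ := (((hVs.and hrs).filter_mono (nhdsWithin_le_nhds (s := Ioi 0))).and
      self_mem_nhdsWithin).exists
    exact ⟨_, h1, by rw [hval s h2]; exact mul_pos hs hκ0⟩

theorem isRelativePerimeter_sublevel (hρ : 2 < ρ) (hn : 8 ≤ n) (hτ : τ ≠ 0) :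
    IsRelativePerimeter (sector ρ (1 / n)) (sublevel ρ n u τ) (ribbon ρ n u τ) := by
  have hN := isClosed_sector (n := n) hρ
  have hint : ∀ x ∈ sector ρ (1 / n), x ∉ frontier (sector ρ (1 / n)) →
      x ∈ interior (sector ρ (1 / n)) := by
    intro x hx hxf
    by_contra h
    exact hxf (hN.frontier_eq ▸ ⟨hx, h⟩)
  have hzero : ∀ x ∈ ribbon ρ n u τ, x ∈ sector ρ (1 / n) → localProfile ρ n 0 u τ x = 0 :=
    fun x hx hxs => ((mem_ribbon_iff_localProfile (sector_subset_halfSpace hρ hn hxs)).1 hx).2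
  have hcont : ContinuousOn (localProfile ρ n 0 u τ) (interior (sector ρ (1 / n))) :=
    (continuousOn_localProfile ρ n 0 u τ).mono
      (interior_subset.trans (sector_subset_halfSpace hρ hn))
  refine ⟨?_, ?_⟩
  · ext x
    constructor
    · rintro ⟨⟨hxS, hxs⟩, hxf⟩
      have hxi := hint x hxs hxf
      refine ⟨⟨?_, fun hxint => ?_⟩, hxf⟩
      · rw [mem_closure_iff_nhds]
        intro V hV
        obtain ⟨⟨y, hy, hy'⟩, -⟩ := exists_localProfile_pos_and_neg hρ hn hτ hxs (hzero x hxS hxs)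
          (inter_mem hV (isOpen_interior.mem_nhds hxi))
        exact ⟨y, hy.1, interior_subset hy.2, hy'⟩
      · obtain ⟨-, y, hy, hy'⟩ := exists_localProfile_pos_and_neg hρ hn hτ hxs (hzero x hxS hxs)
          (mem_interior_iff_mem_nhds.1 hxint)
        exact lt_asymm hy' hy.2
    · rintro ⟨hx, hxf⟩
      have hxs : x ∈ sector ρ (1 / n) :=
        closure_minimal inter_subset_left hN (frontier_subset_closure hx)
      refine ⟨⟨?_, hxs⟩, hxf⟩
      exact (mem_ribbon_iff_localProfile (sector_subset_halfSpace hρ hn hxs)).2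
        ⟨sector_subset_toroid hρ hxs,
          localProfile_eq_zero_of_mem_frontier hρ hn hx (hint x hxs hxf)⟩
  · rintro x ⟨⟨hxS, hxs⟩, hxf⟩ r hr
    have hxi := hint x hxs hxf
    obtain ⟨⟨y, hy, hy'⟩, w, hw, hw'⟩ := exists_localProfile_pos_and_neg hρ hn hτ hxs
      (hzero x hxS hxs) (inter_mem (Metric.ball_mem_nhds x hr) (isOpen_interior.mem_nhds hxi))
    constructor
    · have hO := (hcont.isOpen_inter_preimage isOpen_interior (isOpen_Iio (a := 0))).inter
        (Metric.isOpen_ball (x := x) (ε := r))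
      -- The strict sign at one point near `x` holds on a nonempty open set, which has positive
      -- volume; the complement is treated with the opposite sign.
      refine (hO.measure_pos volume ⟨y, ⟨hy.2, hy'⟩, hy.1⟩).trans_le (measure_mono ?_)
      rintro v ⟨⟨h1, h2⟩, h3⟩
      exact ⟨⟨interior_subset h1, h2⟩, h3⟩
    · have hO := (hcont.isOpen_inter_preimage isOpen_interior (isOpen_Ioi (a := 0))).inter
        (Metric.isOpen_ball (x := x) (ε := r))
      refine (hO.measure_pos volume ⟨w, ⟨hw.2, hw'⟩, hw.1⟩).trans_le (measure_mono ?_)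
      rintro v ⟨⟨h1, h2⟩, h3⟩
      exact ⟨h3, fun h => lt_asymm (mem_Ioi.1 h2) (mem_ofPred_eq ▸ h.2)⟩

/-! ### The family of sets bounded by the sweep -/

/-- The set bounded by `sweep ρ n t` in the sector. -/
def region (ρ : ℝ) (n : ℕ) (t : ℝ) : Set E3 :=
  -- At `t = 1` the strict sublevel would omit the zeros of `(y₁ - 1) sin θ` in the sector: its two
  -- end faces and the circle arc `y₁ = 1`.
  if t = 1 then sector ρ (1 / n) else
    sublevel ρ n (Real.cos (Real.pi * t)) (Real.sin (Real.pi * t))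

theorem region_one (ρ : ℝ) (n : ℕ) : region ρ n 1 = sector ρ (1 / n) := if_pos rfl

theorem region_of_ne_one (ρ : ℝ) (n : ℕ) {t : ℝ} (ht : t ≠ 1) : region ρ n t =
    sublevel ρ n (Real.cos (Real.pi * t)) (Real.sin (Real.pi * t)) := if_neg ht

theorem mem_region {t : ℝ} {x : E3} (hx : x ∈ sector ρ (1 / n)) :
    x ∈ region ρ n t ↔ t = 1 ∨ familyProfile ρ n 0 (t, x) < 0 := by
  rcases eq_or_ne t 1 with rfl | h
  · rw [region_one]
    exact iff_of_true hx (Or.inl rfl)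
  · rw [region_of_ne_one ρ n h]
    simp only [h, false_or]
    exact ⟨fun h => h.2, fun h => ⟨hx, h⟩⟩

theorem region_subset (ρ : ℝ) (n : ℕ) (t : ℝ) : region ρ n t ⊆ sector ρ (1 / n) := by
  rcases eq_or_ne t 1 with rfl | h
  · rw [region_one]
  · rw [region_of_ne_one ρ n h]
    exact inter_subset_left

theorem measurableSet_region (hρ : 2 < ρ) (hn : 8 ≤ n) (t : ℝ) : MeasurableSet (region ρ n t) := by
  rcases eq_or_ne t 1 with rfl | h
  · rw [region_one]
    exact (isClosed_sector hρ).measurableSet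
  · rw [region_of_ne_one ρ n h]
    exact measurableSet_sublevel hρ hn _ _

theorem sin_nonneg_of_mem_sectorAngle (hn : 8 ≤ n) {φ : ℝ} (hφ : φ ∈ Icc 0 (2 * Real.pi / n)) :
    0 ≤ Real.sin (n * φ / 2) := by
  have hn0 : (0 : ℝ) < n := by exact_mod_cast (show 0 < n by omega)
  have h := hφ.2
  rw [le_div_iff₀ hn0] at h
  have h0 : 0 ≤ n * φ := mul_nonneg hn0.le hφ.1
  exact Real.sin_nonneg_of_nonneg_of_le_pi (by linarith) (by linarith)

/-- At `t = 0` the profile is `(y₁ + 1) sin θ`, which is nonnegative because `θ` runs through `[0,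
π]` on the sector. -/
theorem region_zero (hρ : 2 < ρ) (hn : 8 ≤ n) : region ρ n 0 = ∅ := by
  rw [eq_empty_iff_forall_notMem]
  intro x hx
  have hxs := region_subset ρ n 0 hx
  have h := ((mem_region hxs).1 hx).resolve_left zero_ne_one
  obtain ⟨φ, hφ, r, z, hr, hy, rfl⟩ := (mem_sector hρ).1 hxs
  rw [familyProfile, localProfile_cyl hr (mem_Ioo_of_mem_sectorAngle hn hφ), profile] at h
  simp only [mul_zero, Real.cos_zero, Real.sin_zero, zero_mul, sub_zero] at h
  have h1 := (abs_le.1 ((sq_le_one_iff_abs_le_one (r - ρ)).1 (by nlinarith [sq_nonneg z]))).1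
  exact h.not_ge (mul_nonneg (by linarith) (sin_nonneg_of_mem_sectorAngle hn hφ))

theorem familyProfile_one_nonpos (hρ : 2 < ρ) (hn : 8 ≤ n) {x : E3} (hx : x ∈ sector ρ (1 / n)) :
    familyProfile ρ n 0 (1, x) ≤ 0 := by
  obtain ⟨φ, hφ, r, z, hr, hy, rfl⟩ := (mem_sector hρ).1 hx
  rw [familyProfile, localProfile_cyl hr (mem_Ioo_of_mem_sectorAngle hn hφ), profile]
  simp only [mul_one, Real.cos_pi, Real.sin_pi, zero_mul, sub_zero]
  have h1 := (abs_le.1 ((sq_le_one_iff_abs_le_one (r - ρ)).1 (by nlinarith [sq_nonneg z]))).2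
  exact mul_nonpos_of_nonpos_of_nonneg (by linarith) (sin_nonneg_of_mem_sectorAngle hn hφ)

/-- Off the surface the profile is nonzero at `t₀`, so its sign is locally constant in time. -/
theorem eventually_mem_region_iff (hρ : 2 < ρ) (hn : 8 ≤ n) {t₀ : ℝ} {x : E3}
    (hx : x ∉ sweep ρ n t₀) : ∀ᶠ t in 𝓝 t₀, x ∈ region ρ n t ↔ x ∈ region ρ n t₀ := by
  by_cases hxs : x ∈ sector ρ (1 / n)
  · simp only [mem_region hxs]
    have hxh := sector_subset_halfSpace hρ hn hxs
    have hne : familyProfile ρ n 0 (t₀, x) ≠ 0 := fun h => hx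
      ((mem_ribbon_iff_localProfile hxh).2 ⟨sector_subset_toroid hρ hxs, h⟩)
    have hc : ContinuousAt (fun t => familyProfile ρ n 0 (t, x)) t₀ :=
      ((contDiffOn_familyProfile ρ n 0).continuousOn.continuousAt
        ((isOpen_preimage_halfSpace 0).mem_nhds hxh)).comp (f := fun t => (t, x)) (by fun_prop)
    rcases hne.lt_or_gt with h | h
    · filter_upwards [hc.eventually (gt_mem_nhds h)] with t ht
      simp [ht, h]
    -- A positive profile excludes `t₀ = 1`, so the value prescribed there does not interfere.
    · have h1 : t₀ ≠ 1 := by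
        rintro rfl
        exact h.not_ge (familyProfile_one_nonpos hρ hn hxs)
      filter_upwards [hc.eventually (lt_mem_nhds h), isOpen_ne.mem_nhds h1] with t ht ht1
      simp [ht.not_gt, h.not_gt, h1, show t ≠ 1 from ht1]
  · exact Eventually.of_forall fun t =>
      iff_of_false (fun h => hxs (region_subset ρ n t h)) fun h => hxs (region_subset ρ n t₀ h)

/-- Membership is eventually constant for every point off the null set `sweep ρ n t₀`, and all
regions lie in one sector of finite volume: dominated convergence for indicators. -/
theorem tendsto_volume_symmDiff_region (hρ : 2 < ρ) (hn : 8 ≤ n) {t₀ : ℝ}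
    (hv : volume (sweep ρ n t₀) = 0) (s : Set ℝ) :
    Tendsto (fun t => volume (symmDiff (region ρ n t) (region ρ n t₀))) (𝓝[s] t₀) (𝓝 0) := by
  have key := tendsto_measure_of_ae_tendsto_indicator (μ := (volume : Measure E3)) (𝓝[s] t₀)
    (A := ∅) (As := fun t => symmDiff (region ρ n t) (region ρ n t₀)) MeasurableSet.empty
    (fun t => (measurableSet_region hρ hn t).symmDiff (measurableSet_region hρ hn t₀))
    (isClosed_sector (n := n) hρ).measurableSet (isBounded_sector hρ).measure_lt_top.ne
    (Eventually.of_forall fun t => union_subset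
      (sdiff_subset.trans (region_subset ρ n t)) (sdiff_subset.trans (region_subset ρ n t₀))) ?_
  · simpa using key
  · filter_upwards [measure_eq_zero_iff_ae_notMem.1 hv] with x hx
    filter_upwards [nhdsWithin_le_nhds (eventually_mem_region_iff hρ hn hx)] with t ht
    rw [Set.mem_symmDiff, ht]
    simp

theorem hasFinitePerimeter_region (hρ : 2 < ρ) (hn : 8 ≤ n) {t : ℝ} (ht : t ∈ Icc (0 : ℝ) 1) :
    HasFinitePerimeter (region ρ n t) := by
  rcases eq_or_ne t 1 with rfl | h1
  · rw [region_one]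
    exact hasFinitePerimeter_sector hρ hn
  rcases eq_or_ne t 0 with rfl | h0
  · rw [region_zero hρ hn]
    exact ⟨MeasurableSet.empty, 0, fun X _ _ _ => by simp⟩
  · rw [region_of_ne_one ρ n h1]
    exact hasFinitePerimeter_sublevel hρ hn (Real.cos_sq_add_sin_sq _)
      (sin_pi_pos ⟨ht.1.lt_of_ne' h0, ht.2.lt_of_ne h1⟩)

theorem isRelativePerimeter_region (hρ : 2 < ρ) (hn : 8 ≤ n) {t : ℝ} (ht : t ∈ Ioo (0 : ℝ) 1) :
    IsRelativePerimeter (sector ρ (1 / n)) (region ρ n t) (sweep ρ n t) := by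
  rw [region_of_ne_one ρ n ht.2.ne]
  exact isRelativePerimeter_sublevel hρ hn (sin_pi_pos ht).ne'

end

end Toroid

end

theorem corollary2p6 (ρ : ℝ) (hρ : 2 < ρ) (n : ℕ) (hn : 5 * (ρ + 1) / 2 ≤ (n : ℝ)) :
    ∃ S : ℝ → Set Toroid.E3,
      Toroid.IsSweepout (Toroid.dihedral n) (Toroid.toroid ρ) S ∧
      -- area
      (Toroid.area (S 0) = ENNReal.ofReal (n * Real.pi) ∧
        Toroid.area (S 1) = ENNReal.ofReal (n * Real.pi) ∧
        ∀ t ∈ Set.Icc (0 : ℝ) 1, Toroid.area (S t) < ENNReal.ofReal (2 * n * Real.pi)) ∧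
      -- symmetry
      (∀ t ∈ Set.Ioo (0 : ℝ) 1, ∀ k < 2 * n,
        (Even k → Toroid.segment ρ n k ⊆ S t) ∧
        (Odd k → Toroid.MeetsOrthogonally ρ n k (S t))) ∧
      -- topology
      (∀ t ∈ Set.Ioo (0 : ℝ) 1,
        (Odd n → Nonempty (S t ≃ₜ Toroid.MobiusBand)) ∧
        (Even n → Nonempty (S t ≃ₜ Toroid.Annulus))) ∧
      -- finite perimeter sets in the sector
      (∃ E : ℝ → Set Toroid.E3,
        (∀ t ∈ Set.Icc (0 : ℝ) 1,
          E t ⊆ Toroid.sector ρ (1 / n) ∧ Toroid.HasFinitePerimeter (E t)) ∧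
        (∀ t ∈ Set.Ioo (0 : ℝ) 1,
          Toroid.IsRelativePerimeter (Toroid.sector ρ (1 / n)) (E t) (S t)) ∧
        E 0 = ∅ ∧ E 1 = Toroid.sector ρ (1 / n) ∧
        ∀ t₀ ∈ Set.Icc (0 : ℝ) 1,
          Filter.Tendsto (fun t => MeasureTheory.volume (symmDiff (E t) (E t₀)))
            (nhdsWithin t₀ (Set.Icc 0 1)) (nhds 0)) := by
  -- Since `ρ > 2`, the hypothesis gives `n > 15/2`.
  have h8 : 8 ≤ n := by
    have : (7 : ℝ) < n := by linarith
    exact_mod_cast this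
  have hn0 : n ≠ 0 := by omega
  refine ⟨Toroid.sweep ρ n, ?_, ⟨?_, ?_, fun t ht => Toroid.area_sweep_lt hρ hn ht⟩,
    fun t ht k _ => ⟨fun hk => Toroid.segment_subset_sweep hρ hn0 hk t,
      fun hk => Toroid.meetsOrthogonally_sweep hρ hn0 hk ht⟩,
    fun t ht => ⟨fun ho => Toroid.nonempty_homeomorph_mobiusBand hρ ho (Real.cos_sq_add_sin_sq _)
      (Toroid.sin_pi_pos ht), fun he => Toroid.nonempty_homeomorph_annulus hρ he
      (Real.cos_sq_add_sin_sq _) (Toroid.sin_pi_pos ht)⟩,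
    Toroid.region ρ n, fun t ht => ⟨Toroid.region_subset ρ n t,
      Toroid.hasFinitePerimeter_region hρ h8 ht⟩,
    fun t ht => Toroid.isRelativePerimeter_region hρ h8 ht, Toroid.region_zero hρ h8,
    Toroid.region_one ρ n, fun t₀ ht₀ => Toroid.tendsto_volume_symmDiff_region hρ h8
      (Toroid.volume_sweep hρ hn ht₀) _⟩
  · exact
      { subset := fun t _ => Toroid.ribbon_subset _ _ _ _
        isClosed := fun t _ => Toroid.isClosed_sweep hρ n t
        equivariant := fun t _ => Toroid.isEquivariant_ribbon hρ hn0 _ _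
        properlyEmbedded := fun t ht => Toroid.isProperlyEmbedded_sweep hρ n ht
        smooth := Toroid.variesSmoothly_sweep hρ n
        varifoldContinuous := Toroid.isVarifoldContinuous_sweep hρ hn }
  · rw [Toroid.sweep, mul_zero, Real.sin_zero]
    exact Toroid.area_ribbon_zero hρ hn0 (by simp)
  · rw [Toroid.sweep, mul_one, Real.sin_pi]
    exact Toroid.area_ribbon_zero hρ hn0 (by simp)
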